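/- Let $M$ be a compact connected smooth manifold (without boundary) of dimension $m\ge 1$ and let $(N,g)$ be a connected smooth Riemannian manifold of dimension $n>m$. Let $\mathrm{Imm}(M,N)$ be the set of smooth immersions $M\to N$ and $\pi:\mathrm{Imm}(M,N)\to B_i(M,N)=\mathrm{Imm}(M,N)/\mathrm{Diff}(M)$ the projection onto the quotient by the right action $(f,\varphi)\mapsto f\circ\varphi$ of the diffeomorphism group. For an immersion $f$ let $\mathrm{vol}(f^*g)$ be the volume density of the pullback metric, $\mathrm{Vol}^g(f)=\int_M \mathrm{vol}(f^*g)$, let $S^f(X,Y)=\nabla^g_X(Tf.Y)-Tf.\nabla^{f^*g}_XY$ be the second fundamental form and $\mathrm{Tr}^{f^*g}(S^f)$ the mean curvature (its trace with respect to $f^*g$), and for a vector field $h$ along $f$ let $h^\bot$ be its component $g$-orthogonal to $Tf(TM)$. For $A>0$ and vector fields $h,k$ along $f$ put $$G^A_f(h,k)=\int_M\bigl(1+A\,\|\mathrm{Tr}^{f^*g}(S^f)\|_g^2\bigr)\,g(h,k)\,\mathrm{vol}(f^*g),$$ and for a smooth path $f$ in $\mathrm{Imm}(M,N)$, that is, a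 smooth map $(t,x)\mapsto f(t,x)$ with each $f(t,\cdot)$, $t\in[0,1]$, an immersion, put $L^{\mathrm{hor}}_{G^A}(f)=\int_0^1\sqrt{G^A_{f(t,\cdot)}(f_t^\bot,f_t^\bot)}\,dt$, where $f_t=\partial_t f$. For $F_0,F_1\in B_i(M,N)$ let $$\mathrm{dist}^{B_i}_{G^A}(F_0,F_1)=\inf_f L^{\mathrm{hor}}_{G^A}(f)\in[0,\infty],$$ the infimum over all smooth paths $f$ in $\mathrm{Imm}(M,N)$ with $\pi(f(0,\cdot))=F_0$ and $\pi(f(1,\cdot))=F_1$ (it is $+\infty$ if there is no such path). Then $\mathrm{Vol}^g$ is constant on $\mathrm{Diff}(M)$-orbits, hence defines a function $\mathrm{Vol}^g$ on $B_i(M,N)$, and for all $A>0$ and all $F_0,F_1\in B_i(M,N)$ $$\sqrt{\mathrm{Vol}^g(F_1)}-\sqrt{\mathrm{Vol}^g(F_0)}\le\frac1{2\sqrt A}\,\mathrm{dist}^{B_i}_{G^A}(F_0,F_1).$$ -/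

import Mathlib

open scoped Manifold ContDiff ENNReal

noncomputable section

namespace ImmersionSpace

/-- The `i`-th standard basis vector of `ℝᵏ`. -/
def e {k : ℕ} (i : Fin k) : EuclideanSpace ℝ (Fin k) := EuclideanSpace.single i 1

/-- A smooth Riemannian metric on an `n`-dimensional manifold `N`. -/
abbrev RMetric (n : ℕ) (N : Type*) [TopologicalSpace N] [ChartedSpace (EuclideanSpace ℝ (Fin n)) N]
    [IsManifold (𝓡 n) ∞ N] :=
  Bundle.ContMDiffRiemannianMetric (𝓡 n) ∞ (EuclideanSpace ℝ (Fin n))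
    (fun q : N => TangentSpace (𝓡 n) q)

section Immersions

variable (m n : ℕ)
  (M : Type*) [TopologicalSpace M] [ChartedSpace (EuclideanSpace ℝ (Fin m)) M]
  (N : Type*) [TopologicalSpace N] [ChartedSpace (EuclideanSpace ℝ (Fin n)) N]

/-- `f` is a smooth immersion: a smooth map with injective differential at every point. -/
def IsSmoothImmersion {M : Type*} [TopologicalSpace M] [ChartedSpace (EuclideanSpace ℝ (Fin m)) M]
    {N : Type*} [TopologicalSpace N] [ChartedSpace (EuclideanSpace ℝ (Fin n)) N]
    (f : M → N) : Prop :=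
  ContMDiff (𝓡 m) (𝓡 n) ∞ f ∧ ∀ x, Function.Injective (mfderiv (𝓡 m) (𝓡 n) f x)

/-- `Imm(M, N)`: the set of smooth immersions `M → N`. -/
def Imm := {f : M → N // IsSmoothImmersion m n f}

/-- The orbit relation of the right action of `Diff(M)` on `Imm(M, N)` by composition. -/
instance immSetoid : Setoid (Imm m n M N) where
  r f₁ f₂ := ∃ φ : Diffeomorph (𝓡 m) (𝓡 m) M M ∞, f₂.1 = f₁.1 ∘ φ
  iseqv :=
    { refl := fun _ => ⟨Diffeomorph.refl (𝓡 m) M ∞, rfl⟩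
      symm := fun {f₁ f₂} ⟨φ, h⟩ => ⟨φ.symm, by
        rw [h]; funext x; simp⟩
      trans := fun {f₁ f₂ f₃} ⟨φ, h⟩ ⟨χ, h'⟩ => ⟨χ.trans φ, by
        rw [h', h]; funext x; simp⟩ }

/-- `B_i(M, N) = Imm(M, N) / Diff(M)`. -/
def Bi := Quotient (immSetoid m n M N)

/-- The projection `π : Imm(M, N) → B_i(M, N)`. -/
def proj {m n : ℕ}
    {M : Type*} [TopologicalSpace M] [ChartedSpace (EuclideanSpace ℝ (Fin m)) M]
    {N : Type*} [TopologicalSpace N] [ChartedSpace (EuclideanSpace ℝ (Fin n)) N]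
    (f : Imm m n M N) : Bi m n M N := Quotient.mk _ f

end Immersions

section Geometry

variable {k n : ℕ} {N : Type*} [TopologicalSpace N] [ChartedSpace (EuclideanSpace ℝ (Fin n)) N]
  [IsManifold (𝓡 n) ∞ N]

/-- The coefficients `(F^*g)_{ij} = g(TF.∂_i, TF.∂_j)` of the pullback metric at `p`. If `P = ℝᵏ`,
the `∂_i` are the standard coordinate fields; on a general manifold `P` the vector
`∂_i ∈ T_p P` is the `i`-th coordinate vector of the preferred chart at `p`. -/
def gram {P : Type*} [TopologicalSpace P] [ChartedSpace (EuclideanSpace ℝ (Fin k)) P]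
    (g : RMetric n N) (F : P → N) (p : P) : Matrix (Fin k) (Fin k) ℝ :=
  Matrix.of fun i j =>
    g.inner (F p) (mfderiv (𝓡 k) (𝓡 n) F p (e i)) (mfderiv (𝓡 k) (𝓡 n) F p (e j))

/-- The Christoffel symbol `Γ^l_{ij}` at `u` of the Levi-Civita connection of the metric with
coefficient matrix `γ`:
`Γ^l_{ij} = ½ ∑_p γ^{lp} (∂_i γ_{jp} + ∂_j γ_{ip} - ∂_p γ_{ij})`. -/
def christoffelSymbol (γ : EuclideanSpace ℝ (Fin k) → Matrix (Fin k) (Fin k) ℝ)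
    (u : EuclideanSpace ℝ (Fin k)) (l i j : Fin k) : ℝ :=
  (1 / 2 : ℝ) * ∑ p, (γ u)⁻¹ l p *
    (fderiv ℝ (fun u' => γ u' j p) u (e i) + fderiv ℝ (fun u' => γ u' i p) u (e j)
      - fderiv ℝ (fun u' => γ u' i j) u (e p))

/-- The vector `Γ_u(v, w) = (∑_{ij} Γ^l_{ij}(u) vⁱ wʲ)_l`. -/
def christoffel (γ : EuclideanSpace ℝ (Fin k) → Matrix (Fin k) (Fin k) ℝ)
    (u v w : EuclideanSpace ℝ (Fin k)) : EuclideanSpace ℝ (Fin k) :=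
  WithLp.toLp 2 fun l => ∑ i, ∑ j, christoffelSymbol γ u l i j * v i * w j

end Geometry

section Submanifold

variable {m n : ℕ}
  {M : Type*} [TopologicalSpace M] [ChartedSpace (EuclideanSpace ℝ (Fin m)) M]
  {N : Type*} [TopologicalSpace N] [ChartedSpace (EuclideanSpace ℝ (Fin n)) N]
  [IsManifold (𝓡 n) ∞ N]

/-- The second fundamental form `S^f(v, w) = ∇^g_v (Tf.w) - Tf.∇^{f^*g}_v w` of `f` at `x`.
It is tensorial, and is computed here with the vector field whose coefficients in the preferred
chart `φ` of `M` at `x` are constant, equal to those of `w`. With `ψ` the preferred chart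
of `N` at `f x` and `F = ψ ∘ f ∘ φ⁻¹`,
`∇^g_v (Tf.w) = D²F(v, w) + Γ^g(DF.v, DF.w)` and `∇^{f^*g}_v w = Γ^{f^*g}(v, w)`.
(Mathlib identifies `T_x M` with `ℝᵐ` and `T_{f x} N` with `ℝⁿ` through these very charts.) -/
def secondFundamentalForm (g : RMetric n N) (f : M → N) (x : M)
    (v w : EuclideanSpace ℝ (Fin m)) : TangentSpace (𝓡 n) (f x) :=
  let φ := extChartAt (𝓡 m) x
  let ψ := extChartAt (𝓡 n) (f x)
  let F : EuclideanSpace ℝ (Fin m) → EuclideanSpace ℝ (Fin n) := ψ ∘ f ∘ φ.symm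
  let u : EuclideanSpace ℝ (Fin m) := φ x
  let S : EuclideanSpace ℝ (Fin n) :=
    (fderiv ℝ (fun u' => fderiv ℝ F u' w) u v
        + christoffel (gram g ψ.symm) (F u) (fderiv ℝ F u v) (fderiv ℝ F u w))
      - fderiv ℝ F u (christoffel (gram g (f ∘ φ.symm)) u v w)
  S

/-- The mean curvature `Tr^{f^*g}(S^f) = ∑_{ij} (f^*g)^{ij} S^f(∂_i, ∂_j)` at `x`. -/
def meanCurvature (g : RMetric n N) (f : M → N) (x : M) : TangentSpace (𝓡 n) (f x) :=
  ∑ i : Fin m, ∑ j : Fin m,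
    (gram (k := m) g f x)⁻¹ i j • secondFundamentalForm g f x (e i) (e j)

/-- The normal component `h^⊥ = h - Tf.h^⊤` of `h ∈ T_{f x} N`, where
`h^⊤ = ∑_{ij} (f^*g)^{ij} g(h, Tf.∂_j) ∂_i`. -/
def normalPart (g : RMetric n N) (f : M → N) (x : M) (h : TangentSpace (𝓡 n) (f x)) :
    TangentSpace (𝓡 n) (f x) :=
  h - ∑ i : Fin m, ∑ j : Fin m,
    ((gram (k := m) g f x)⁻¹ i j * g.inner (f x) h (mfderiv (𝓡 m) (𝓡 n) f x (e j))) •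
      mfderiv (𝓡 m) (𝓡 n) f x (e i)

variable [IsManifold (𝓡 m) ∞ M] [CompactSpace M] [T2Space M]

variable (m M) in
/-- A smooth partition of unity on `M`, indexed by the points `c` of `M`, whose `c`-th member has
support in the domain of the preferred chart at `c`. -/
def chartPartition : SmoothPartitionOfUnity M (𝓡 m) M Set.univ :=
  Classical.choose
    (SmoothPartitionOfUnity.exists_isSubordinate_chartAt_source (I := 𝓡 m) (M := M))

/-- The measure on `M` of the volume density `vol(f^*g)`, given in a chart `u` by
`√(det (f^*g)_{ij}) |du¹ ∧ ⋯ ∧ duᵐ|`, and glued with a partition of unity. -/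
def volMeasure [MeasurableSpace M] (g : RMetric n N) (f : M → N) : MeasureTheory.Measure M :=
  MeasureTheory.Measure.sum fun c : M =>
    MeasureTheory.Measure.map (extChartAt (𝓡 m) c).symm
      ((MeasureTheory.volume.restrict (extChartAt (𝓡 m) c).target).withDensity fun u =>
        ENNReal.ofReal (chartPartition m M c ((extChartAt (𝓡 m) c).symm u) *
          √(gram (k := m) g (f ∘ (extChartAt (𝓡 m) c).symm) u).det))

/-- `Vol^g(f) = ∫_M vol(f^*g)`. -/
def Vol [MeasurableSpace M] (g : RMetric n N) (f : M → N) : ℝ :=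
  (volMeasure (m := m) g f).real Set.univ

/-- The metric `G^A_f(h, k) = ∫_M (1 + A ‖Tr^{f^*g}(S^f)‖²) g(h, k) vol(f^*g)` for vector
fields `h, k` along `f`. -/
def GA [MeasurableSpace M] (g : RMetric n N) (A : ℝ) (f : M → N)
    (h k : (x : M) → TangentSpace (𝓡 n) (f x)) : ℝ :=
  ∫ x, (1 + A * g.inner (f x) (meanCurvature (m := m) g f x) (meanCurvature (m := m) g f x)) *
    g.inner (f x) (h x) (k x) ∂(volMeasure (m := m) g f)

/-- The horizontal length
`L^hor_{G^A}(c) = ∫₀¹ √(G^A_{c(t)}(c_t^⊥, c_t^⊥)) dt` of a path `c : ℝ × M → N`. -/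
def horLength [MeasurableSpace M] (g : RMetric n N) (A : ℝ) (c : ℝ × M → N) : ℝ≥0∞ :=
  ∫⁻ t in Set.Icc (0 : ℝ) 1, ENNReal.ofReal
    √(GA (m := m) g A (fun x => c (t, x))
      (fun x => normalPart (m := m) g (fun x => c (t, x)) x
        (mfderiv 𝓘(ℝ, ℝ) (𝓡 n) (fun s => c (s, x)) t (1 : ℝ)))
      (fun x => normalPart (m := m) g (fun x => c (t, x)) x
        (mfderiv 𝓘(ℝ, ℝ) (𝓡 n) (fun s => c (s, x)) t (1 : ℝ))))

/-- `c` is a smooth path in `Imm(M, N)` from `f₀` (at time `0`) to `f₁` (at time `1`): a smooth map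
on `ℝ × M` such that `c(t, ·)` is an immersion for all `t ∈ [0, 1]`. -/
structure IsImmPath (f₀ f₁ : Imm m n M N) (c : ℝ × M → N) : Prop where
  smooth : ContMDiff (𝓘(ℝ, ℝ).prod (𝓡 m)) (𝓡 n) ∞ c
  immersion : ∀ t ∈ Set.Icc (0 : ℝ) 1, IsSmoothImmersion m n fun x => c (t, x)
  source : ∀ x, c (0, x) = f₀.1 x
  target : ∀ x, c (1, x) = f₁.1 x

/-- `dist^{B_i}_{G^A}(F₀, F₁)`: the infimum of the horizontal lengths of all smooth paths in
`Imm(M, N)` between lifts of `F₀` and `F₁` (equal to `∞` if there are none). -/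
def distBi [MeasurableSpace M] (g : RMetric n N) (A : ℝ) (F₀ F₁ : Bi m n M N) : ℝ≥0∞ :=
  ⨅ (f₀ : Imm m n M N) (_ : proj f₀ = F₀) (f₁ : Imm m n M N) (_ : proj f₁ = F₁)
    (c : ℝ × M → N) (_ : IsImmPath f₀ f₁ c), horLength (m := m) g A c

/-- `Vol^g` on `B_i(M, N)`: the volume of a representing immersion. -/
def volBi [MeasurableSpace M] (g : RMetric n N) (F : Bi m n M N) : ℝ :=
  Vol (m := m) g (Quotient.out F).1

end Submanifold

end ImmersionSpace

end

open scoped Manifold ContDiff ENNReal Topology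

noncomputable section

namespace ImmersionSpace

-- Along a path of immersions the volume density changes by a divergence, coming from the tangential
-- part of the velocity, minus `g(Tr S, f_t^⊥)` times the density. The divergence integrates to zero
-- over the closed manifold `M`, so `Vol' = -∫ g(Tr S, f_t^⊥) vol`. Cauchy-Schwarz, first in
-- `L²(vol)` against the constant `1` and then pointwise for `g`, gives `(Vol')² ≤ Vol · ∫ ‖Tr S‖²
-- ‖f_t^⊥‖² vol ≤ Vol · G^A(f_t^⊥, f_t^⊥) / A`. Hence `√Vol` grows at rate at most `√G^A / (2√A)`;
-- integrating over `[0, 1]` and taking the infimum over paths gives the estimate. Invariance of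
-- `Vol` under `Diff(M)` is the change of variables formula.
--
-- The geometry is reduced to one identity, `koszul_pullback`: for a pullback form `B = F^*B'` the
-- Koszul expression of `B` is that of `B'` along `F` plus `B'(D²F, DF)`. Neither invertibility nor
-- injectivity of `DF` is needed. Applied to a coordinate change it gives the transformation law of
-- Christoffel symbols, hence the tensoriality of the second fundamental form; applied to an
-- immersion it gives its normality; applied to a path `C : ℝ × ℝᵐ → ℝⁿ`, whose pullback form may be
-- degenerate, with two spatial arguments and one in the time direction, it gives the first
-- variation of the induced metric (`fderiv_pullback_time`). Together with Jacobi's formula and the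
-- coordinate formula for the divergence this becomes the first variation of the density
-- (`hasDerivAt_sqrt_det`), and chart independence turns it into `hasDerivAt_density`.
--
-- For the global statement let `ρ_a` be the partition of unity that glues the volume measure.
-- Integration by parts in the chart at `a` turns `∫ ρ_a div X` into `-∫ dρ_a(X)`, where `X` is the
-- tangential velocity. The functions `dρ_a(X)` are intrinsic on `M`, and they add up to zero
-- because `∑ ρ_a = 1` (`sum_integral_divergence`). Differentiation under the integral then yields
-- `hasDerivAt_Vol`, and `sqrt_Vol_sub_le_horLength` integrates the resulting differential
-- inequality.

local notation "𝓔" k:max => EuclideanSpace ℝ (Fin k)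

/-! ### Bilinear forms in the standard basis: determinants and traces under base change. -/

section LinearAlgebra

variable {k l m n : ℕ}

lemma e_apply (i j : Fin k) : (e i : 𝓔 k) j = if j = i then 1 else 0 := by
  simp [e]

lemma sum_smul_e (v : 𝓔 k) : ∑ i, v i • (e i : 𝓔 k) = v := by
  ext j
  simp [e_apply]

lemma basisFun_eq_e (i : Fin k) : (EuclideanSpace.basisFun (Fin k) ℝ).toBasis i = e i := by
  simp [e]

/-- The matrix of a bilinear form in the standard basis. -/
def formMatrix (b : 𝓔 k →L[ℝ] 𝓔 k →L[ℝ] ℝ) :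
    Matrix (Fin k) (Fin k) ℝ :=
  Matrix.of fun i j => b (e i) (e j)

lemma bilin_apply_eq_sum {V : Type*} [AddCommGroup V] [Module ℝ V]
    (S : 𝓔 k →ₗ[ℝ] 𝓔 k →ₗ[ℝ] V)
    (v w : 𝓔 k) :
    S v w = ∑ i, ∑ j, (v i * w j) • S (e i) (e j) := by
  conv_lhs => rw [← sum_smul_e v, ← sum_smul_e w]
  simp only [map_sum, LinearMap.sum_apply, map_smul, LinearMap.smul_apply, mul_smul, Finset.smul_sum]
  rw [Finset.sum_comm]
  exact Finset.sum_congr rfl fun i _ => Finset.sum_congr rfl fun j _ => smul_comm _ _ _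

/-- The matrix of a linear endomorphism in the standard basis. -/
def endMatrix (J : 𝓔 k →L[ℝ] 𝓔 k) :
    Matrix (Fin k) (Fin k) ℝ :=
  Matrix.of fun i j => J (e j) i

lemma endMatrix_det (J : 𝓔 k →L[ℝ] 𝓔 k) :
    (endMatrix J).det = J.det := by
  rw [ContinuousLinearMap.det, ← LinearMap.det_toMatrix (EuclideanSpace.basisFun (Fin k) ℝ).toBasis]
  congr 1

lemma formMatrix_comp
    (b b' : 𝓔 k →L[ℝ] 𝓔 k →L[ℝ] ℝ)
    (J : 𝓔 k →L[ℝ] 𝓔 k)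
    (h : ∀ v w, b' v w = b (J v) (J w)) :
    formMatrix b' = (endMatrix J).transpose * formMatrix b * endMatrix J := by
  ext i j
  have : b (J (e i)) (J (e j)) = _ := bilin_apply_eq_sum (b.toLinearMap₁₂) (J (e i)) (J (e j))
  simp only [formMatrix, Matrix.of_apply, h, this, Matrix.mul_apply, endMatrix,
    Matrix.transpose_apply, Finset.sum_mul, smul_eq_mul]
  rw [Finset.sum_comm]
  refine Finset.sum_congr rfl fun a _ => Finset.sum_congr rfl fun c _ => ?_
  rw [ContinuousLinearMap.toLinearMap₁₂_apply_apply_apply]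
  ring

/-- Under the square root the factor becomes `|det J|`, the Jacobian in the change of variables
formula; this is why the volume density is well defined. -/
lemma formMatrix_det_comp
    (b b' : 𝓔 k →L[ℝ] 𝓔 k →L[ℝ] ℝ)
    (J : 𝓔 k →L[ℝ] 𝓔 k)
    (h : ∀ v w, b' v w = b (J v) (J w)) :
    (formMatrix b').det = J.det ^ 2 * (formMatrix b).det := by
  rw [formMatrix_comp b b' J h, Matrix.det_mul, Matrix.det_mul, Matrix.det_transpose,
    endMatrix_det]
  ring

/-- The trace of a bilinear map with respect to the bilinear form with matrix `γ`. -/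
def formTrace {V : Type*} [AddCommGroup V] [Module ℝ V] (γ : Matrix (Fin k) (Fin k) ℝ)
    (S : 𝓔 k → 𝓔 k → V) : V :=
  ∑ i, ∑ j, γ⁻¹ i j • S (e i) (e j)

/-- The inverse matrix is contravariant, `J (JᵀγJ)⁻¹ Jᵀ = γ⁻¹`, and so absorbs the two factors `J`
inside `S`. Every chart-independence statement about traces below rests on this. -/
lemma formTrace_comp {V : Type*} [AddCommGroup V] [Module ℝ V]
    (b b' : 𝓔 k →L[ℝ] 𝓔 k →L[ℝ] ℝ)
    (J : 𝓔 k →L[ℝ] 𝓔 k) (hJ : J.det ≠ 0)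
    (h : ∀ v w, b' v w = b (J v) (J w))
    (S : 𝓔 k →ₗ[ℝ] 𝓔 k →ₗ[ℝ] V) :
    formTrace (formMatrix b') (fun v w => S (J v) (J w)) =
      formTrace (formMatrix b) (fun v w => S v w) := by
  have hu : IsUnit (endMatrix J).det := by rw [endMatrix_det]; exact hJ.isUnit
  have hut : IsUnit (endMatrix J).transpose.det := by rwa [Matrix.det_transpose]
  have key : endMatrix J * (formMatrix b')⁻¹ * (endMatrix J).transpose = (formMatrix b)⁻¹ := by
    rw [formMatrix_comp b b' J h, Matrix.mul_inv_rev, Matrix.mul_inv_rev, ← mul_assoc,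
      Matrix.mul_nonsing_inv _ hu, one_mul, mul_assoc, Matrix.nonsing_inv_mul _ hut, mul_one]
  simp only [formTrace]
  rw [← key]
  simp_rw [fun i j => bilin_apply_eq_sum S (J (e i)) (J (e j)), Finset.smul_sum, smul_smul,
    Matrix.mul_apply, Finset.sum_mul, Finset.sum_smul, endMatrix, Matrix.transpose_apply,
    Matrix.of_apply]
  calc _ = ∑ i, ∑ a, ∑ j, ∑ c, ((formMatrix b')⁻¹ i j * (J (e i) a * J (e j) c)) • S (e a) (e c) :=
        Finset.sum_congr rfl fun i _ => Finset.sum_comm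
    _ = ∑ a, ∑ i, ∑ j, ∑ c, ((formMatrix b')⁻¹ i j * (J (e i) a * J (e j) c)) • S (e a) (e c) :=
        Finset.sum_comm
    _ = ∑ a, ∑ i, ∑ c, ∑ j, ((formMatrix b')⁻¹ i j * (J (e i) a * J (e j) c)) • S (e a) (e c) :=
        Finset.sum_congr rfl fun i _ => Finset.sum_congr rfl fun j _ => Finset.sum_comm
    _ = ∑ a, ∑ c, ∑ i, ∑ j, ((formMatrix b')⁻¹ i j * (J (e i) a * J (e j) c)) • S (e a) (e c) :=
        Finset.sum_congr rfl fun i _ => Finset.sum_comm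
    _ = ∑ a, ∑ c, ∑ j, ∑ i, ((formMatrix b')⁻¹ i j * (J (e i) a * J (e j) c)) • S (e a) (e c) :=
        Finset.sum_congr rfl fun i _ => Finset.sum_congr rfl fun j _ => Finset.sum_comm
    _ = _ := Finset.sum_congr rfl fun i _ => Finset.sum_congr rfl fun j _ =>
        Finset.sum_congr rfl fun a _ => Finset.sum_congr rfl fun c _ => by
          congr 1; ring

lemma clm_bijective_of_det_ne_zero
    (J : 𝓔 k →L[ℝ] 𝓔 k) (hJ : J.det ≠ 0) :
    Function.Bijective J := by
  exact (Module.End.isUnit_iff _).1 ((LinearMap.isUnit_iff_isUnit_det _).2 hJ.isUnit)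

end LinearAlgebra

/-! ### The Koszul expression and its behaviour under pullback. -/

section Koszul

variable {V W : Type*} [NormedAddCommGroup V] [NormedSpace ℝ V]
  [NormedAddCommGroup W] [NormedSpace ℝ W]

/-- The right-hand side of the Koszul formula for constant vector fields. -/
def koszul (B : V → V →L[ℝ] V →L[ℝ] ℝ) (u v w z : V) : ℝ :=
  (1 / 2 : ℝ) * (fderiv ℝ B u v w z + fderiv ℝ B u w v z - fderiv ℝ B u z v w)

/-- `koszul` as a trilinear map. -/
def koszulTrilin (B : V → V →L[ℝ] V →L[ℝ] ℝ) (u : V) : V →ₗ[ℝ] V →ₗ[ℝ] V →ₗ[ℝ] ℝ :=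
  LinearMap.mk₂ ℝ
    (fun v w =>
      { toFun := koszul B u v w
        map_add' := fun a b => by simp [koszul]; ring
        map_smul' := fun r a => by simp [koszul]; ring })
    (fun a b c => by ext z; simp [koszul]; ring)
    (fun r a b => by ext z; simp [koszul]; ring)
    (fun a b c => by ext z; simp [koszul]; ring)
    (fun r a b => by ext z; simp [koszul]; ring)

lemma fderiv_form_apply {X : Type*} [NormedAddCommGroup X] [NormedSpace ℝ X]
    {B : X → V →L[ℝ] V →L[ℝ] ℝ} {u : X}
    (hB : DifferentiableAt ℝ B u) (x : X) (v w : V) :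
    fderiv ℝ (fun u' => B u' v w) u x = fderiv ℝ B u x v w := by
  have h := (hB.hasFDerivAt.clm_apply (hasFDerivAt_const v u)).clm_apply (hasFDerivAt_const w u)
  rw [h.fderiv]
  simp

lemma fderiv_pullback {F : V → W} {B : V → V →L[ℝ] V →L[ℝ] ℝ} {B' : W → W →L[ℝ] W →L[ℝ] ℝ} {u : V}
    (hF : ContDiffAt ℝ 2 F u) (hB' : DifferentiableAt ℝ B' (F u)) (hB : DifferentiableAt ℝ B u)
    (h : ∀ᶠ u' in 𝓝 u, ∀ v w, B u' v w = B' (F u') (fderiv ℝ F u' v) (fderiv ℝ F u' w))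
    (x v w : V) :
    fderiv ℝ B u x v w =
      fderiv ℝ B' (F u) (fderiv ℝ F u x) (fderiv ℝ F u v) (fderiv ℝ F u w)
      + B' (F u) (fderiv ℝ (fderiv ℝ F) u x v) (fderiv ℝ F u w)
      + B' (F u) (fderiv ℝ F u v) (fderiv ℝ (fderiv ℝ F) u x w) := by
  rw [← fderiv_form_apply hB]
  have hd : HasFDerivAt F (fderiv ℝ F u) u := (hF.differentiableAt (by norm_num)).hasFDerivAt
  have hdd : HasFDerivAt (fderiv ℝ F) (fderiv ℝ (fderiv ℝ F) u) u :=
    ((hF.fderiv_right (m := 1) (by norm_num)).differentiableAt (by norm_num)).hasFDerivAt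
  have hc : HasFDerivAt (fun u' => B' (F u')) ((fderiv ℝ B' (F u)).comp (fderiv ℝ F u)) u :=
    HasFDerivAt.comp (g := B') u hB'.hasFDerivAt hd
  have h1 := (hc.clm_apply (hdd.clm_apply (hasFDerivAt_const v u))).clm_apply
    (hdd.clm_apply (hasFDerivAt_const w u))
  have h2 : (fun u' => B u' v w) =ᶠ[𝓝 u]
      fun u' => B' (F u') (fderiv ℝ F u' v) (fderiv ℝ F u' w) := h.mono fun u' hu' => hu' v w
  rw [h2.fderiv_eq]
  rw [h1.fderiv]
  simp
  ring

/-- The product rule produces six terms with a second derivative of `F`. By symmetry of `D²F` and of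
the form four of them cancel, and the other two agree and use up the factor `1/2`. The derivative of
`F` may be degenerate. -/
lemma koszul_pullback {F : V → W} {B : V → V →L[ℝ] V →L[ℝ] ℝ} {B' : W → W →L[ℝ] W →L[ℝ] ℝ} {u : V}
    (hF : ContDiffAt ℝ 2 F u) (hB' : DifferentiableAt ℝ B' (F u)) (hB : DifferentiableAt ℝ B u)
    (hsymm : ∀ a b, B' (F u) a b = B' (F u) b a)
    (h : ∀ᶠ u' in 𝓝 u, ∀ v w, B u' v w = B' (F u') (fderiv ℝ F u' v) (fderiv ℝ F u' w))
    (v w z : V) :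
    koszul B u v w z = koszul B' (F u) (fderiv ℝ F u v) (fderiv ℝ F u w) (fderiv ℝ F u z)
      + B' (F u) (fderiv ℝ (fderiv ℝ F) u v w) (fderiv ℝ F u z) := by
  have hs : IsSymmSndFDerivAt ℝ F u := hF.isSymmSndFDerivAt (by simp)
  simp only [koszul, fderiv_pullback hF hB' hB h]
  rw [hs w v, hs z v, hs z w, hsymm (fderiv ℝ F u v) (fderiv ℝ (fderiv ℝ F) u w z),
    hsymm (fderiv ℝ F u w)]
  ring

lemma fderiv_fderiv_apply {F : V → W} {u : V} (hF : ContDiffAt ℝ 2 F u) (v w : V) :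
    fderiv ℝ (fun u' => fderiv ℝ F u' w) u v = fderiv ℝ (fderiv ℝ F) u v w := by
  have hdd : HasFDerivAt (fderiv ℝ F) (fderiv ℝ (fderiv ℝ F) u) u :=
    ((hF.fderiv_right (m := 1) (by norm_num)).differentiableAt (by norm_num)).hasFDerivAt
  rw [(hdd.clm_apply (hasFDerivAt_const w u)).fderiv]
  simp

lemma fderiv_fderiv_comp {X : Type*} [NormedAddCommGroup X] [NormedSpace ℝ X]
    {F : V → W} {H : W → X} {K : V → X} {u : V} (hF : ContDiffAt ℝ 2 F u)
    (hH : ContDiffAt ℝ 2 H (F u)) (hK : K =ᶠ[𝓝 u] H ∘ F) (v w : V) :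
    fderiv ℝ (fderiv ℝ K) u v w =
      fderiv ℝ (fderiv ℝ H) (F u) (fderiv ℝ F u v) (fderiv ℝ F u w)
        + fderiv ℝ H (F u) (fderiv ℝ (fderiv ℝ F) u v w) := by
  have hd : HasFDerivAt F (fderiv ℝ F u) u := (hF.differentiableAt (by norm_num)).hasFDerivAt
  have hdd : HasFDerivAt (fderiv ℝ F) (fderiv ℝ (fderiv ℝ F) u) u :=
    ((hF.fderiv_right (m := 1) (by norm_num)).differentiableAt (by norm_num)).hasFDerivAt
  have hHdd : HasFDerivAt (fderiv ℝ H) (fderiv ℝ (fderiv ℝ H) (F u)) (F u) :=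
    ((hH.fderiv_right (m := 1) (by norm_num)).differentiableAt (by norm_num)).hasFDerivAt
  have h1 : fderiv ℝ K =ᶠ[𝓝 u] fun u' => (fderiv ℝ H (F u')).comp (fderiv ℝ F u') := by
    have e1 := hF.eventually (by simp)
    have e2 := hF.continuousAt.eventually (hH.eventually (by simp))
    filter_upwards [hK.fderiv (𝕜 := ℝ), e1, e2] with u' hu' h1 h2
    rw [hu']
    exact fderiv_comp _ (h2.differentiableAt (by norm_num)) (h1.differentiableAt (by norm_num))
  rw [h1.fderiv_eq]
  have hc : HasFDerivAt (fun u' => fderiv ℝ H (F u'))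
    ((fderiv ℝ (fderiv ℝ H) (F u)).comp (fderiv ℝ F u)) u :=
    HasFDerivAt.comp (g := fderiv ℝ H) u hHdd hd
  rw [(hc.clm_comp hdd).fderiv]
  simp [add_comm]

end Koszul

/-! ### Christoffel symbols as the solution of the Koszul formula. -/

section Christoffel

variable {k : ℕ}

/-- `christoffel` as a bilinear map. -/
def christoffelBilin (γ : 𝓔 k → Matrix (Fin k) (Fin k) ℝ) (u : 𝓔 k) : 𝓔 k →ₗ[ℝ] 𝓔 k →ₗ[ℝ] 𝓔 k :=
  LinearMap.mk₂ ℝ (christoffel γ u)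
    (fun a b c => by
      ext l; simp [christoffel, ← Finset.sum_add_distrib]
      exact Finset.sum_congr rfl fun i _ => Finset.sum_congr rfl fun j _ => by ring)
    (fun r a b => by
      ext l; simp [christoffel, Finset.mul_sum]
      exact Finset.sum_congr rfl fun i _ => Finset.sum_congr rfl fun j _ => by ring)
    (fun a b c => by
      ext l; simp [christoffel, ← Finset.sum_add_distrib]
      exact Finset.sum_congr rfl fun i _ => Finset.sum_congr rfl fun j _ => by ring)
    (fun r a b => by
      ext l; simp [christoffel, Finset.mul_sum]
      exact Finset.sum_congr rfl fun i _ => Finset.sum_congr rfl fun j _ => by ring)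

lemma formMatrix_symm {b : 𝓔 k →L[ℝ] 𝓔 k →L[ℝ] ℝ} (hs : ∀ v w, b v w = b w v) (i j : Fin k) :
    formMatrix b i j = formMatrix b j i := hs _ _

lemma christoffel_e_apply (γ : 𝓔 k → Matrix (Fin k) (Fin k) ℝ) (u : 𝓔 k) (i j l : Fin k) :
    christoffel γ u (e i) (e j) l = christoffelSymbol γ u l i j := by
  simp [christoffel, e_apply]

/-- Lowering the index cancels the inverse matrix in `Γ`. Both sides are trilinear, so basis vectors
suffice. Later arguments manipulate `Γ` only through this pairing, never through its coordinates. -/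
lemma form_christoffel {B : 𝓔 k → 𝓔 k →L[ℝ] 𝓔 k →L[ℝ] ℝ} {u : 𝓔 k} (hB : DifferentiableAt ℝ B u)
    (hs : ∀ v w, B u v w = B u w v) (hdet : (formMatrix (B u)).det ≠ 0) (v w z : 𝓔 k) :
    B u (christoffel (fun u' => formMatrix (B u')) u v w) z = koszul B u v w z := by
  set γ : 𝓔 k → Matrix (Fin k) (Fin k) ℝ := fun u' => formMatrix (B u') with hγ
  have hd : ∀ i j p, fderiv ℝ (fun u' => γ u' i j) u (e p) = fderiv ℝ B u (e p) (e i) (e j) :=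
    fun i j p => fderiv_form_apply hB (e p) (e i) (e j)
  have hinv : ∀ q p, ∑ l, B u (e l) (e q) * (γ u)⁻¹ l p = if q = p then 1 else 0 := by
    intro q p
    have := congrFun (congrFun (Matrix.mul_nonsing_inv (γ u) hdet.isUnit) q) p
    rw [Matrix.mul_apply, Matrix.one_apply] at this
    rw [← this]
    exact Finset.sum_congr rfl fun l _ => by rw [hs]; rfl
  have basis : ∀ i j q, B u (christoffel γ u (e i) (e j)) (e q) = koszul B u (e i) (e j) (e q) := by
    intro i j q
    rw [← sum_smul_e (christoffel γ u (e i) (e j))]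
    simp only [map_sum, map_smul, sum_apply, smul_apply,
      smul_eq_mul, christoffel_e_apply, christoffelSymbol, hd]
    calc _ = ∑ p, (∑ l, B u (e l) (e q) * (γ u)⁻¹ l p) * ((1 / 2 : ℝ) *
          (fderiv ℝ B u (e i) (e j) (e p) + fderiv ℝ B u (e j) (e i) (e p)
            - fderiv ℝ B u (e p) (e i) (e j))) := by
          simp_rw [Finset.mul_sum, Finset.sum_mul]
          rw [Finset.sum_comm]
          exact Finset.sum_congr rfl fun i _ => Finset.sum_congr rfl fun j _ => by ring
      _ = _ := by simp [hinv, koszul]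
  have ext3 : (christoffelBilin γ u).compr₂ (B u).toLinearMap₁₂ = koszulTrilin B u := by
    refine (EuclideanSpace.basisFun (Fin k) ℝ).toBasis.ext fun i =>
      (EuclideanSpace.basisFun (Fin k) ℝ).toBasis.ext fun j =>
      (EuclideanSpace.basisFun (Fin k) ℝ).toBasis.ext fun q => ?_
    simp only [basisFun_eq_e]
    exact basis i j q
  exact congrArg (fun T => T v w z) ext3

end Christoffel

/-! ### Second fundamental form in coordinates: tensoriality, normality, variation of the metric. -/

section MetricForms

variable {k m n : ℕ}

/-- Symmetric positive definite bilinear forms. -/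
structure IsInnerForm {V : Type*} [NormedAddCommGroup V] [NormedSpace ℝ V]
    (b : V →L[ℝ] V →L[ℝ] ℝ) : Prop where
  symm : ∀ v w, b v w = b w v
  pos : ∀ v, v ≠ 0 → 0 < b v v

lemma IsInnerForm.eq_zero {V : Type*} [NormedAddCommGroup V] [NormedSpace ℝ V]
    {b : V →L[ℝ] V →L[ℝ] ℝ} (hb : IsInnerForm b) {v : V} (h : ∀ w, b v w = 0) : v = 0 := by
  by_contra hv
  exact (hb.pos v hv).ne' (h v)

lemma IsInnerForm.posDef {b : 𝓔 k →L[ℝ] 𝓔 k →L[ℝ] ℝ} (hb : IsInnerForm b) :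
    (formMatrix b).PosDef := by
  refine Matrix.PosDef.of_dotProduct_mulVec_pos ?_ fun x hx => ?_
  · ext i j
    simp [formMatrix, hb.symm (e i)]
  · have h : b (WithLp.toLp 2 x) (WithLp.toLp 2 x) = _ :=
      bilin_apply_eq_sum b.toLinearMap₁₂ (WithLp.toLp 2 x) (WithLp.toLp 2 x)
    have h2 : 0 < b (WithLp.toLp 2 x) (WithLp.toLp 2 x) := hb.pos _ (by simpa using hx)
    rw [h] at h2
    refine h2.trans_eq ?_
    simp only [dotProduct, Matrix.mulVec, star_trivial, Finset.mul_sum, formMatrix, smul_eq_mul,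
      ContinuousLinearMap.toLinearMap₁₂_apply_apply_apply, Matrix.of_apply]
    exact Finset.sum_congr rfl fun i _ => Finset.sum_congr rfl fun j _ => by ring

lemma IsInnerForm.det_pos {b : 𝓔 k →L[ℝ] 𝓔 k →L[ℝ] ℝ} (hb : IsInnerForm b) :
    0 < (formMatrix b).det := hb.posDef.det_pos

/-- Near `u`, the field of forms `B` is the pullback of `B'` by `F`. -/
def IsPullbackAt {V W : Type*} [NormedAddCommGroup V] [NormedSpace ℝ V]
    [NormedAddCommGroup W] [NormedSpace ℝ W] (F : V → W) (B' : W → W →L[ℝ] W →L[ℝ] ℝ)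
    (B : V → V →L[ℝ] V →L[ℝ] ℝ) (u : V) : Prop :=
  ∀ᶠ u' in 𝓝 u, ∀ v w, B u' v w = B' (F u') (fderiv ℝ F u' v) (fderiv ℝ F u' w)

/-- Nondegeneracy of `B'` lets both sides be compared by pairing them with vectors `DΦ z`, which
exhaust the space as `DΦ` is bijective. The paired identity is `koszul_pullback`. -/
lemma christoffel_pullback {Φ : 𝓔 k → 𝓔 k} {B B' : 𝓔 k → 𝓔 k →L[ℝ] 𝓔 k →L[ℝ] ℝ} {u : 𝓔 k}
    (hΦ : ContDiffAt ℝ 2 Φ u) (hdet : (fderiv ℝ Φ u).det ≠ 0)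
    (hB' : DifferentiableAt ℝ B' (Φ u)) (hB : DifferentiableAt ℝ B u)
    (hm' : IsInnerForm (B' (Φ u))) (hm : IsInnerForm (B u)) (h : IsPullbackAt Φ B' B u)
    (v w : 𝓔 k) :
    fderiv ℝ Φ u (christoffel (fun u' => formMatrix (B u')) u v w) =
      fderiv ℝ (fderiv ℝ Φ) u v w +
        christoffel (fun y => formMatrix (B' y)) (Φ u) (fderiv ℝ Φ u v) (fderiv ℝ Φ u w) := by
  rw [← sub_eq_zero]
  refine hm'.eq_zero fun y => ?_
  obtain ⟨z, rfl⟩ := (clm_bijective_of_det_ne_zero _ hdet).surjective y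
  rw [map_sub, map_add, sub_apply, add_apply, ← h.self_of_nhds,
    form_christoffel hB hm.symm hm.det_pos.ne', form_christoffel hB' hm'.symm hm'.det_pos.ne',
    koszul_pullback hΦ hB' hB hm'.symm h]
  ring

/-- The second fundamental form of `F` in coordinates, for the metric `B` on the target and
the metric `β` on the source. -/
def sff (B : 𝓔 n → 𝓔 n →L[ℝ] 𝓔 n →L[ℝ] ℝ) (β : 𝓔 m → 𝓔 m →L[ℝ] 𝓔 m →L[ℝ] ℝ) (F : 𝓔 m → 𝓔 n)
    (u v w : 𝓔 m) : 𝓔 n :=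
  (fderiv ℝ (fun u' => fderiv ℝ F u' w) u v
      + christoffel (fun y => formMatrix (B y)) (F u) (fderiv ℝ F u v) (fderiv ℝ F u w))
    - fderiv ℝ F u (christoffel (fun u' => formMatrix (β u')) u v w)

variable {B B' : 𝓔 n → 𝓔 n →L[ℝ] 𝓔 n →L[ℝ] ℝ} {β β' : 𝓔 m → 𝓔 m →L[ℝ] 𝓔 m →L[ℝ] ℝ}
  {F F' : 𝓔 m → 𝓔 n} {u : 𝓔 m}

/-- Provides the bilinearity that `formTrace_comp` requires. -/
lemma exists_sff_bilin (hF : ContDiffAt ℝ 2 F u) :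
    ∃ S : 𝓔 m →ₗ[ℝ] 𝓔 m →ₗ[ℝ] 𝓔 n, ∀ v w, S v w = sff B β F u v w := by
  refine ⟨(fderiv ℝ (fderiv ℝ F) u).toLinearMap₁₂ +
    (christoffelBilin (fun y => formMatrix (B y)) (F u)).compl₁₂ (fderiv ℝ F u).toLinearMap
      (fderiv ℝ F u).toLinearMap -
    (christoffelBilin (fun u' => formMatrix (β u')) u).compr₂ (fderiv ℝ F u).toLinearMap,
    fun v w => ?_⟩
  rw [sff, fderiv_fderiv_apply hF]
  rfl

/-- The pairing of `DF z` with `DF Γ^β(v, w)` is the Koszul expression of `β`; by `koszul_pullback`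
this is exactly its pairing with the remaining two terms of the second fundamental form. -/
lemma sff_normal (hF : ContDiffAt ℝ 2 F u) (hB : DifferentiableAt ℝ B (F u))
    (hβ : DifferentiableAt ℝ β u) (hmB : IsInnerForm (B (F u))) (hmβ : IsInnerForm (β u))
    (h : IsPullbackAt F B β u) (v w z : 𝓔 m) :
    B (F u) (sff B β F u v w) (fderiv ℝ F u z) = 0 := by
  rw [sff, fderiv_fderiv_apply hF, map_sub, map_add, sub_apply, add_apply, ← h.self_of_nhds,
    form_christoffel hβ hmβ.symm hmβ.det_pos.ne', form_christoffel hB hmB.symm hmB.det_pos.ne',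
    koszul_pullback hF hB hβ hmB.symm h]
  ring

/-- The chain rule for second derivatives creates the extra term `DF(D²Φ)`, and the inhomogeneous
term in the transformation law of the source Christoffel symbols removes it. -/
lemma sff_comp_right {Φ : 𝓔 m → 𝓔 m} (hΦ : ContDiffAt ℝ 2 Φ u)
    (hdet : (fderiv ℝ Φ u).det ≠ 0) (hF : ContDiffAt ℝ 2 F (Φ u)) (hF' : F' =ᶠ[𝓝 u] F ∘ Φ)
    (hβ : DifferentiableAt ℝ β (Φ u)) (hβ' : DifferentiableAt ℝ β' u)
    (hm : IsInnerForm (β (Φ u))) (hm' : IsInnerForm (β' u)) (h : IsPullbackAt Φ β β' u)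
    (v w : 𝓔 m) :
    sff B β' F' u v w = sff B β F (Φ u) (fderiv ℝ Φ u v) (fderiv ℝ Φ u w) := by
  have hd : fderiv ℝ F' u = (fderiv ℝ F (Φ u)).comp (fderiv ℝ Φ u) := by
    rw [hF'.fderiv_eq]
    exact fderiv_comp _ (hF.differentiableAt (by norm_num)) (hΦ.differentiableAt (by norm_num))
  have hc : ContDiffAt ℝ 2 F' u := (hF.comp u hΦ).congr_of_eventuallyEq hF'
  rw [sff, sff, fderiv_fderiv_apply hc, fderiv_fderiv_apply hF, fderiv_fderiv_comp hΦ hF hF', hd,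
    hF'.self_of_nhds]
  simp only [ContinuousLinearMap.comp_apply, Function.comp_apply]
  rw [christoffel_pullback hΦ hdet hβ hβ' hm hm' h, map_add]
  abel

/-- Here the extra term `D²Ψ(DF, DF)` is what turns the Christoffel symbols of `B'` into the image
under `DΨ` of those of `B`. -/
lemma sff_comp_left {Ψ : 𝓔 n → 𝓔 n} (hF : ContDiffAt ℝ 2 F u) (hΨ : ContDiffAt ℝ 2 Ψ (F u))
    (hdet : (fderiv ℝ Ψ (F u)).det ≠ 0) (hF' : F' =ᶠ[𝓝 u] Ψ ∘ F)
    (hB' : DifferentiableAt ℝ B' (Ψ (F u))) (hB : DifferentiableAt ℝ B (F u))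
    (hm' : IsInnerForm (B' (Ψ (F u)))) (hm : IsInnerForm (B (F u)))
    (h : IsPullbackAt Ψ B' B (F u)) (v w : 𝓔 m) :
    sff B' β F' u v w = fderiv ℝ Ψ (F u) (sff B β F u v w) := by
  have hd : fderiv ℝ F' u = (fderiv ℝ Ψ (F u)).comp (fderiv ℝ F u) := by
    rw [hF'.fderiv_eq]
    exact fderiv_comp _ (hΨ.differentiableAt (by norm_num)) (hF.differentiableAt (by norm_num))
  have hc : ContDiffAt ℝ 2 F' u := (hΨ.comp u hF).congr_of_eventuallyEq hF'
  rw [sff, sff, fderiv_fderiv_apply hc, fderiv_fderiv_apply hF, fderiv_fderiv_comp hF hΨ hF', hd,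
    hF'.self_of_nhds]
  simp only [ContinuousLinearMap.comp_apply, Function.comp_apply, map_sub, map_add]
  rw [christoffel_pullback hΨ hdet hB' hB hm' hm h]
  abel

/-- The first variation of the pullback metric, in coordinates. -/
lemma fderiv_pullback_time {C : ℝ × 𝓔 m → 𝓔 n} {t : ℝ}
    {D : ℝ × 𝓔 m → (ℝ × 𝓔 m) →L[ℝ] (ℝ × 𝓔 m) →L[ℝ] ℝ}
    (hC : ContDiffAt ℝ 2 C (t, u)) (hB : DifferentiableAt ℝ B (C (t, u)))
    (hD : DifferentiableAt ℝ D (t, u)) (hm : IsInnerForm (B (C (t, u))))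
    (h : IsPullbackAt C B D (t, u)) (v w : 𝓔 m) :
    (1 / 2 : ℝ) * fderiv ℝ D (t, u) (1, 0) (0, v) (0, w) =
      (1 / 2 : ℝ) * (fderiv ℝ D (t, u) (0, v) (0, w) (1, 0)
        + fderiv ℝ D (t, u) (0, w) (0, v) (1, 0))
      - D (t, u) (0, christoffel (fun u' => formMatrix (β u')) u v w) (1, 0)
      - B (C (t, u)) (sff B β (fun u' => C (t, u')) u v w) (fderiv ℝ C (t, u) (1, 0)) := by
  have hι : ∀ u', HasFDerivAt (fun u' : 𝓔 m => ((t, u') : ℝ × 𝓔 m))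
      (ContinuousLinearMap.inr ℝ ℝ (𝓔 m)) u' := fun u' => hasFDerivAt_prodMk_right t u'
  have hCι : (fun u' => fderiv ℝ (fun u' => C (t, u')) u') =ᶠ[𝓝 u]
      fun u' => (fderiv ℝ C (t, u')).comp (ContinuousLinearMap.inr ℝ ℝ (𝓔 m)) := by
    have : ∀ᶠ u' in 𝓝 u, ContDiffAt ℝ 2 C (t, u') :=
      (hι u).continuousAt.eventually (hC.eventually (by simp))
    filter_upwards [this] with u' hu'
    exact ((hu'.differentiableAt (by norm_num)).hasFDerivAt.comp u' (hι u')).fderiv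
  have hF : ContDiffAt ℝ 2 (fun u' => C (t, u')) u :=
    hC.comp u (contDiffAt_const.prodMk contDiffAt_id)
  have hd : ∀ v, fderiv ℝ (fun u' => C (t, u')) u v = fderiv ℝ C (t, u) (0, v) := fun v => by
    have := congrArg (fun T => T v) hCι.self_of_nhds
    simpa using this
  have hdd : fderiv ℝ (fun u' => fderiv ℝ (fun u' => C (t, u')) u' w) u v =
      fderiv ℝ (fderiv ℝ C) (t, u) (0, v) (0, w) := by
    have hCdd : HasFDerivAt (fderiv ℝ C) (fderiv ℝ (fderiv ℝ C) (t, u)) (t, u) :=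
      ((hC.fderiv_right (m := 1) (by norm_num)).differentiableAt (by norm_num)).hasFDerivAt
    have hc : HasFDerivAt (fun u' => fderiv ℝ C (t, u'))
        ((fderiv ℝ (fderiv ℝ C) (t, u)).comp (ContinuousLinearMap.inr ℝ ℝ (𝓔 m))) u :=
      HasFDerivAt.comp (g := fderiv ℝ C) u hCdd (hι u)
    have : (fun u' => fderiv ℝ (fun u' => C (t, u')) u' w) =ᶠ[𝓝 u]
        fun u' => fderiv ℝ C (t, u') (0, w) := hCι.mono fun u' hu' => by
      simp only [hu']; simp
    rw [this.fderiv_eq, (hc.clm_apply (hasFDerivAt_const _ u)).fderiv]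
    simp
  -- The form `D` may be degenerate, which `koszul_pullback` allows. Time goes in the last slot, so
  -- that `∂_t D` on spatial vectors occurs with a minus sign. The two terms containing `Γ^β`
  -- cancel, so `β` is arbitrary here.
  have hk := koszul_pullback hC hB hD hm.symm h (0, v) (0, w) (1, 0)
  rw [sff, hdd, hd, hd, hd, map_sub, map_add, sub_apply, add_apply,
    form_christoffel hB hm.symm hm.det_pos.ne', h.self_of_nhds (0, _)]
  rw [koszul] at hk
  linarith

end MetricForms

/-! ### Derivatives of determinants and inverse matrices, and the divergence formula. -/

section MatrixCalculus

variable {V : Type*} [NormedAddCommGroup V] [NormedSpace ℝ V] {k : ℕ}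

lemma contDiffAt_det {r : ℕ∞ω} {γ : V → Matrix (Fin k) (Fin k) ℝ} {u : V}
    (h : ∀ i j, ContDiffAt ℝ r (fun u' => γ u' i j) u) :
    ContDiffAt ℝ r (fun u' => (γ u').det) u := by
  simp only [Matrix.det_apply']
  exact ContDiffAt.sum fun σ _ => contDiffAt_const.mul (contDiffAt_prod fun i _ => h _ _)

/-- By Cramer's rule the entries of the inverse are quotients of determinants; the adjugate entries
are determinants with one row made constant. -/
lemma contDiffAt_inv {r : ℕ∞ω} {γ : V → Matrix (Fin k) (Fin k) ℝ} {u : V}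
    (h : ∀ i j, ContDiffAt ℝ r (fun u' => γ u' i j) u) (hdet : (γ u).det ≠ 0) (i j : Fin k) :
    ContDiffAt ℝ r (fun u' => (γ u')⁻¹ i j) u := by
  simp only [Matrix.inv_def, Ring.inverse_eq_inv', Matrix.smul_apply, smul_eq_mul,
    Matrix.adjugate_apply]
  refine ((contDiffAt_det h).inv hdet).mul (contDiffAt_det fun a b => ?_)
  by_cases ha : a = j
  · subst ha; simpa using contDiffAt_const
  · simpa [Matrix.updateRow_ne ha] using h a b

/-- Jacobi's formula. -/
lemma fderiv_det {γ : V → Matrix (Fin k) (Fin k) ℝ} {u : V}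
    (h : ∀ i j, DifferentiableAt ℝ (fun u' => γ u' i j) u) (hdet : (γ u).det ≠ 0) (x : V) :
    fderiv ℝ (fun u' => (γ u').det) u x =
      (γ u).det * ∑ i, ∑ j, (γ u)⁻¹ i j * fderiv ℝ (fun u' => γ u' j i) u x := by
  let d : ContinuousMultilinearMap ℝ (fun _ : Fin k => Fin k → ℝ) ℝ :=
    { (Matrix.detRowAlternating : (Fin k → ℝ) [⋀^Fin k]→ₗ[ℝ] ℝ).toMultilinearMap with
      cont := Continuous.matrix_det continuous_id }
  let γ' : V → Fin k → Fin k → ℝ := γ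
  have hγ : HasFDerivAt γ' (ContinuousLinearMap.pi fun i => ContinuousLinearMap.pi fun j =>
      fderiv ℝ (fun u' => γ u' i j) u) u :=
    hasFDerivAt_pi.2 fun i => hasFDerivAt_pi.2 fun j => (h i j).hasFDerivAt
  have hd : HasFDerivAt (fun u' => (γ u').det) _ u :=
    HasFDerivAt.comp (g := d) u (d.hasFDerivAt (γ' u)) hγ
  rw [hd.fderiv, ContinuousLinearMap.comp_apply, ContinuousMultilinearMap.linearDeriv_apply]
  simp_rw [Finset.mul_sum]
  rw [Finset.sum_comm]
  refine Finset.sum_congr rfl fun i _ => ?_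
  -- The derivative of the multilinear map `det` is a sum over rows of determinants in which row `i`
  -- is replaced by its derivative `b`; each is evaluated by Cramer's rule.
  set b : Fin k → ℝ := fun j => fderiv ℝ (fun u' => γ u' i j) u x with hb
  have h1 : d (Function.update (γ' u) i b) = ((γ u).updateRow i b).det := rfl
  refine h1.trans ?_
  rw [← Matrix.cramer_transpose_apply, Matrix.cramer_eq_adjugate_mulVec, ← Matrix.adjugate_transpose,
    Matrix.mulVec, dotProduct]
  refine Finset.sum_congr rfl fun j _ => ?_
  rw [Matrix.inv_def, Matrix.smul_apply, Ring.inverse_eq_inv', Matrix.transpose_apply, smul_eq_mul,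
    ← mul_assoc, ← mul_assoc, mul_inv_cancel₀ hdet, one_mul]

/-- Obtained by differentiating `γ γ⁻¹ = 1`, valid near `u` since the determinant stays nonzero. -/
lemma fderiv_inv_matrix {γ : V → Matrix (Fin k) (Fin k) ℝ} {u : V}
    (h : ∀ i j, ContDiffAt ℝ 1 (fun u' => γ u' i j) u) (hdet : (γ u).det ≠ 0) (x : V)
    (i j : Fin k) :
    fderiv ℝ (fun u' => (γ u')⁻¹ i j) u x =
      -∑ a, ∑ b, (γ u)⁻¹ i a * fderiv ℝ (fun u' => γ u' a b) u x * (γ u)⁻¹ b j := by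
  have hd : ∀ i j, DifferentiableAt ℝ (fun u' => γ u' i j) u := fun i j =>
    (h i j).differentiableAt (by norm_num)
  have hi : ∀ i j, DifferentiableAt ℝ (fun u' => (γ u')⁻¹ i j) u := fun i j =>
    (contDiffAt_inv h hdet i j).differentiableAt (by norm_num)
  have hev : ∀ᶠ u' in 𝓝 u, (γ u').det ≠ 0 :=
    (contDiffAt_det h).continuousAt.eventually_ne hdet
  set δ : Matrix (Fin k) (Fin k) ℝ := Matrix.of fun a b => fderiv ℝ (fun u' => γ u' a b) u x with hδ
  set ε : Matrix (Fin k) (Fin k) ℝ :=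
    Matrix.of fun a b => fderiv ℝ (fun u' => (γ u')⁻¹ a b) u x with hε
  have key : δ * (γ u)⁻¹ + γ u * ε = 0 := by
    ext a b
    have h1 : (fun u' => ∑ c, γ u' a c * (γ u')⁻¹ c b) =ᶠ[𝓝 u]
        fun _ => (1 : Matrix (Fin k) (Fin k) ℝ) a b := by
      filter_upwards [hev] with u' hu'
      rw [← Matrix.mul_apply, Matrix.mul_nonsing_inv _ hu'.isUnit]
    have h2 : HasFDerivAt (fun u' => ∑ c, γ u' a c * (γ u')⁻¹ c b)
        (∑ c, (γ u a c • fderiv ℝ (fun u' => (γ u')⁻¹ c b) u +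
          (γ u)⁻¹ c b • fderiv ℝ (fun u' => γ u' a c) u)) u :=
      HasFDerivAt.fun_sum fun c _ => (hd a c).hasFDerivAt.mul (hi c b).hasFDerivAt
    have h3 := congrArg (fun T => T x) (h1.fderiv_eq (𝕜 := ℝ))
    simp only [h2.fderiv, fderiv_fun_const, Pi.zero_apply, zero_apply, sum_apply,
      add_apply, smul_apply, smul_eq_mul, Finset.sum_add_distrib] at h3
    simp only [Matrix.add_apply, Matrix.mul_apply, Matrix.zero_apply, hδ, hε, Matrix.of_apply]
    rw [← h3, add_comm]
    congr 1
    exact Finset.sum_congr rfl fun c _ => mul_comm _ _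
  have h4 : ε = -((γ u)⁻¹ * δ * (γ u)⁻¹) := by
    have := congrArg (fun T => (γ u)⁻¹ * T) (eq_neg_of_add_eq_zero_right key)
    simp only [← mul_assoc, Matrix.nonsing_inv_mul _ hdet.isUnit, one_mul] at this
    rw [this, mul_neg, mul_assoc]
  have h5 := congrFun (congrFun h4 i) j
  simp only [hε, Matrix.of_apply, Matrix.neg_apply, Matrix.mul_apply, hδ, Finset.sum_mul] at h5
  rw [h5, Finset.sum_comm]

lemma fderiv_sqrt_det {γ : V → Matrix (Fin k) (Fin k) ℝ} {u : V}
    (h : ∀ i j, ContDiffAt ℝ 1 (fun u' => γ u' i j) u) (hdet : 0 < (γ u).det) (x : V) :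
    fderiv ℝ (fun u' => √(γ u').det) u x =
      √(γ u).det * ((1 / 2) * ∑ i, ∑ j, (γ u)⁻¹ i j * fderiv ℝ (fun u' => γ u' j i) u x) := by
  have hd := ((contDiffAt_det h).differentiableAt (by norm_num)).hasFDerivAt
  rw [(hd.sqrt hdet.ne').fderiv, smul_apply,
    fderiv_det (fun i j => (h i j).differentiableAt (by norm_num)) hdet.ne']
  have h2 : √(γ u).det ≠ 0 := (Real.sqrt_pos.2 hdet).ne'
  have h3 := Real.mul_self_sqrt hdet.le
  rw [smul_eq_mul]
  nth_rewrite 2 [← h3]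
  field_simp

/-- With `G = γ⁻¹` and `D p i j = ∂_p γ_ij`, this is `-G^{ij} Γ^l_{ij} X_l = (∂_i G^{ij}) X_j +
G^{ij} X_j ∂_i log √det γ`, with the derivatives of `G` and of the determinant already expanded.
Only the symmetries of `G` and `D` enter, so it is stated for abstract arrays. -/
lemma christoffel_contraction {G : Fin k → Fin k → ℝ} {D : Fin k → Fin k → Fin k → ℝ}
    (hG : ∀ i j, G i j = G j i) (hD : ∀ p i j, D p i j = D p j i) (X : Fin k → ℝ) :
    ∑ i, ∑ j, G i j * ∑ l, ((1 / 2 : ℝ) * ∑ p, G l p * (D i j p + D j i p - D p i j)) * X l =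
      (∑ i, ∑ j, X j * ∑ a, ∑ b, G i a * D i a b * G b j)
        - ∑ i, (∑ j, G i j * X j) * ((1 / 2) * ∑ a, ∑ b, G a b * D i b a) := by
  set Y : Fin k → ℝ := fun p => ∑ l, G l p * X l with hY
  have h1 : ∀ i j, ∑ l, ((1 / 2 : ℝ) * ∑ p, G l p * (D i j p + D j i p - D p i j)) * X l =
      (1 / 2 : ℝ) * ∑ p, (D i j p + D j i p - D p i j) * Y p := by
    intro i j
    simp only [hY, Finset.mul_sum, Finset.sum_mul]
    rw [Finset.sum_comm]
    exact Finset.sum_congr rfl fun _ _ => Finset.sum_congr rfl fun _ _ => by ring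
  have h2 : ∀ i, ∑ j, X j * ∑ a, ∑ b, G i a * D i a b * G b j =
      ∑ a, ∑ b, G i a * D i a b * Y b := by
    intro i
    simp only [hY, Finset.mul_sum]
    rw [Finset.sum_comm]
    refine Finset.sum_congr rfl fun a _ => ?_
    rw [Finset.sum_comm]
    exact Finset.sum_congr rfl fun b _ => Finset.sum_congr rfl fun c _ => by rw [hG c b]; ring
  have h3 : ∀ i, ∑ j, G i j * X j = Y i := fun i =>
    Finset.sum_congr rfl fun j _ => by rw [hG]
  have e1 : ∑ i, ∑ j, ∑ p, G i j * (D j i p * Y p) = ∑ i, ∑ j, ∑ p, G i j * (D i j p * Y p) := by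
    rw [Finset.sum_comm]
    exact Finset.sum_congr rfl fun i _ => Finset.sum_congr rfl fun j _ =>
      Finset.sum_congr rfl fun p _ => by rw [hG]
  have e2 : ∑ i, ∑ j, ∑ p, G i j * (D p i j * Y p) = ∑ i, ∑ a, ∑ b, Y i * (G a b * D i b a) := by
    simp_rw [Finset.sum_comm (s := (Finset.univ : Finset (Fin k))) (t := Finset.univ)
      (f := fun j p => G _ j * (D p _ j * Y p))]
    rw [Finset.sum_comm]
    exact Finset.sum_congr rfl fun i _ => Finset.sum_congr rfl fun a _ =>
      Finset.sum_congr rfl fun b _ => by rw [hD i b a]; ring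
  simp only [h1, h2, h3]
  have e3 : ∑ i, ∑ j, G i j * ((1 / 2 : ℝ) * ∑ p, (D i j p + D j i p - D p i j) * Y p) =
      (1 / 2 : ℝ) * (∑ i, ∑ j, ∑ p, G i j * (D i j p * Y p) + ∑ i, ∑ j, ∑ p, G i j * (D j i p * Y p)
        - ∑ i, ∑ j, ∑ p, G i j * (D p i j * Y p)) := by
    simp only [← Finset.sum_add_distrib, ← Finset.sum_sub_distrib, Finset.mul_sum]
    exact Finset.sum_congr rfl fun _ _ => Finset.sum_congr rfl fun _ _ =>
      Finset.sum_congr rfl fun _ _ => by ring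
  rw [e3, e1, e2]
  have e4 : ∑ i, Y i * ((1 / 2 : ℝ) * ∑ a, ∑ b, G a b * D i b a) =
      (1 / 2 : ℝ) * ∑ i, ∑ a, ∑ b, Y i * (G a b * D i b a) := by
    simp only [Finset.mul_sum]
    exact Finset.sum_congr rfl fun _ _ => Finset.sum_congr rfl fun _ _ =>
      Finset.sum_congr rfl fun _ _ => by ring
  rw [e4]
  simp only [mul_assoc]
  ring

/-- The coordinate formula for the divergence of the vector field dual to the covector field `X`. -/
lemma divergence_formula {γ : 𝓔 k → Matrix (Fin k) (Fin k) ℝ} {X : 𝓔 k → Fin k → ℝ} {u : 𝓔 k}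
    (h : ∀ i j, ContDiffAt ℝ 1 (fun u' => γ u' i j) u) (hdet : 0 < (γ u).det)
    (hs : ∀ i j, ∀ u', γ u' i j = γ u' j i)
    (hX : ∀ j, ContDiffAt ℝ 1 (fun u' => X u' j) u) :
    ∑ i, fderiv ℝ (fun u' => √(γ u').det * ∑ j, (γ u')⁻¹ i j * X u' j) u (e i) =
      √(γ u).det * ∑ i, ∑ j, (γ u)⁻¹ i j *
        (fderiv ℝ (fun u' => X u' j) u (e i) - ∑ l, christoffelSymbol γ u l i j * X u l) := by
  have hP : DifferentiableAt ℝ (fun u' => √(γ u').det) u :=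
    (((contDiffAt_det h).differentiableAt (by norm_num)).sqrt hdet.ne')
  have hG : ∀ i j, DifferentiableAt ℝ (fun u' => (γ u')⁻¹ i j) u := fun i j =>
    (contDiffAt_inv h hdet.ne' i j).differentiableAt (by norm_num)
  have hXd : ∀ j, DifferentiableAt ℝ (fun u' => X u' j) u := fun j =>
    (hX j).differentiableAt (by norm_num)
  have h1 : ∀ i, fderiv ℝ (fun u' => √(γ u').det * ∑ j, (γ u')⁻¹ i j * X u' j) u (e i) =
      √(γ u).det * ∑ j, ((γ u)⁻¹ i j * fderiv ℝ (fun u' => X u' j) u (e i) +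
        X u j * fderiv ℝ (fun u' => (γ u')⁻¹ i j) u (e i)) +
      (∑ j, (γ u)⁻¹ i j * X u j) * fderiv ℝ (fun u' => √(γ u').det) u (e i) := by
    intro i
    have h2 : HasFDerivAt (fun u' => ∑ j, (γ u')⁻¹ i j * X u' j)
        (∑ j, ((γ u)⁻¹ i j • fderiv ℝ (fun u' => X u' j) u +
          X u j • fderiv ℝ (fun u' => (γ u')⁻¹ i j) u)) u :=
      HasFDerivAt.fun_sum fun j _ => (hG i j).hasFDerivAt.mul (hXd j).hasFDerivAt
    rw [(hP.hasFDerivAt.fun_mul h2).fderiv]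
    simp only [sum_apply, add_apply, smul_apply, smul_eq_mul]
  have hGs : ∀ i j, (γ u)⁻¹ i j = (γ u)⁻¹ j i := by
    have : (γ u).transpose = γ u := by ext i j; exact hs j i u
    intro i j
    rw [← Matrix.transpose_apply ((γ u)⁻¹) j i, Matrix.transpose_nonsing_inv, this]
  have hDs : ∀ i j p, fderiv ℝ (fun u' => γ u' i j) u (e p) = fderiv ℝ (fun u' => γ u' j i) u (e p) :=
    fun i j p => by simp only [hs i j]
  have key := christoffel_contraction (G := fun i j => (γ u)⁻¹ i j)
    (D := fun p i j => fderiv ℝ (fun u' => γ u' i j) u (e p)) hGs (fun p i j => hDs i j p) (X u)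
  have hsub : ∑ i, ∑ j, (γ u)⁻¹ i j * (fderiv ℝ (fun u' => X u' j) u (e i) -
        ∑ l, christoffelSymbol γ u l i j * X u l) =
      ∑ i, ∑ j, (γ u)⁻¹ i j * fderiv ℝ (fun u' => X u' j) u (e i) -
        ∑ i, ∑ j, (γ u)⁻¹ i j * ∑ l, christoffelSymbol γ u l i j * X u l := by
    simp only [← Finset.sum_sub_distrib, ← mul_sub]
  rw [hsub, show ∑ i, ∑ j, (γ u)⁻¹ i j * ∑ l, christoffelSymbol γ u l i j * X u l = _ from key]
  simp only [h1, fderiv_sqrt_det h hdet, fderiv_inv_matrix h hdet.ne', Finset.sum_add_distrib,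
    mul_neg, Finset.sum_neg_distrib, mul_add, mul_left_comm _ (√(γ u).det), ← Finset.mul_sum]
  ring

end MatrixCalculus

/-! ### First variation of the volume density in coordinates. -/

section FirstVariation

variable {m n : ℕ}

/-- Christoffel symbols involve first derivatives, so agreement at `u` alone would not suffice. This
is needed because the Gram matrices of a path and of its time slices are compared only over a chart
domain. -/
lemma christoffel_congr {γ γ' : 𝓔 m → Matrix (Fin m) (Fin m) ℝ} {u : 𝓔 m} (h : γ =ᶠ[𝓝 u] γ')
    (v w : 𝓔 m) : christoffel γ u v w = christoffel γ' u v w := by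
  have : ∀ l i j, christoffelSymbol γ u l i j = christoffelSymbol γ' u l i j := by
    intro l i j
    have h1 : ∀ a b, fderiv ℝ (fun u' => γ u' a b) u = fderiv ℝ (fun u' => γ' u' a b) u :=
      fun a b => Filter.EventuallyEq.fderiv_eq (h.mono fun u' hu' => by simp only [hu'])
    simp only [christoffelSymbol, h1, h.self_of_nhds]
  simp only [christoffel, this]

/-- The restriction of a form on `ℝ × ℝᵐ` at `(t, u)` to `ℝᵐ`. -/
def spatialForm (D : ℝ × 𝓔 m → (ℝ × 𝓔 m) →L[ℝ] (ℝ × 𝓔 m) →L[ℝ] ℝ) (t : ℝ) (u : 𝓔 m) :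
    𝓔 m →L[ℝ] 𝓔 m →L[ℝ] ℝ :=
  (D (t, u)).bilinearComp (ContinuousLinearMap.inr ℝ ℝ (𝓔 m)) (ContinuousLinearMap.inr ℝ ℝ (𝓔 m))

@[simp] lemma spatialForm_apply (D : ℝ × 𝓔 m → (ℝ × 𝓔 m) →L[ℝ] (ℝ × 𝓔 m) →L[ℝ] ℝ) (t : ℝ)
    (u v w : 𝓔 m) : spatialForm D t u v w = D (t, u) (0, v) (0, w) := by
  simp [spatialForm]

/-- The first variation of the volume density, in coordinates. -/
lemma hasDerivAt_sqrt_det {B : 𝓔 n → 𝓔 n →L[ℝ] 𝓔 n →L[ℝ] ℝ} {C : ℝ × 𝓔 m → 𝓔 n} {t : ℝ} {u : 𝓔 m}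
    {D : ℝ × 𝓔 m → (ℝ × 𝓔 m) →L[ℝ] (ℝ × 𝓔 m) →L[ℝ] ℝ}
    (hC : ContDiffAt ℝ 2 C (t, u)) (hB : DifferentiableAt ℝ B (C (t, u)))
    (hD : ContDiffAt ℝ 1 D (t, u)) (hDs : ∀ p v w, D p v w = D p w v)
    (hm : IsInnerForm (B (C (t, u)))) (h : IsPullbackAt C B D (t, u))
    (hdet : 0 < (formMatrix (spatialForm D t u)).det) :
    HasDerivAt (fun s => √(formMatrix (spatialForm D s u)).det)
      (∑ i, fderiv ℝ (fun u' => √(formMatrix (spatialForm D t u')).det *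
          ∑ j, (formMatrix (spatialForm D t u'))⁻¹ i j * D (t, u') (0, e j) (1, 0)) u (e i)
        - √(formMatrix (spatialForm D t u)).det *
          B (C (t, u)) (formTrace (formMatrix (spatialForm D t u))
            (sff B (spatialForm D t) (fun u' => C (t, u')) u)) (fderiv ℝ C (t, u) (1, 0))) t := by
  have hDd : DifferentiableAt ℝ D (t, u) := hD.differentiableAt (by norm_num)
  have hDat : ∀ v w, ContDiffAt ℝ 1 (fun p => D p v w) (t, u) := fun v w =>
    (hD.clm_apply contDiffAt_const).clm_apply contDiffAt_const
  have hι : ContDiffAt ℝ 1 (fun u' : 𝓔 m => ((t, u') : ℝ × 𝓔 m)) u :=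
    contDiffAt_const.prodMk contDiffAt_id
  have hτ : ContDiffAt ℝ 1 (fun s : ℝ => ((s, u) : ℝ × 𝓔 m)) t :=
    contDiffAt_id.prodMk contDiffAt_const
  have hDu : ∀ v w, ContDiffAt ℝ 1 (fun u' => D (t, u') v w) u := fun v w =>
    ContDiffAt.comp (g := fun p => D p v w) u (hDat v w) hι
  have hDt : ∀ v w, ContDiffAt ℝ 1 (fun s => D (s, u) v w) t := fun v w =>
    ContDiffAt.comp (g := fun p => D p v w) t (hDat v w) hτ
  have hγu : ∀ i j, ContDiffAt ℝ 1 (fun u' => formMatrix (spatialForm D t u') i j) u :=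
    fun i j => by simpa [formMatrix] using hDu (0, e i) (0, e j)
  have hγt : ∀ i j, ContDiffAt ℝ 1 (fun s => formMatrix (spatialForm D s u) i j) t :=
    fun i j => by simpa [formMatrix] using hDt (0, e i) (0, e j)
  have du : ∀ v w x, fderiv ℝ (fun u' => D (t, u') v w) u x = fderiv ℝ D (t, u) (0, x) v w := by
    intro v w x
    have h1 := HasFDerivAt.comp (g := fun p => D p v w) u
      ((hDat v w).differentiableAt (by norm_num)).hasFDerivAt (hasFDerivAt_prodMk_right t u)
    have h2 : HasFDerivAt (fun u' => D (t, u') v w) _ u := h1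
    rw [h2.fderiv, ContinuousLinearMap.comp_apply, fderiv_form_apply hDd]
    simp
  have dt : ∀ v w, fderiv ℝ (fun s => D (s, u) v w) t 1 = fderiv ℝ D (t, u) (1, 0) v w := by
    intro v w
    have hl : HasFDerivAt (fun s : ℝ => ((s, u) : ℝ × 𝓔 m)) (ContinuousLinearMap.inl ℝ ℝ (𝓔 m)) t :=
      hasFDerivAt_prodMk_left t u
    have h1 := HasFDerivAt.comp (g := fun p => D p v w) (f := fun s : ℝ => ((s, u) : ℝ × 𝓔 m)) t
      ((hDat v w).differentiableAt (by norm_num)).hasFDerivAt hl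
    have h2 : HasFDerivAt (fun s => D (s, u) v w) _ t := h1
    rw [h2.fderiv, ContinuousLinearMap.comp_apply, fderiv_form_apply hDd]
    simp
  have hsqrt : DifferentiableAt ℝ (fun s => √(formMatrix (spatialForm D s u)).det) t :=
    ((contDiffAt_det hγt).differentiableAt (by norm_num)).sqrt hdet.ne'
  refine hsqrt.hasDerivAt.congr_deriv ?_
  rw [← fderiv_apply_one_eq_deriv, fderiv_sqrt_det hγt hdet,
    divergence_formula hγu hdet (fun i j u' => formMatrix_symm (fun v w => by simp [hDs]) i j)
      (fun j => hDu _ _), ← mul_sub]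
  congr 1
  set γ := formMatrix (spatialForm D t u) with hγ
  have hX : ∀ i j, ∑ l, christoffelSymbol (fun u' => formMatrix (spatialForm D t u')) u l i j *
      D (t, u) (0, e l) (1, 0) =
      D (t, u) (0, christoffel (fun u' => formMatrix (spatialForm D t u')) u (e i) (e j)) (1, 0) := by
    intro i j
    let T : 𝓔 m →ₗ[ℝ] ℝ := ((D (t, u)).flip (1, 0)).toLinearMap ∘ₗ LinearMap.inr ℝ ℝ (𝓔 m)
    have hT : ∀ v, T v = D (t, u) (0, v) (1, 0) := fun v => rfl
    simp only [← hT]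
    conv_rhs => rw [← sum_smul_e (christoffel _ u (e i) (e j))]
    simp [christoffel_e_apply]
  have hform : ∀ i j, (1 / 2 : ℝ) * fderiv ℝ (fun s => formMatrix (spatialForm D s u) j i) t 1 = 
      (1 / 2 : ℝ) * (fderiv ℝ D (t, u) (0, e j) (0, e i) (1, 0)
        + fderiv ℝ D (t, u) (0, e i) (0, e j) (1, 0))
      - D (t, u) (0, christoffel (fun u' => formMatrix (spatialForm D t u')) u (e j) (e i)) (1, 0)
      - B (C (t, u)) (sff B (spatialForm D t) (fun u' => C (t, u')) u (e j) (e i))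
        (fderiv ℝ C (t, u) (1, 0)) := by
    intro i j
    rw [← fderiv_pullback_time hC hB hDd hm h, ← dt]
    simp [formMatrix]
  have hGs : ∀ i j, γ⁻¹ i j = γ⁻¹ j i := by
    have : γ.transpose = γ := by
      ext i j; exact formMatrix_symm (b := spatialForm D t u) (fun v w => by simp [hDs]) j i
    intro i j
    rw [← Matrix.transpose_apply (γ⁻¹) j i, Matrix.transpose_nonsing_inv, this]
  have hR : (1 / 2 : ℝ) * ∑ i, ∑ j,
      γ⁻¹ i j * fderiv ℝ (fun s => formMatrix (spatialForm D s u) j i) t 1 =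
      ∑ i, ∑ j, γ⁻¹ i j * ((1 / 2 : ℝ) *
        fderiv ℝ (fun s => formMatrix (spatialForm D s u) i j) t 1) := by
    rw [Finset.sum_comm]
    simp only [Finset.mul_sum]
    exact Finset.sum_congr rfl fun _ _ => Finset.sum_congr rfl fun _ _ => by rw [hGs]; ring
  -- Symmetry of `γ⁻¹` makes the two halves of the symmetrized derivative of the covector `D(·,
  -- ∂_t)` equal after contraction, leaving the divergence term.
  have hsw : ∑ i, ∑ j, γ⁻¹ i j * ((1 / 2 : ℝ) * fderiv ℝ D (t, u) (0, e i) (0, e j) (1, 0)) +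
      ∑ i, ∑ j, γ⁻¹ i j * ((1 / 2 : ℝ) * fderiv ℝ D (t, u) (0, e j) (0, e i) (1, 0)) =
      ∑ i, ∑ j, γ⁻¹ i j * fderiv ℝ D (t, u) (0, e i) (0, e j) (1, 0) := by
    nth_rewrite 2 [Finset.sum_comm]
    simp only [← Finset.sum_add_distrib]
    exact Finset.sum_congr rfl fun i _ => Finset.sum_congr rfl fun j _ => by rw [hGs j i]; ring
  rw [hR]
  simp only [hform, hX, du, formTrace, map_sum, map_smul, sum_apply, smul_apply, smul_eq_mul,
    mul_sub, Finset.sum_sub_distrib, mul_add, Finset.sum_add_distrib]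
  rw [hsw]

end FirstVariation

/-! ### Pullback of the Riemannian metric as a field of bilinear forms. -/

section PullForm

variable {V : Type*} [NormedAddCommGroup V] [NormedSpace ℝ V]
  {W : Type*} [NormedAddCommGroup W] [NormedSpace ℝ W]
  {n : ℕ} {N : Type*} [TopologicalSpace N] [ChartedSpace (𝓔 n) N] [IsManifold (𝓡 n) ∞ N]

/-- The pullback `K^*g` at `p`, as a bilinear form on the model space. -/
def pullForm {P : Type*} [TopologicalSpace P] [ChartedSpace V P] (g : RMetric n N) (K : P → N)
    (p : P) : V →L[ℝ] V →L[ℝ] ℝ :=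
  let b : 𝓔 n →L[ℝ] 𝓔 n →L[ℝ] ℝ := g.inner (K p)
  let A : V →L[ℝ] 𝓔 n := mfderiv 𝓘(ℝ, V) (𝓡 n) K p
  b.bilinearComp A A

section Manifold

variable {P : Type*} [TopologicalSpace P] [ChartedSpace V P]
  {Q : Type*} [TopologicalSpace Q] [ChartedSpace W Q]

lemma pullForm_apply (g : RMetric n N) (K : P → N) (p : P) (v w : V) :
    pullForm (V := V) g K p v w =
      g.inner (K p) (mfderiv 𝓘(ℝ, V) (𝓡 n) K p v) (mfderiv 𝓘(ℝ, V) (𝓡 n) K p w) := rfl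

lemma pullForm_symm (g : RMetric n N) (K : P → N) (p : P) (v w : V) :
    pullForm (V := V) g K p v w = pullForm (V := V) g K p w v := g.symm _ _ _

lemma gram_eq {k : ℕ} {P : Type*} [TopologicalSpace P] [ChartedSpace (𝓔 k) P] (g : RMetric n N)
    (K : P → N) (p : P) : gram (k := k) g K p = formMatrix (pullForm g K p) := rfl

lemma pullForm_comp (g : RMetric n N) {K : P → N} {T : Q → P} {K' : Q → N} {q : Q}
    (h : K' =ᶠ[𝓝 q] K ∘ T) (hK : MDifferentiableAt 𝓘(ℝ, V) (𝓡 n) K (T q))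
    (hT : MDifferentiableAt 𝓘(ℝ, W) 𝓘(ℝ, V) T q) (v w : W) :
    pullForm (V := W) g K' q v w = pullForm (V := V) g K (T q)
      (mfderiv 𝓘(ℝ, W) 𝓘(ℝ, V) T q v) (mfderiv 𝓘(ℝ, W) 𝓘(ℝ, V) T q w) := by
  rw [pullForm_apply, h.mfderiv_eq, mfderiv_comp q hK hT, h.self_of_nhds]
  rfl

lemma pullForm_isInnerForm (g : RMetric n N) {K : P → N} {p : P}
    (h : Function.Injective (mfderiv 𝓘(ℝ, V) (𝓡 n) K p)) :
    IsInnerForm (pullForm (V := V) g K p) where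
  symm v w := pullForm_symm g K p v w
  pos v hv := by
    refine g.pos _ _ fun h0 => hv ?_
    exact h (h0.trans (map_zero _).symm)

end Manifold

lemma contDiffOn_pullForm [FiniteDimensional ℝ V] (g : RMetric n N) {K : V → N} {U : Set V}
    (hU : IsOpen U) (hK : ContMDiffOn 𝓘(ℝ, V) (𝓡 n) ∞ K U) :
    ContDiffOn ℝ ∞ (pullForm (V := V) g K) U := by
  rw [contDiffOn_clm_apply]
  intro v
  rw [contDiffOn_clm_apply]
  intro w
  rw [← contMDiffOn_iff_contDiffOn]
  -- The fields `TK.v` for constant `v` are smooth sections along `K`, as the tangent map of `K` is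
  -- smooth; inserting two of them in the smooth metric gives the coefficients of `K^*g`.
  have hsec : ∀ v : V, ContMDiffOn 𝓘(ℝ, V) ((𝓡 n).prod 𝓘(ℝ, 𝓔 n)) ∞
      (fun p => Bundle.TotalSpace.mk' (𝓔 n) (E := fun q : N => TangentSpace (𝓡 n) q) (K p)
        (mfderiv 𝓘(ℝ, V) (𝓡 n) K p v)) U := by
    intro v
    have h1 := hK.contMDiffOn_tangentMapWithin (m := ∞) (by simp) hU.uniqueMDiffOn
    have h2 : ContMDiffOn 𝓘(ℝ, V) (𝓘(ℝ, V).prod 𝓘(ℝ, V)) ∞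
        (fun p : V => (⟨p, v⟩ : TangentBundle 𝓘(ℝ, V) V)) U :=
      (contMDiffOn_vectorSpace_iff_contDiffOn (V := fun _ : V => v)).2 contDiffOn_const
    refine (h1.comp h2 fun p hp => hp).congr fun p hp => ?_
    simp [tangentMapWithin, mfderivWithin_of_isOpen hU hp]
  intro p hp
  have : ContMDiffWithinAt 𝓘(ℝ, V) ((𝓡 n).prod 𝓘(ℝ)) ∞
      (fun p ↦ Bundle.TotalSpace.mk' ℝ (E := Bundle.Trivial N ℝ) (K p)
        (g.inner (K p) (mfderiv 𝓘(ℝ, V) (𝓡 n) K p v) (mfderiv 𝓘(ℝ, V) (𝓡 n) K p w))) U p := by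
    apply ContMDiffWithinAt.clm_bundle_apply₂ (F₁ := 𝓔 n) (F₂ := 𝓔 n)
    · exact ContMDiffAt.comp_contMDiffWithinAt p g.contMDiff.contMDiffAt (hK p hp)
    · exact hsec v p hp
    · exact hsec w p hp
  simp only [Bundle.contMDiffWithinAt_totalSpace] at this
  exact this.2

lemma contDiffAt_pullForm [FiniteDimensional ℝ V] (g : RMetric n N) {K : V → N} {U : Set V}
    (hU : IsOpen U) (hK : ContMDiffOn 𝓘(ℝ, V) (𝓡 n) ∞ K U) {p : V} (hp : p ∈ U) :
    ContDiffAt ℝ ∞ (pullForm (V := V) g K) p :=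
  (contDiffOn_pullForm g hU hK).contDiffAt (hU.mem_nhds hp)

end PullForm

/-! ### The metric read in a preferred chart. -/

section Charts

variable {n : ℕ} {N : Type*} [TopologicalSpace N] [ChartedSpace (𝓔 n) N] [IsManifold (𝓡 n) ∞ N]

lemma chart_symm_contMDiffAt (y : N) {p : 𝓔 n} (hp : p ∈ (extChartAt (𝓡 n) y).target) :
    ContMDiffAt (𝓡 n) (𝓡 n) ∞ (extChartAt (𝓡 n) y).symm p :=
  (contMDiffOn_extChartAt_symm y).contMDiffAt ((isOpen_extChartAt_target y).mem_nhds hp)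

lemma chart_contMDiffAt (y : N) {q : N} (hq : q ∈ (extChartAt (𝓡 n) y).source) :
    ContMDiffAt (𝓡 n) (𝓡 n) ∞ (extChartAt (𝓡 n) y) q :=
  contMDiffAt_extChartAt' (by rwa [extChartAt_source] at hq)

lemma chart_symm_injective (y : N) {p : 𝓔 n} (hp : p ∈ (extChartAt (𝓡 n) y).target) :
    Function.Injective (mfderiv (𝓡 n) (𝓡 n) (extChartAt (𝓡 n) y).symm p) := by
  have := (isInvertible_mfderivWithin_extChartAt_symm (I := 𝓡 n) hp).injective
  simpa using this

lemma contDiffAt_chartForm (g : RMetric n N) (y : N) {p : 𝓔 n}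
    (hp : p ∈ (extChartAt (𝓡 n) y).target) :
    ContDiffAt ℝ ∞ (pullForm (V := 𝓔 n) g (extChartAt (𝓡 n) y).symm) p :=
  contDiffAt_pullForm g (isOpen_extChartAt_target y) (contMDiffOn_extChartAt_symm y) hp

lemma chartForm_isInnerForm (g : RMetric n N) (y : N) {p : 𝓔 n}
    (hp : p ∈ (extChartAt (𝓡 n) y).target) :
    IsInnerForm (pullForm (V := 𝓔 n) g (extChartAt (𝓡 n) y).symm p) :=
  pullForm_isInnerForm g (chart_symm_injective y hp)

/-- The metric at a point, read in a chart. -/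
lemma isPullbackAt_chart {V : Type*} [NormedAddCommGroup V] [NormedSpace ℝ V] (g : RMetric n N)
    (y : N) {K : V → N} {p : V} (hK : ContMDiffAt 𝓘(ℝ, V) (𝓡 n) ∞ K p)
    (hp : K p ∈ (extChartAt (𝓡 n) y).source) :
    ContDiffAt ℝ ∞ (extChartAt (𝓡 n) y ∘ K) p ∧
    K =ᶠ[𝓝 p] (extChartAt (𝓡 n) y).symm ∘ (extChartAt (𝓡 n) y ∘ K) ∧
    IsPullbackAt (extChartAt (𝓡 n) y ∘ K) (pullForm g (extChartAt (𝓡 n) y).symm)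
      (pullForm g K) p := by
  have hC : ContMDiffAt 𝓘(ℝ, V) (𝓡 n) ∞ (extChartAt (𝓡 n) y ∘ K) p :=
    (chart_contMDiffAt y hp).comp p hK
  have hev : ∀ᶠ q in 𝓝 p, K q ∈ (extChartAt (𝓡 n) y).source :=
    hK.continuousAt.eventually ((isOpen_extChartAt_source y).mem_nhds hp)
  have heq : K =ᶠ[𝓝 p] (extChartAt (𝓡 n) y).symm ∘ (extChartAt (𝓡 n) y ∘ K) :=
    hev.mono fun q hq => ((extChartAt (𝓡 n) y).left_inv hq).symm
  have hC' := contMDiffAt_iff_contDiffAt.1 hC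
  refine ⟨hC', heq, ?_⟩
  have e1 := (hC'.of_le (m := 1) (by norm_num)).eventually (by simp)
  filter_upwards [hev, heq.eventuallyEq_nhds, e1] with q h1 h2 h3 v w
  have h4 := h3.differentiableAt (by norm_num)
  have h5 : (extChartAt (𝓡 n) y ∘ K) q ∈ (extChartAt (𝓡 n) y).target :=
    (extChartAt (𝓡 n) y).map_source h1
  rw [pullForm_comp g h2 ((chart_symm_contMDiffAt y h5).mdifferentiableAt (by simp))
    h4.mdifferentiableAt, mfderiv_eq_fderiv]
  rfl

end Charts

/-! ### Transition maps between preferred charts. -/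

section Transition

variable {k : ℕ} {P : Type*} [TopologicalSpace P] [ChartedSpace (𝓔 k) P] [IsManifold (𝓡 k) ∞ P]

lemma clm_det_ne_zero_of_bijective {J : 𝓔 k →L[ℝ] 𝓔 k} (hJ : Function.Bijective J) :
    J.det ≠ 0 :=
  ((LinearMap.isUnit_iff_isUnit_det (J : 𝓔 k →ₗ[ℝ] 𝓔 k)).1
    ((Module.End.isUnit_iff _).2 hJ)).ne_zero

/-- The differential at `x` of the preferred chart at `x₀`. -/
def chartDeriv (x₀ x : P) : 𝓔 k →L[ℝ] 𝓔 k := mfderiv (𝓡 k) (𝓡 k) (extChartAt (𝓡 k) x₀) x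

lemma chartDeriv_det_ne_zero {x₀ x : P} (hx : x ∈ (extChartAt (𝓡 k) x₀).source) :
    (chartDeriv (k := k) x₀ x).det ≠ 0 :=
  clm_det_ne_zero_of_bijective (isInvertible_mfderiv_extChartAt (I := 𝓡 k) hx).bijective

lemma fderiv_transition {x₀ x : P} (hx : x ∈ (extChartAt (𝓡 k) x₀).source) :
    fderiv ℝ (extChartAt (𝓡 k) x₀ ∘ (extChartAt (𝓡 k) x).symm) (extChartAt (𝓡 k) x x) =
      chartDeriv (k := k) x₀ x := by
  have hs : MDifferentiableAt (𝓡 k) (𝓡 k) (extChartAt (𝓡 k) x).symm (extChartAt (𝓡 k) x x) :=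
    (chart_symm_contMDiffAt x (mem_extChartAt_target x)).mdifferentiableAt (by simp)
  have hx' : (extChartAt (𝓡 k) x).symm (extChartAt (𝓡 k) x x) = x := extChartAt_to_inv x
  have hc : MDifferentiableAt (𝓡 k) (𝓡 k) (extChartAt (𝓡 k) x₀)
      ((extChartAt (𝓡 k) x).symm (extChartAt (𝓡 k) x x)) := by
    rw [hx']
    exact (chart_contMDiffAt x₀ hx).mdifferentiableAt (by simp)
  have h1 := mfderiv_comp _ hc hs
  -- The tangent space at `x` is identified with `ℝᵏ` through the chart at `x` itself, so the
  -- inverse of that chart has derivative the identity at the centre.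
  have h2 := mfderivWithin_range_extChartAt_symm (I := 𝓡 k) (x := x)
  simp only [modelWithCornersSelf_coe, Set.range_id, mfderivWithin_univ] at h2
  rw [← mfderiv_eq_fderiv, h1, h2]
  ext1 v
  simp only [chartDeriv]
  rw [hx']
  rfl

lemma contDiffAt_transition {x₀ x₁ : P} {u : 𝓔 k} (hu : u ∈ (extChartAt (𝓡 k) x₁).target)
    (hx : (extChartAt (𝓡 k) x₁).symm u ∈ (extChartAt (𝓡 k) x₀).source) :
    ContDiffAt ℝ ∞ (extChartAt (𝓡 k) x₀ ∘ (extChartAt (𝓡 k) x₁).symm) u :=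
  contMDiffAt_iff_contDiffAt.1 ((chart_contMDiffAt x₀ hx).comp u (chart_symm_contMDiffAt x₁ hu))

end Transition

/-! ### Chart independence and normality of the mean curvature of one immersion. -/

section StaticForms

variable {m n : ℕ} {M : Type*} [TopologicalSpace M] [ChartedSpace (𝓔 m) M] [IsManifold (𝓡 m) ∞ M]
  {N : Type*} [TopologicalSpace N] [ChartedSpace (𝓔 n) N] [IsManifold (𝓡 n) ∞ N]

/-- This is the pullback rule for `id = ψ⁻¹ ∘ ψ` near `q`. It moves inner products from the chart at
the varying point `q` to the fixed chart at `y`. -/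
lemma chartForm_chartDeriv (g : RMetric n N) {y q : N} (hq : q ∈ (extChartAt (𝓡 n) y).source)
    (v w : TangentSpace (𝓡 n) q) :
    pullForm (V := 𝓔 n) g (extChartAt (𝓡 n) y).symm (extChartAt (𝓡 n) y q)
      (chartDeriv y q v) (chartDeriv y q w) = g.inner q v w := by
  have hid : (id : N → N) =ᶠ[𝓝 q] (extChartAt (𝓡 n) y).symm ∘ extChartAt (𝓡 n) y := by
    filter_upwards [(isOpen_extChartAt_source y).mem_nhds hq] with q hq
    exact ((extChartAt (𝓡 n) y).left_inv hq).symm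
  have h := pullForm_comp (V := 𝓔 n) (W := 𝓔 n) g hid
    ((chart_symm_contMDiffAt y ((extChartAt (𝓡 n) y).map_source hq)).mdifferentiableAt (by simp))
    ((chart_contMDiffAt y hq).mdifferentiableAt (by simp)) v w
  have hid' : pullForm (V := 𝓔 n) g id q v w = g.inner q v w := by
    change g.inner q (mfderiv (𝓡 n) (𝓡 n) id q v) (mfderiv (𝓡 n) (𝓡 n) id q w) = _
    rw [mfderiv_id]
    rfl
  exact h.symm.trans hid'

lemma contMDiffOn_comp_chart_symm {f : M → N} (hf : ContMDiff (𝓡 m) (𝓡 n) ∞ f) (x₀ : M) :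
    ContMDiffOn (𝓡 m) (𝓡 n) ∞ (f ∘ (extChartAt (𝓡 m) x₀).symm) (extChartAt (𝓡 m) x₀).target :=
  hf.comp_contMDiffOn (contMDiffOn_extChartAt_symm x₀)

lemma pullForm_eq_chart (g : RMetric n N) {f : M → N} (hf : ContMDiff (𝓡 m) (𝓡 n) ∞ f) {x₀ x : M}
    (hx : x ∈ (extChartAt (𝓡 m) x₀).source) (v w : 𝓔 m) :
    pullForm (V := 𝓔 m) g f x v w =
      pullForm (V := 𝓔 m) g (f ∘ (extChartAt (𝓡 m) x₀).symm) (extChartAt (𝓡 m) x₀ x)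
        (chartDeriv x₀ x v) (chartDeriv x₀ x w) := by
  have heq : f =ᶠ[𝓝 x] (f ∘ (extChartAt (𝓡 m) x₀).symm) ∘ extChartAt (𝓡 m) x₀ := by
    filter_upwards [(isOpen_extChartAt_source x₀).mem_nhds hx] with q hq
    exact (congrArg f ((extChartAt (𝓡 m) x₀).left_inv hq)).symm
  have ht := (extChartAt (𝓡 m) x₀).map_source hx
  exact pullForm_comp (V := 𝓔 m) (W := 𝓔 m) g heq
    (((contMDiffOn_comp_chart_symm hf x₀).contMDiffAt
      ((isOpen_extChartAt_target x₀).mem_nhds ht)).mdifferentiableAt (by simp))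
    ((chart_contMDiffAt x₀ hx).mdifferentiableAt (by simp)) v w

lemma pullForm_transition (g : RMetric n N) {f : M → N} (hf : ContMDiff (𝓡 m) (𝓡 n) ∞ f) {x₀ x₁ : M}
    {u : 𝓔 m} (hu : u ∈ (extChartAt (𝓡 m) x₁).target)
    (hx : (extChartAt (𝓡 m) x₁).symm u ∈ (extChartAt (𝓡 m) x₀).source) :
    IsPullbackAt (extChartAt (𝓡 m) x₀ ∘ (extChartAt (𝓡 m) x₁).symm)
      (pullForm g (f ∘ (extChartAt (𝓡 m) x₀).symm)) (pullForm g (f ∘ (extChartAt (𝓡 m) x₁).symm)) u := by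
  have hO := (continuousOn_extChartAt_symm (I := 𝓡 m) x₁).isOpen_inter_preimage
    (isOpen_extChartAt_target x₁) (isOpen_extChartAt_source (I := 𝓡 m) x₀)
  filter_upwards [hO.mem_nhds ⟨hu, hx⟩] with u' hu' v w
  have heq : f ∘ (extChartAt (𝓡 m) x₁).symm =ᶠ[𝓝 u'] (f ∘ (extChartAt (𝓡 m) x₀).symm) ∘
      (extChartAt (𝓡 m) x₀ ∘ (extChartAt (𝓡 m) x₁).symm) := by
    filter_upwards [hO.mem_nhds hu'] with q hq
    exact (congrArg f ((extChartAt (𝓡 m) x₀).left_inv hq.2)).symm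
  have ht := (extChartAt (𝓡 m) x₀).map_source hu'.2
  rw [pullForm_comp (V := 𝓔 m) (W := 𝓔 m) g heq
    (((contMDiffOn_comp_chart_symm hf x₀).contMDiffAt
      ((isOpen_extChartAt_target x₀).mem_nhds ht)).mdifferentiableAt (by simp))
    ((contDiffAt_transition hu'.1 hu'.2).differentiableAt (by simp)).mdifferentiableAt,
    mfderiv_eq_fderiv]
  rfl

lemma comp_chart_symm_injective {f : M → N} (hf : IsSmoothImmersion m n f) (x₀ : M) {u : 𝓔 m}
    (hu : u ∈ (extChartAt (𝓡 m) x₀).target) :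
    Function.Injective (mfderiv (𝓡 m) (𝓡 n) (f ∘ (extChartAt (𝓡 m) x₀).symm) u) := by
  rw [mfderiv_comp u (hf.1.mdifferentiable (by simp) _)
    ((chart_symm_contMDiffAt x₀ hu).mdifferentiableAt (by simp))]
  exact (hf.2 _).comp (chart_symm_injective x₀ hu)

lemma localForm_isInnerForm (g : RMetric n N) {f : M → N} (hf : IsSmoothImmersion m n f) (x₀ : M)
    {u : 𝓔 m} (hu : u ∈ (extChartAt (𝓡 m) x₀).target) :
    IsInnerForm (pullForm (V := 𝓔 m) g (f ∘ (extChartAt (𝓡 m) x₀).symm) u) :=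
  pullForm_isInnerForm g (comp_chart_symm_injective hf x₀ hu)

lemma contDiffAt_localForm (g : RMetric n N) {f : M → N} (hf : ContMDiff (𝓡 m) (𝓡 n) ∞ f) (x₀ : M)
    {u : 𝓔 m} (hu : u ∈ (extChartAt (𝓡 m) x₀).target) :
    ContDiffAt ℝ ∞ (pullForm (V := 𝓔 m) g (f ∘ (extChartAt (𝓡 m) x₀).symm)) u :=
  contDiffAt_pullForm g (isOpen_extChartAt_target x₀) (contMDiffOn_comp_chart_symm hf x₀) hu

/-- The second fundamental form read in the preferred charts at `x₀` and `y₀`. -/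
def localSff (g : RMetric n N) (f : M → N) (x₀ : M) (y₀ : N) (u : 𝓔 m) (v w : 𝓔 m) : 𝓔 n :=
  sff (pullForm g (extChartAt (𝓡 n) y₀).symm) (pullForm g (f ∘ (extChartAt (𝓡 m) x₀).symm))
    (extChartAt (𝓡 n) y₀ ∘ f ∘ (extChartAt (𝓡 m) x₀).symm) u v w

/-- The mean curvature read in the preferred charts at `x₀` and `y₀`. -/
def localMeanCurvature (g : RMetric n N) (f : M → N) (x₀ : M) (y₀ : N) (u : 𝓔 m) : 𝓔 n :=
  formTrace (formMatrix (pullForm g (f ∘ (extChartAt (𝓡 m) x₀).symm) u)) (localSff g f x₀ y₀ u)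

/-- The points of the preferred chart at `x₀` that `f` maps into the preferred chart at `y₀`. -/
def localDomain (f : M → N) (x₀ : M) (y₀ : N) : Set (𝓔 m) :=
  (extChartAt (𝓡 m) x₀).target ∩
    (f ∘ (extChartAt (𝓡 m) x₀).symm) ⁻¹' (extChartAt (𝓡 n) y₀).source

lemma isOpen_localDomain {f : M → N} (hf : ContMDiff (𝓡 m) (𝓡 n) ∞ f) (x₀ : M) (y₀ : N) :
    IsOpen (localDomain (m := m) (n := n) f x₀ y₀) :=
  (contMDiffOn_comp_chart_symm hf x₀).continuousOn.isOpen_inter_preimage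
    (isOpen_extChartAt_target x₀) (isOpen_extChartAt_source y₀)

lemma localPullback (g : RMetric n N) {f : M → N} (hf : ContMDiff (𝓡 m) (𝓡 n) ∞ f) {x₀ : M} {y₀ : N}
    {u : 𝓔 m} (hu : u ∈ localDomain (m := m) (n := n) f x₀ y₀) :
    ContDiffAt ℝ ∞ (extChartAt (𝓡 n) y₀ ∘ f ∘ (extChartAt (𝓡 m) x₀).symm) u ∧
    (extChartAt (𝓡 n) y₀ ∘ f ∘ (extChartAt (𝓡 m) x₀).symm) u ∈ (extChartAt (𝓡 n) y₀).target ∧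
    IsPullbackAt (extChartAt (𝓡 n) y₀ ∘ f ∘ (extChartAt (𝓡 m) x₀).symm)
      (pullForm g (extChartAt (𝓡 n) y₀).symm)
      (pullForm g (f ∘ (extChartAt (𝓡 m) x₀).symm)) u := by
  have h := isPullbackAt_chart g y₀ ((contMDiffOn_comp_chart_symm hf x₀).contMDiffAt
      ((isOpen_extChartAt_target x₀).mem_nhds hu.1)) hu.2
  exact ⟨h.1, (extChartAt (𝓡 n) y₀).map_source hu.2, h.2.2⟩

lemma localSff_normal (g : RMetric n N) {f : M → N} (hf : IsSmoothImmersion m n f) {x₀ : M} {y₀ : N}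
    {u : 𝓔 m} (hu : u ∈ localDomain (m := m) (n := n) f x₀ y₀) (v w z : 𝓔 m) :
    pullForm (V := 𝓔 n) g (extChartAt (𝓡 n) y₀).symm
      ((extChartAt (𝓡 n) y₀ ∘ f ∘ (extChartAt (𝓡 m) x₀).symm) u) (localSff g f x₀ y₀ u v w)
      (fderiv ℝ (extChartAt (𝓡 n) y₀ ∘ f ∘ (extChartAt (𝓡 m) x₀).symm) u z) = 0 := by
  obtain ⟨h1, h2, h3⟩ := localPullback g hf.1 hu
  exact sff_normal (h1.of_le (by norm_cast))
    ((contDiffAt_chartForm g y₀ h2).differentiableAt (by simp))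
    ((contDiffAt_localForm g hf.1 x₀ hu.1).differentiableAt (by simp))
    (chartForm_isInnerForm g y₀ h2) (localForm_isInnerForm g hf x₀ hu.1) h3 v w z

lemma localSff_change_source (g : RMetric n N) {f : M → N} (hf : IsSmoothImmersion m n f)
    {x₀ x₁ : M} {y₀ : N} {u : 𝓔 m} (hu : u ∈ localDomain (m := m) (n := n) f x₁ y₀)
    (hx : (extChartAt (𝓡 m) x₁).symm u ∈ (extChartAt (𝓡 m) x₀).source)
    (hdet : (fderiv ℝ (extChartAt (𝓡 m) x₀ ∘ (extChartAt (𝓡 m) x₁).symm) u).det ≠ 0) (v w : 𝓔 m) :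
    localSff g f x₁ y₀ u v w =
      localSff g f x₀ y₀ (extChartAt (𝓡 m) x₀ ((extChartAt (𝓡 m) x₁).symm u))
        (fderiv ℝ (extChartAt (𝓡 m) x₀ ∘ (extChartAt (𝓡 m) x₁).symm) u v)
        (fderiv ℝ (extChartAt (𝓡 m) x₀ ∘ (extChartAt (𝓡 m) x₁).symm) u w) := by
  have hO := (continuousOn_extChartAt_symm (I := 𝓡 m) x₁).isOpen_inter_preimage
    (isOpen_extChartAt_target x₁) (isOpen_extChartAt_source (I := 𝓡 m) x₀)
  have ht := (extChartAt (𝓡 m) x₀).map_source hx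
  have hu0 : (extChartAt (𝓡 m) x₀) ((extChartAt (𝓡 m) x₁).symm u) ∈ localDomain (m := m) (n := n) f x₀ y₀ := by
    refine ⟨ht, ?_⟩
    rw [Set.mem_preimage, Function.comp_apply, (extChartAt (𝓡 m) x₀).left_inv hx]
    exact hu.2
  have hF' : extChartAt (𝓡 n) y₀ ∘ f ∘ (extChartAt (𝓡 m) x₁).symm =ᶠ[𝓝 u]
      (extChartAt (𝓡 n) y₀ ∘ f ∘ (extChartAt (𝓡 m) x₀).symm) ∘
        (extChartAt (𝓡 m) x₀ ∘ (extChartAt (𝓡 m) x₁).symm) := by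
    filter_upwards [hO.mem_nhds ⟨hu.1, hx⟩] with q hq
    exact (congrArg (extChartAt (𝓡 n) y₀ ∘ f) ((extChartAt (𝓡 m) x₀).left_inv hq.2)).symm
  exact sff_comp_right ((contDiffAt_transition hu.1 hx).of_le (by norm_cast)) hdet
    ((localPullback g hf.1 hu0).1.of_le (by norm_cast)) hF'
    ((contDiffAt_localForm g hf.1 x₀ ht).differentiableAt (by simp))
    ((contDiffAt_localForm g hf.1 x₁ hu.1).differentiableAt (by simp))
    (localForm_isInnerForm g hf x₀ ht) (localForm_isInnerForm g hf x₁ hu.1)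
    (pullForm_transition g hf.1 hu.1 hx) v w

lemma localSff_change_target (g : RMetric n N) {f : M → N} (hf : IsSmoothImmersion m n f)
    {x₀ : M} {y₀ y₁ : N} {u : 𝓔 m} (hu : u ∈ localDomain (m := m) (n := n) f x₀ y₀) (hu' : u ∈ localDomain (n := n) f x₀ y₁)
    (hdet : (fderiv ℝ (extChartAt (𝓡 n) y₁ ∘ (extChartAt (𝓡 n) y₀).symm)
      ((extChartAt (𝓡 n) y₀ ∘ f ∘ (extChartAt (𝓡 m) x₀).symm) u)).det ≠ 0) (v w : 𝓔 m) :
    localSff g f x₀ y₁ u v w =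
      fderiv ℝ (extChartAt (𝓡 n) y₁ ∘ (extChartAt (𝓡 n) y₀).symm)
        ((extChartAt (𝓡 n) y₀ ∘ f ∘ (extChartAt (𝓡 m) x₀).symm) u) (localSff g f x₀ y₀ u v w) := by
  obtain ⟨h1, h2, -⟩ := localPullback g hf.1 hu
  obtain ⟨h1', h2', -⟩ := localPullback g hf.1 hu'
  have hy : (extChartAt (𝓡 n) y₀).symm
      ((extChartAt (𝓡 n) y₀ ∘ f ∘ (extChartAt (𝓡 m) x₀).symm) u) =
      (f ∘ (extChartAt (𝓡 m) x₀).symm) u := (extChartAt (𝓡 n) y₀).left_inv hu.2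
  have hx : (extChartAt (𝓡 n) y₀).symm
      ((extChartAt (𝓡 n) y₀ ∘ f ∘ (extChartAt (𝓡 m) x₀).symm) u) ∈
      (extChartAt (𝓡 n) y₁).source := by rw [hy]; exact hu'.2
  have hF' : extChartAt (𝓡 n) y₁ ∘ f ∘ (extChartAt (𝓡 m) x₀).symm =ᶠ[𝓝 u]
      (extChartAt (𝓡 n) y₁ ∘ (extChartAt (𝓡 n) y₀).symm) ∘
        (extChartAt (𝓡 n) y₀ ∘ f ∘ (extChartAt (𝓡 m) x₀).symm) := by
    filter_upwards [(isOpen_localDomain hf.1 x₀ y₀).mem_nhds hu] with q hq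
    exact (congrArg (extChartAt (𝓡 n) y₁) ((extChartAt (𝓡 n) y₀).left_inv hq.2)).symm
  have hval := hF'.self_of_nhds
  have hpull := (isPullbackAt_chart g y₁ (chart_symm_contMDiffAt y₀ h2) hx).2.2
  have h2'' : (extChartAt (𝓡 n) y₁ ∘ (extChartAt (𝓡 n) y₀).symm)
      ((extChartAt (𝓡 n) y₀ ∘ f ∘ (extChartAt (𝓡 m) x₀).symm) u) ∈
      (extChartAt (𝓡 n) y₁).target := (extChartAt (𝓡 n) y₁).map_source hx
  exact sff_comp_left (h1.of_le (by norm_cast))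
    ((contDiffAt_transition h2 hx).of_le (by norm_cast)) hdet hF'
    ((contDiffAt_chartForm g y₁ h2'').differentiableAt (by simp))
    ((contDiffAt_chartForm g y₀ h2).differentiableAt (by simp))
    (chartForm_isInnerForm g y₁ h2'') (chartForm_isInnerForm g y₀ h2) hpull v w

lemma map_formTrace {k : ℕ} {X Y : Type*} [AddCommGroup X] [Module ℝ X] [AddCommGroup Y] [Module ℝ Y]
    (L : X →ₗ[ℝ] Y) (γ : Matrix (Fin k) (Fin k) ℝ) (S : 𝓔 k → 𝓔 k → X) :
    L (formTrace γ S) = formTrace γ (fun v w => L (S v w)) := by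
  simp only [formTrace, map_sum, map_smul]

lemma mem_localDomain (f : M → N) {x₀ x : M} {y₀ : N} (hx : x ∈ (extChartAt (𝓡 m) x₀).source)
    (hy : f x ∈ (extChartAt (𝓡 n) y₀).source) :
    extChartAt (𝓡 m) x₀ x ∈ localDomain (m := m) (n := n) f x₀ y₀ := by
  refine ⟨(extChartAt (𝓡 m) x₀).map_source hx, ?_⟩
  rw [Set.mem_preimage, Function.comp_apply, (extChartAt (𝓡 m) x₀).left_inv hx]
  exact hy

lemma exists_localSff_bilin (g : RMetric n N) {f : M → N} (hf : IsSmoothImmersion m n f) {x₀ : M}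
    {y₀ : N} {u : 𝓔 m} (hu : u ∈ localDomain (m := m) (n := n) f x₀ y₀) :
    ∃ S : 𝓔 m →ₗ[ℝ] 𝓔 m →ₗ[ℝ] 𝓔 n, ∀ v w, S v w = localSff g f x₀ y₀ u v w :=
  exists_sff_bilin ((localPullback g hf.1 hu).1.of_le (by norm_cast))

/-- The mean curvature does not depend on the charts used to compute it. -/
lemma localMeanCurvature_eq (g : RMetric n N) {f : M → N} (hf : IsSmoothImmersion m n f) {x₀ x : M}
    {y₀ : N} (hx : x ∈ (extChartAt (𝓡 m) x₀).source) (hy : f x ∈ (extChartAt (𝓡 n) y₀).source) :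
    localMeanCurvature g f x₀ y₀ (extChartAt (𝓡 m) x₀ x) =
      chartDeriv (k := n) y₀ (f x) (meanCurvature (m := m) g f x) := by
  have hxx : (extChartAt (𝓡 m) x).symm (extChartAt (𝓡 m) x x) = x := extChartAt_to_inv x
  have hx' : (extChartAt (𝓡 m) x).symm (extChartAt (𝓡 m) x x) ∈ (extChartAt (𝓡 m) x₀).source := by
    rwa [hxx]
  have hFx : (extChartAt (𝓡 n) (f x) ∘ f ∘ (extChartAt (𝓡 m) x).symm) (extChartAt (𝓡 m) x x) =
      extChartAt (𝓡 n) (f x) (f x) := by simp only [Function.comp_apply, hxx]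
  -- The second fundamental form at `x` is by definition computed in the charts at `x` and `f x`. It
  -- is carried first to the target chart at `y₀`, then to the source chart at `x₀`.
  have hS : ∀ v w, chartDeriv (k := n) y₀ (f x)
      (localSff g f x (f x) (extChartAt (𝓡 m) x x) v w) =
      localSff g f x₀ y₀ (extChartAt (𝓡 m) x₀ x) (chartDeriv x₀ x v) (chartDeriv x₀ x w) := by
    intro v w
    have h1 := localSff_change_target g hf
      (mem_localDomain f (mem_extChartAt_source (I := 𝓡 m) x) (mem_extChartAt_source (I := 𝓡 n) (f x)))
      (mem_localDomain f (mem_extChartAt_source (I := 𝓡 m) x) hy)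
      (by rw [hFx, fderiv_transition hy]; exact chartDeriv_det_ne_zero hy) v w
    have h2 := localSff_change_source g hf
      (mem_localDomain f (mem_extChartAt_source (I := 𝓡 m) x) hy) hx'
      (by rw [fderiv_transition hx]; exact chartDeriv_det_ne_zero hx) v w
    rw [hFx, fderiv_transition hy] at h1
    rw [fderiv_transition hx, hxx] at h2
    rw [← h1, h2]
  obtain ⟨S, hSb⟩ := exists_localSff_bilin g hf (mem_localDomain f hx hy)
  have h3 := formTrace_comp _ _ _ (chartDeriv_det_ne_zero hx) (pullForm_eq_chart g hf.1 hx) S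
  simp only [hSb, ← hS] at h3
  rw [localMeanCurvature]
  refine h3.symm.trans ?_
  exact (map_formTrace (chartDeriv (k := n) y₀ (f x)).toLinearMap _ _).symm

lemma fderiv_local_chartDeriv {f : M → N} (hf : ContMDiff (𝓡 m) (𝓡 n) ∞ f) {x₀ x : M}
    {y₀ : N} (hx : x ∈ (extChartAt (𝓡 m) x₀).source) (hy : f x ∈ (extChartAt (𝓡 n) y₀).source)
    (v : 𝓔 m) :
    fderiv ℝ (extChartAt (𝓡 n) y₀ ∘ f ∘ (extChartAt (𝓡 m) x₀).symm) (extChartAt (𝓡 m) x₀ x)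
      (chartDeriv x₀ x v) = chartDeriv (k := n) y₀ (f x) (mfderiv (𝓡 m) (𝓡 n) f x v) := by
  have hψ : MDifferentiableAt (𝓡 n) (𝓡 n) (extChartAt (𝓡 n) y₀) (f x) :=
    (chart_contMDiffAt y₀ hy).mdifferentiableAt (by simp)
  have hφ : MDifferentiableAt (𝓡 m) (𝓡 m) (extChartAt (𝓡 m) x₀) x :=
    (chart_contMDiffAt x₀ hx).mdifferentiableAt (by simp)
  have hfx : MDifferentiableAt (𝓡 m) (𝓡 n) f x := hf.mdifferentiable (by simp) x
  have heq : extChartAt (𝓡 n) y₀ ∘ f =ᶠ[𝓝 x]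
      (extChartAt (𝓡 n) y₀ ∘ f ∘ (extChartAt (𝓡 m) x₀).symm) ∘ extChartAt (𝓡 m) x₀ := by
    filter_upwards [(isOpen_extChartAt_source x₀).mem_nhds hx] with q hq
    exact (congrArg (extChartAt (𝓡 n) y₀ ∘ f) ((extChartAt (𝓡 m) x₀).left_inv hq)).symm
  have hu := mem_localDomain f hx hy
  have hF : DifferentiableAt ℝ (extChartAt (𝓡 n) y₀ ∘ f ∘ (extChartAt (𝓡 m) x₀).symm)
      (extChartAt (𝓡 m) x₀ x) := by
    have h1 := (chart_contMDiffAt y₀ hu.2).comp _ ((contMDiffOn_comp_chart_symm hf x₀).contMDiffAt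
      ((isOpen_extChartAt_target x₀).mem_nhds hu.1))
    exact (contMDiffAt_iff_contDiffAt.1 h1).differentiableAt (by simp)
  have h1 := heq.mfderiv_eq (I := 𝓡 m) (I' := 𝓡 n)
  rw [mfderiv_comp x hψ hfx, mfderiv_comp x hF.mdifferentiableAt hφ, mfderiv_eq_fderiv] at h1
  exact (congrArg (fun L : 𝓔 m →L[ℝ] 𝓔 n => L v) h1).symm

lemma inner_meanCurvature_eq (g : RMetric n N) {f : M → N} (hf : IsSmoothImmersion m n f) {x₀ x : M}
    {y₀ : N} (hx : x ∈ (extChartAt (𝓡 m) x₀).source) (hy : f x ∈ (extChartAt (𝓡 n) y₀).source)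
    (k : TangentSpace (𝓡 n) (f x)) :
    g.inner (f x) (meanCurvature (m := m) g f x) k =
      pullForm (V := 𝓔 n) g (extChartAt (𝓡 n) y₀).symm (extChartAt (𝓡 n) y₀ (f x))
        (localMeanCurvature g f x₀ y₀ (extChartAt (𝓡 m) x₀ x)) (chartDeriv y₀ (f x) k) := by
  rw [localMeanCurvature_eq g hf hx hy, chartForm_chartDeriv g hy]

/-- The mean curvature is a linear combination of values of the second fundamental form, each of
which is normal. -/
lemma meanCurvature_normal (g : RMetric n N) {f : M → N} (hf : IsSmoothImmersion m n f) (x : M)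
    (v : 𝓔 m) :
    g.inner (f x) (meanCurvature (m := m) g f x) (mfderiv (𝓡 m) (𝓡 n) f x v) = 0 := by
  have hx := mem_extChartAt_source (I := 𝓡 m) x
  have hy := mem_extChartAt_source (I := 𝓡 n) (f x)
  have hxx : (extChartAt (𝓡 m) x).symm (extChartAt (𝓡 m) x x) = x := extChartAt_to_inv x
  have hn := localSff_normal g hf (mem_localDomain f hx hy)
  simp only [Function.comp_apply, hxx] at hn
  rw [inner_meanCurvature_eq g hf hx hy, ← fderiv_local_chartDeriv hf.1 hx hy, localMeanCurvature,
    formTrace]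
  simp only [map_sum, map_smul, sum_apply, smul_apply]
  exact Finset.sum_eq_zero fun i _ => Finset.sum_eq_zero fun j _ => by
    rw [show _ = (0 : ℝ) from hn _ _ _, smul_zero]

end StaticForms

/-! ### Continuity of the coordinate expressions. -/

section Continuity

variable {m n k : ℕ} {X : Type*} [TopologicalSpace X]

lemma contDiffAt_formMatrix {V : Type*} [NormedAddCommGroup V] [NormedSpace ℝ V] {r : ℕ∞ω}
    {B : V → 𝓔 k →L[ℝ] 𝓔 k →L[ℝ] ℝ} {u : V} (hB : ContDiffAt ℝ r B u) (i j : Fin k) :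
    ContDiffAt ℝ r (fun u' => formMatrix (B u') i j) u :=
  (hB.clm_apply contDiffAt_const).clm_apply contDiffAt_const

/-- Base point and both arguments are allowed to move, as they do in the second fundamental form,
where they are `F u`, `DF_u v` and `DF_u w`. -/
lemma continuousAt_christoffel {B : 𝓔 k → 𝓔 k →L[ℝ] 𝓔 k →L[ℝ] ℝ} {p v w : X → 𝓔 k} {x : X}
    (hB : ContDiffAt ℝ 1 B (p x)) (hdet : (formMatrix (B (p x))).det ≠ 0) (hp : ContinuousAt p x)
    (hv : ContinuousAt v x) (hw : ContinuousAt w x) :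
    ContinuousAt (fun y => christoffel (fun u' => formMatrix (B u')) (p y) (v y) (w y)) x := by
  have hγ := contDiffAt_formMatrix hB
  have h1 : ∀ i j q, ContinuousAt
      (fun y => fderiv ℝ (fun u' => formMatrix (B u') i j) (p y) (e q)) x := fun i j q =>
    (ContinuousAt.comp (g := fderiv ℝ (fun u' => formMatrix (B u') i j))
      ((hγ i j).fderiv_right (m := 0) (by norm_num)).continuousAt hp).clm_apply continuousAt_const
  have h2 : ∀ i j, ContinuousAt (fun y => (formMatrix (B (p y)))⁻¹ i j) x := fun i j =>
    ContinuousAt.comp (g := fun u' => (formMatrix (B u'))⁻¹ i j)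
      (contDiffAt_inv hγ hdet i j).continuousAt hp
  have h3 : ∀ l i j, ContinuousAt
      (fun y => christoffelSymbol (fun u' => formMatrix (B u')) (p y) l i j) x := by
    intro l i j
    unfold christoffelSymbol
    exact continuousAt_const.mul (tendsto_finsetSum _ fun q _ =>
      (h2 l q).mul (((h1 j q i).add (h1 i q j)).sub (h1 i j q)))
  have hc : ∀ (a : X → 𝓔 k), ContinuousAt a x → ∀ i, ContinuousAt (fun y => a y i) x :=
    fun a ha i => ((EuclideanSpace.proj (𝕜 := ℝ) i).continuous.continuousAt).comp ha
  unfold christoffel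
  refine (PiLp.continuous_toLp 2 _).continuousAt.comp (continuousAt_pi.2 fun l => ?_)
  exact tendsto_finsetSum _ fun i _ => tendsto_finsetSum _ fun j _ =>
    ((h3 l i j).mul (hc v hv i)).mul (hc w hw j)

lemma continuousAt_sff {B : 𝓔 n → 𝓔 n →L[ℝ] 𝓔 n →L[ℝ] ℝ} {β : 𝓔 m → 𝓔 m →L[ℝ] 𝓔 m →L[ℝ] ℝ}
    {F : 𝓔 m → 𝓔 n} {u : 𝓔 m} (hF : ContDiffAt ℝ ∞ F u) (hB : ContDiffAt ℝ ∞ B (F u))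
    (hβ : ContDiffAt ℝ ∞ β u) (hdB : (formMatrix (B (F u))).det ≠ 0)
    (hdβ : (formMatrix (β u)).det ≠ 0) (v w : 𝓔 m) :
    ContinuousAt (fun u' => sff B β F u' v w) u := by
  have h1 : ContDiffAt ℝ ∞ (fderiv ℝ F) u := hF.fderiv_right (by simp)
  have h1' : ∀ z, ContDiffAt ℝ ∞ (fun u' => fderiv ℝ F u' z) u := fun z =>
    h1.clm_apply contDiffAt_const
  have h2 : ContinuousAt (fun u' => fderiv ℝ (fun u'' => fderiv ℝ F u'' w) u' v) u :=
    ((h1' w).fderiv_right (m := ∞) (by simp)).continuousAt.clm_apply continuousAt_const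
  unfold sff
  exact (h2.add (continuousAt_christoffel (hB.of_le (by norm_cast)) hdB hF.continuousAt
    (h1' v).continuousAt (h1' w).continuousAt)).sub (h1.continuousAt.clm_apply
      (continuousAt_christoffel (hβ.of_le (by norm_cast)) hdβ continuousAt_id continuousAt_const
        continuousAt_const))

end Continuity

/-! ### Continuity of the squared norm of the mean curvature. -/

section StaticContinuity

variable {m n : ℕ} {M : Type*} [TopologicalSpace M] [ChartedSpace (𝓔 m) M] [IsManifold (𝓡 m) ∞ M]
  {N : Type*} [TopologicalSpace N] [ChartedSpace (𝓔 n) N] [IsManifold (𝓡 n) ∞ N]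

lemma continuousAt_localMeanCurvature (g : RMetric n N) {f : M → N} (hf : IsSmoothImmersion m n f)
    {x₀ : M} {y₀ : N} {u : 𝓔 m} (hu : u ∈ localDomain (m := m) (n := n) f x₀ y₀) :
    ContinuousAt (localMeanCurvature g f x₀ y₀) u := by
  obtain ⟨h1, h2, -⟩ := localPullback g hf.1 hu
  have hβ := contDiffAt_localForm g hf.1 x₀ hu.1
  have hd := (localForm_isInnerForm g hf x₀ hu.1).det_pos.ne'
  unfold localMeanCurvature formTrace
  exact tendsto_finsetSum _ fun i _ => tendsto_finsetSum _ fun j _ =>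
    (contDiffAt_inv (contDiffAt_formMatrix hβ) hd i j).continuousAt.smul
      (continuousAt_sff h1 (contDiffAt_chartForm g y₀ h2) hβ
        (chartForm_isInnerForm g y₀ h2).det_pos.ne' hd _ _)

lemma continuous_inner_meanCurvature (g : RMetric n N) {f : M → N} (hf : IsSmoothImmersion m n f) :
    Continuous fun x => g.inner (f x) (meanCurvature (m := m) g f x) (meanCurvature (m := m) g f x) := by
  refine continuous_iff_continuousAt.2 fun x₀ => ?_
  have hx := mem_extChartAt_source (I := 𝓡 m) x₀
  have hy := mem_extChartAt_source (I := 𝓡 n) (f x₀)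
  -- The coordinates of the mean curvature at `x` refer to a chart chosen at `f x`, with no
  -- continuity in `x`. Passing to the fixed charts at `x₀` and `f x₀` removes this dependence.
  have hev : (fun x => g.inner (f x) (meanCurvature (m := m) g f x) (meanCurvature (m := m) g f x))
      =ᶠ[𝓝 x₀] fun x => pullForm (V := 𝓔 n) g (extChartAt (𝓡 n) (f x₀)).symm
        (extChartAt (𝓡 n) (f x₀) (f x)) (localMeanCurvature g f x₀ (f x₀) (extChartAt (𝓡 m) x₀ x))
        (localMeanCurvature g f x₀ (f x₀) (extChartAt (𝓡 m) x₀ x)) := by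
    filter_upwards [(isOpen_extChartAt_source x₀).mem_nhds hx, hf.1.continuous.continuousAt.eventually
      ((isOpen_extChartAt_source (I := 𝓡 n) (f x₀)).mem_nhds hy)] with x h1 h2
    rw [localMeanCurvature_eq g hf h1 h2, chartForm_chartDeriv g h2]
  refine ContinuousAt.congr ?_ hev.symm
  have hφ : ContinuousAt (extChartAt (𝓡 m) x₀) x₀ := continuousAt_extChartAt x₀
  have hH : ContinuousAt (fun x => localMeanCurvature g f x₀ (f x₀) (extChartAt (𝓡 m) x₀ x)) x₀ :=
    ContinuousAt.comp (g := localMeanCurvature g f x₀ (f x₀))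
      (continuousAt_localMeanCurvature g hf (mem_localDomain f hx hy)) hφ
  have hψ : ContinuousAt (fun x => extChartAt (𝓡 n) (f x₀) (f x)) x₀ :=
    ContinuousAt.comp (g := extChartAt (𝓡 n) (f x₀)) (continuousAt_extChartAt (f x₀))
      hf.1.continuous.continuousAt
  have hB : ContinuousAt (fun x => pullForm (V := 𝓔 n) g (extChartAt (𝓡 n) (f x₀)).symm
      (extChartAt (𝓡 n) (f x₀) (f x))) x₀ :=
    ContinuousAt.comp (g := pullForm (V := 𝓔 n) g (extChartAt (𝓡 n) (f x₀)).symm)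
      (contDiffAt_chartForm g (f x₀) (mem_extChartAt_target (f x₀))).continuousAt hψ
  exact (hB.clm_apply hH).clm_apply hH

end StaticContinuity

/-! ### Paths of maps and their velocity read in a source chart. -/

section Paths

variable {m n : ℕ} {M : Type*} [TopologicalSpace M] [ChartedSpace (𝓔 m) M] [IsManifold (𝓡 m) ∞ M]
  {N : Type*} [TopologicalSpace N] [ChartedSpace (𝓔 n) N] [IsManifold (𝓡 n) ∞ N]

lemma isOpen_pathDomain (x₀ : M) :
    IsOpen ((Set.univ : Set ℝ) ×ˢ (extChartAt (𝓡 m) x₀).target) :=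
  isOpen_univ.prod (isOpen_extChartAt_target x₀)

/-- A path of maps, read in the preferred chart of the source at `x₀`. -/
def localPath (c : ℝ × M → N) (x₀ : M) (p : ℝ × 𝓔 m) : N := c (p.1, (extChartAt (𝓡 m) x₀).symm p.2)

/-- The velocity `∂_t c` of a path of maps. -/
def velocity (n : ℕ) {N : Type*} [TopologicalSpace N] [ChartedSpace (𝓔 n) N] (c : ℝ × M → N)
    (t : ℝ) (x : M) : TangentSpace (𝓡 n) (c (t, x)) :=
  mfderiv 𝓘(ℝ, ℝ) (𝓡 n) (fun s => c (s, x)) t (1 : ℝ)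

variable {c : ℝ × M → N} (hc : ContMDiff (𝓘(ℝ, ℝ).prod (𝓡 m)) (𝓡 n) ∞ c)
include hc

lemma contMDiffOn_localPath (x₀ : M) :
    ContMDiffOn 𝓘(ℝ, ℝ × 𝓔 m) (𝓡 n) ∞ (localPath c x₀)
      (Set.univ ×ˢ (extChartAt (𝓡 m) x₀).target) := by
  refine hc.comp_contMDiffOn ((contDiff_fst.contMDiff.contMDiffOn).prodMk ?_)
  exact (contMDiffOn_extChartAt_symm x₀).comp contDiff_snd.contMDiff.contMDiffOn fun p hp => hp.2

lemma contMDiffAt_localPath {x₀ : M} (t : ℝ) {u : 𝓔 m} (hu : u ∈ (extChartAt (𝓡 m) x₀).target) :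
    ContMDiffAt 𝓘(ℝ, ℝ × 𝓔 m) (𝓡 n) ∞ (localPath c x₀) (t, u) :=
  (contMDiffOn_localPath hc x₀).contMDiffAt ((isOpen_pathDomain x₀).mem_nhds ⟨trivial, hu⟩)

lemma contDiffAt_pathForm (g : RMetric n N) {x₀ : M} (t : ℝ) {u : 𝓔 m}
    (hu : u ∈ (extChartAt (𝓡 m) x₀).target) :
    ContDiffAt ℝ ∞ (pullForm (V := ℝ × 𝓔 m) g (localPath c x₀)) (t, u) :=
  contDiffAt_pullForm g (isOpen_pathDomain x₀) (contMDiffOn_localPath hc x₀) ⟨trivial, hu⟩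

lemma contMDiff_slice (t : ℝ) : ContMDiff (𝓡 m) (𝓡 n) ∞ fun x => c (t, x) :=
  hc.comp (contMDiff_const.prodMk contMDiff_id)

lemma mfderiv_localPath_time {x₀ : M} (t : ℝ) {u : 𝓔 m} (hu : u ∈ (extChartAt (𝓡 m) x₀).target) :
    mfderiv 𝓘(ℝ, ℝ × 𝓔 m) (𝓡 n) (localPath c x₀) (t, u) ((1, 0) : ℝ × 𝓔 m) =
      velocity n c t ((extChartAt (𝓡 m) x₀).symm u) := by
  have hl : HasFDerivAt (fun s : ℝ => ((s, u) : ℝ × 𝓔 m)) (ContinuousLinearMap.inl ℝ ℝ (𝓔 m)) t :=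
    hasFDerivAt_prodMk_left t u
  have h := ((contMDiffAt_localPath hc t hu).mdifferentiableAt (by simp)).hasMFDerivAt.comp t
    hl.hasMFDerivAt
  rw [velocity, show (fun s => c (s, (extChartAt (𝓡 m) x₀).symm u)) =
    localPath c x₀ ∘ fun s : ℝ => ((s, u) : ℝ × 𝓔 m) from rfl, h.mfderiv]
  rfl

lemma mfderiv_localPath_space {x₀ : M} (t : ℝ) {u : 𝓔 m} (hu : u ∈ (extChartAt (𝓡 m) x₀).target)
    (v : 𝓔 m) :
    mfderiv 𝓘(ℝ, ℝ × 𝓔 m) (𝓡 n) (localPath c x₀) (t, u) ((0, v) : ℝ × 𝓔 m) =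
      mfderiv (𝓡 m) (𝓡 n) ((fun x => c (t, x)) ∘ (extChartAt (𝓡 m) x₀).symm) u v := by
  have hl : HasFDerivAt (fun u : 𝓔 m => ((t, u) : ℝ × 𝓔 m)) (ContinuousLinearMap.inr ℝ ℝ (𝓔 m)) u :=
    hasFDerivAt_prodMk_right t u
  have h := ((contMDiffAt_localPath hc t hu).mdifferentiableAt (by simp)).hasMFDerivAt.comp u
    hl.hasMFDerivAt
  rw [show ((fun x => c (t, x)) ∘ (extChartAt (𝓡 m) x₀).symm) =
    localPath c x₀ ∘ fun u : 𝓔 m => ((t, u) : ℝ × 𝓔 m) from rfl, h.mfderiv]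
  rfl

lemma spatialForm_pathForm (g : RMetric n N) {x₀ : M} (t : ℝ) {u : 𝓔 m}
    (hu : u ∈ (extChartAt (𝓡 m) x₀).target) :
    spatialForm (pullForm g (localPath c x₀)) t u =
      pullForm g ((fun x => c (t, x)) ∘ (extChartAt (𝓡 m) x₀).symm) u := by
  ext v w
  rw [spatialForm_apply, pullForm_apply, pullForm_apply, mfderiv_localPath_space hc t hu,
    mfderiv_localPath_space hc t hu]
  rfl

lemma mfderiv_slice (t : ℝ) {x₀ x : M} (hx : x ∈ (extChartAt (𝓡 m) x₀).source) (v : 𝓔 m) :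
    mfderiv (𝓡 m) (𝓡 n) ((fun x => c (t, x)) ∘ (extChartAt (𝓡 m) x₀).symm) (extChartAt (𝓡 m) x₀ x)
      (chartDeriv x₀ x v) = mfderiv (𝓡 m) (𝓡 n) (fun x => c (t, x)) x v := by
  have heq : (fun x => c (t, x)) =ᶠ[𝓝 x]
      ((fun x => c (t, x)) ∘ (extChartAt (𝓡 m) x₀).symm) ∘ extChartAt (𝓡 m) x₀ := by
    filter_upwards [(isOpen_extChartAt_source x₀).mem_nhds hx] with q hq
    exact (congrArg (fun x => c (t, x)) ((extChartAt (𝓡 m) x₀).left_inv hq)).symm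
  have ht := (extChartAt (𝓡 m) x₀).map_source hx
  rw [heq.mfderiv_eq (x := x), mfderiv_comp x (((contMDiffOn_comp_chart_symm (contMDiff_slice hc t)
    x₀).contMDiffAt ((isOpen_extChartAt_target x₀).mem_nhds ht)).mdifferentiableAt (by simp))
    ((chart_contMDiffAt x₀ hx).mdifferentiableAt (by simp))]
  rfl

lemma inner_velocity (g : RMetric n N) (t : ℝ) {x₀ x : M} (hx : x ∈ (extChartAt (𝓡 m) x₀).source) :
    g.inner (c (t, x)) (velocity n c t x) (velocity n c t x) =
      pullForm (V := ℝ × 𝓔 m) g (localPath c x₀) (t, extChartAt (𝓡 m) x₀ x) (1, 0) (1, 0) := by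
  have ht := (extChartAt (𝓡 m) x₀).map_source hx
  rw [pullForm_apply, mfderiv_localPath_time hc t ht]
  -- The base point `φ⁻¹(φ x)` is only propositionally equal to `x` and occurs in the types of the
  -- velocities, so the whole expression is transported at once.
  exact congrArg (fun y => g.inner (c (t, y)) (velocity n c t y) (velocity n c t y))
    ((extChartAt (𝓡 m) x₀).left_inv hx).symm

lemma inner_velocity_mfderiv (g : RMetric n N) (t : ℝ) {x₀ x : M}
    (hx : x ∈ (extChartAt (𝓡 m) x₀).source) (v : 𝓔 m) :
    g.inner (c (t, x)) (velocity n c t x) (mfderiv (𝓡 m) (𝓡 n) (fun x => c (t, x)) x v) =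
      pullForm (V := ℝ × 𝓔 m) g (localPath c x₀) (t, extChartAt (𝓡 m) x₀ x) (1, 0)
        (0, chartDeriv x₀ x v) := by
  have ht := (extChartAt (𝓡 m) x₀).map_source hx
  rw [pullForm_apply, mfderiv_localPath_time hc t ht, mfderiv_localPath_space hc t ht,
    mfderiv_slice hc t hx]
  exact congrArg (fun y => (g.inner (c (t, y)) : 𝓔 n →L[ℝ] 𝓔 n →L[ℝ] ℝ) (velocity n c t y)
    (mfderiv (𝓡 m) (𝓡 n) (fun x => c (t, x)) x v)) ((extChartAt (𝓡 m) x₀).left_inv hx).symm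

end Paths

/-! ### Orthogonal projection off the image of a linear map. -/

section NormalPart

variable {m n : ℕ}

/-- Pythagoras: the coefficients `a` of the tangential part solve `γ a = b(h, A e_i)`, so its square
and its pairing with `h` are both `∑ a_i b(h, A e_i)`, which is the trace on the right. The formula
expresses the norm of the normal velocity through the pullback form of the path alone. -/
lemma form_normal_projection (b : 𝓔 n →L[ℝ] 𝓔 n →L[ℝ] ℝ) (hb : ∀ v w, b v w = b w v)
    (A : 𝓔 m →L[ℝ] 𝓔 n) (hdet : (formMatrix (b.bilinearComp A A)).det ≠ 0) (h : 𝓔 n) :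
    b (h - ∑ i, ∑ j, ((formMatrix (b.bilinearComp A A))⁻¹ i j * b h (A (e j))) • A (e i))
      (h - ∑ i, ∑ j, ((formMatrix (b.bilinearComp A A))⁻¹ i j * b h (A (e j))) • A (e i)) =
    b h h - formTrace (formMatrix (b.bilinearComp A A)) (fun v w => b h (A v) * b h (A w)) := by
  set γ := formMatrix (b.bilinearComp A A) with hγ
  set a : Fin m → ℝ := fun i => ∑ j, γ⁻¹ i j * b h (A (e j)) with ha
  have hT : ∑ i, ∑ j, (γ⁻¹ i j * b h (A (e j))) • A (e i) = ∑ i, a i • A (e i) := by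
    simp only [ha, Finset.sum_smul]
  have hmul : ∀ i, ∑ j, γ i j * a j = b h (A (e i)) := by
    intro i
    have h1 := congrFun (congrArg (fun B : Matrix (Fin m) (Fin m) ℝ =>
      B.mulVec fun j => b h (A (e j))) (Matrix.mul_nonsing_inv γ hdet.isUnit)) i
    simp only [← Matrix.mulVec_mulVec, Matrix.one_mulVec] at h1
    exact h1
  have h1 : b h (∑ i, a i • A (e i)) = ∑ i, a i * b h (A (e i)) := by
    simp only [map_sum, map_smul, smul_eq_mul]
  have h2 : b (∑ i, a i • A (e i)) (∑ i, a i • A (e i)) = ∑ i, a i * b h (A (e i)) := by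
    simp only [← hmul, map_sum, map_smul, smul_eq_mul, sum_apply, smul_apply, Finset.mul_sum]
    refine Finset.sum_congr rfl fun i _ => Finset.sum_congr rfl fun j _ => ?_
    have : γ i j = b (A (e j)) (A (e i)) := hb _ _
    rw [this]; ring
  have h3 : formTrace γ (fun v w => b h (A v) * b h (A w)) = ∑ i, a i * b h (A (e i)) := by
    simp only [formTrace, ha, Finset.sum_mul, smul_eq_mul]
    exact Finset.sum_congr rfl fun i _ => Finset.sum_congr rfl fun j _ => by ring
  rw [hT]
  simp only [map_sub, sub_apply]
  rw [hb (∑ i, a i • A (e i)) h, h1, h2, h3]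
  ring

end NormalPart

/-! ### First variation of the density in intrinsic terms. -/

section FirstVariation

variable {m n : ℕ} {M : Type*} [TopologicalSpace M] [ChartedSpace (𝓔 m) M] [IsManifold (𝓡 m) ∞ M]
  {N : Type*} [TopologicalSpace N] [ChartedSpace (𝓔 n) N] [IsManifold (𝓡 n) ∞ N]

lemma gram_det_pos (g : RMetric n N) {f : M → N} (hf : IsSmoothImmersion m n f) (x : M) :
    0 < (formMatrix (pullForm (V := 𝓔 m) g f x)).det :=
  (pullForm_isInnerForm g (hf.2 x)).det_pos

lemma inner_normalPart (g : RMetric n N) {f : M → N} (hf : IsSmoothImmersion m n f) (x : M)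
    (h : TangentSpace (𝓡 n) (f x)) :
    g.inner (f x) (normalPart (m := m) g f x h) (normalPart (m := m) g f x h) =
      g.inner (f x) h h - formTrace (formMatrix (pullForm (V := 𝓔 m) g f x)) (fun v w =>
        g.inner (f x) h (mfderiv (𝓡 m) (𝓡 n) f x v) *
          g.inner (f x) h (mfderiv (𝓡 m) (𝓡 n) f x w)) :=
  form_normal_projection (g.inner (f x)) (g.symm (f x)) (mfderiv (𝓡 m) (𝓡 n) f x)
    (gram_det_pos g hf x).ne' h

lemma inner_meanCurvature_normalPart (g : RMetric n N) {f : M → N} (hf : IsSmoothImmersion m n f)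
    (x : M) (h : TangentSpace (𝓡 n) (f x)) :
    g.inner (f x) (meanCurvature (m := m) g f x) (normalPart (m := m) g f x h) =
      g.inner (f x) (meanCurvature (m := m) g f x) h := by
  rw [normalPart, map_sub, map_sum]
  simp only [map_sum, map_smul]
  rw [Finset.sum_eq_zero, sub_zero]
  exact fun i _ => Finset.sum_eq_zero fun j _ => by rw [meanCurvature_normal g hf, smul_zero]

variable {c : ℝ × M → N} (hc : ContMDiff (𝓘(ℝ, ℝ).prod (𝓡 m)) (𝓡 n) ∞ c)
include hc

lemma pullForm_slice (g : RMetric n N) (t : ℝ) {x₀ x : M}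
    (hx : x ∈ (extChartAt (𝓡 m) x₀).source) (v w : 𝓔 m) :
    pullForm (V := 𝓔 m) g (fun x => c (t, x)) x v w =
      spatialForm (pullForm g (localPath c x₀)) t (extChartAt (𝓡 m) x₀ x)
        (chartDeriv x₀ x v) (chartDeriv x₀ x w) := by
  rw [spatialForm_pathForm hc g t ((extChartAt (𝓡 m) x₀).map_source hx),
    pullForm_eq_chart g (contMDiff_slice hc t) hx]

/-- The squared norm of the normal velocity, read in a chart. -/
lemma inner_normal_velocity (g : RMetric n N) {t : ℝ} (ht : IsSmoothImmersion m n fun x => c (t, x))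
    {x₀ x : M} (hx : x ∈ (extChartAt (𝓡 m) x₀).source) :
    g.inner (c (t, x)) (normalPart (m := m) g (fun x => c (t, x)) x (velocity n c t x))
      (normalPart (m := m) g (fun x => c (t, x)) x (velocity n c t x)) =
    pullForm (V := ℝ × 𝓔 m) g (localPath c x₀) (t, extChartAt (𝓡 m) x₀ x) (1, 0) (1, 0) -
      formTrace (formMatrix (spatialForm (pullForm g (localPath c x₀)) t (extChartAt (𝓡 m) x₀ x)))
        (fun v w => pullForm (V := ℝ × 𝓔 m) g (localPath c x₀) (t, extChartAt (𝓡 m) x₀ x) (1, 0) (0, v)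
          * pullForm (V := ℝ × 𝓔 m) g (localPath c x₀) (t, extChartAt (𝓡 m) x₀ x) (1, 0) (0, w)) := by
  rw [inner_normalPart g ht x, inner_velocity hc g t hx]
  simp only [inner_velocity_mfderiv hc g t hx]
  let L : 𝓔 m →ₗ[ℝ] ℝ :=
    (pullForm (V := ℝ × 𝓔 m) g (localPath c x₀) (t, extChartAt (𝓡 m) x₀ x) (1, 0)).toLinearMap ∘ₗ
      LinearMap.inr ℝ ℝ (𝓔 m)
  have h := formTrace_comp _ _ _ (chartDeriv_det_ne_zero hx) (pullForm_slice hc g t hx)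
    ((LinearMap.mul ℝ ℝ).compl₁₂ L L)
  exact congrArg _ h

/-- The coordinate divergence of the tangential part of the velocity, times the volume density. -/
def tangentialFlux (g : RMetric n N) (c : ℝ × M → N) (x₀ : M) (t : ℝ) (i : Fin m) (u : 𝓔 m) : ℝ :=
  √(formMatrix (spatialForm (pullForm g (localPath c x₀)) t u)).det *
    ∑ j, (formMatrix (spatialForm (pullForm g (localPath c x₀)) t u))⁻¹ i j *
      pullForm (V := ℝ × 𝓔 m) g (localPath c x₀) (t, u) (0, e j) (1, 0)

/-- The coordinate formula `hasDerivAt_sqrt_det` is used with the target chart centred at `c (t,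
x)`. Chart independence identifies the trace with the mean curvature, and its normality allows the
velocity to be replaced by its normal part. -/
lemma hasDerivAt_density (g : RMetric n N) {t : ℝ} (ht : IsSmoothImmersion m n fun x => c (t, x))
    {x₀ x : M} (hx : x ∈ (extChartAt (𝓡 m) x₀).source) :
    HasDerivAt (fun s => √(formMatrix (spatialForm (pullForm g (localPath c x₀)) s
        (extChartAt (𝓡 m) x₀ x))).det)
      (∑ i, fderiv ℝ (tangentialFlux g c x₀ t i) (extChartAt (𝓡 m) x₀ x) (e i)
        - √(formMatrix (spatialForm (pullForm g (localPath c x₀)) t (extChartAt (𝓡 m) x₀ x))).det *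
          g.inner (c (t, x)) (meanCurvature (m := m) g (fun x => c (t, x)) x) 
            (normalPart (m := m) g (fun x => c (t, x)) x (velocity n c t x))) t := by
  have hy := mem_extChartAt_source (I := 𝓡 n) (c (t, x))
  have hu := (extChartAt (𝓡 m) x₀).map_source hx
  have hKx : localPath c x₀ (t, extChartAt (𝓡 m) x₀ x) = c (t, x) :=
    congrArg (fun y => c (t, y)) ((extChartAt (𝓡 m) x₀).left_inv hx)
  have hK := contMDiffAt_localPath hc t hu
  obtain ⟨h1, -, h3⟩ := isPullbackAt_chart g (c (t, x)) hK (by rw [hKx]; exact hy)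
  have hCx : (extChartAt (𝓡 n) (c (t, x)) ∘ localPath c x₀) (t, extChartAt (𝓡 m) x₀ x) =
      extChartAt (𝓡 n) (c (t, x)) (c (t, x)) := congrArg _ hKx
  have hBt : (extChartAt (𝓡 n) (c (t, x)) ∘ localPath c x₀) (t, extChartAt (𝓡 m) x₀ x) ∈
      (extChartAt (𝓡 n) (c (t, x))).target := by rw [hCx]; exact mem_extChartAt_target _
  have hmain := hasDerivAt_sqrt_det (h1.of_le (by norm_cast))
    ((contDiffAt_chartForm g _ hBt).differentiableAt (by simp))
    ((contDiffAt_pathForm hc g t hu).of_le (by norm_cast)) (fun p v w => pullForm_symm g _ p v w)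
    (chartForm_isInnerForm g _ hBt) h3
    (by rw [spatialForm_pathForm hc g t hu]; exact (localForm_isInnerForm g ht x₀ hu).det_pos)
  refine hmain.congr_deriv ?_
  congr 2
  rw [inner_meanCurvature_normalPart g ht x, inner_meanCurvature_eq g ht hx hy, hCx]
  have hvel : fderiv ℝ (extChartAt (𝓡 n) (c (t, x)) ∘ localPath c x₀) (t, extChartAt (𝓡 m) x₀ x)
      ((1, 0) : ℝ × 𝓔 m) = chartDeriv (c (t, x)) (c (t, x)) (velocity n c t x) := by
    have hψ : MDifferentiableAt (𝓡 n) (𝓡 n) (extChartAt (𝓡 n) (c (t, x)))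
        (localPath c x₀ (t, extChartAt (𝓡 m) x₀ x)) := by
      rw [hKx]; exact (chart_contMDiffAt _ hy).mdifferentiableAt (by simp)
    have h4 := mfderiv_comp _ hψ (hK.mdifferentiableAt (by simp))
    rw [mfderiv_eq_fderiv] at h4
    rw [h4]
    refine (congrArg (fun z : 𝓔 n => (mfderiv (𝓡 n) (𝓡 n) (extChartAt (𝓡 n) (c (t, x)))
      (localPath c x₀ (t, extChartAt (𝓡 m) x₀ x)) : 𝓔 n →L[ℝ] 𝓔 n) z)
      (mfderiv_localPath_time hc t hu)).trans ?_
    exact congrArg (fun y => (mfderiv (𝓡 n) (𝓡 n) (extChartAt (𝓡 n) (c (t, x)))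
      (c (t, y)) : 𝓔 n →L[ℝ] 𝓔 n) (velocity n c t y)) ((extChartAt (𝓡 m) x₀).left_inv hx)
  have hH : formTrace (formMatrix (spatialForm (pullForm g (localPath c x₀)) t
      (extChartAt (𝓡 m) x₀ x)))
      (sff (pullForm g (extChartAt (𝓡 n) (c (t, x))).symm)
        (spatialForm (pullForm g (localPath c x₀)) t)
        (fun u' => (extChartAt (𝓡 n) (c (t, x)) ∘ localPath c x₀) (t, u')) (extChartAt (𝓡 m) x₀ x)) =
      localMeanCurvature g (fun x => c (t, x)) x₀ (c (t, x)) (extChartAt (𝓡 m) x₀ x) := by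
    rw [localMeanCurvature, spatialForm_pathForm hc g t hu]
    congr 1
    funext v w
    rw [localSff, sff, sff, christoffel_congr (γ := fun u' => formMatrix
      (spatialForm (pullForm g (localPath c x₀)) t u')) (γ' := fun u' => formMatrix
      (pullForm g ((fun x => c (t, x)) ∘ (extChartAt (𝓡 m) x₀).symm) u'))]
    · rfl
    · filter_upwards [(isOpen_extChartAt_target x₀).mem_nhds hu] with u' hu'
      rw [spatialForm_pathForm hc g t hu']
  rw [hvel, hH]

end FirstVariation

/-! ### The volume measure: integration through the partition of unity and change of variables. -/

section Measure

open MeasureTheory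

variable {m n : ℕ} {M : Type*} [TopologicalSpace M] [ChartedSpace (𝓔 m) M] [IsManifold (𝓡 m) ∞ M]
  [CompactSpace M] [T2Space M]
  {N : Type*} [TopologicalSpace N] [ChartedSpace (𝓔 n) N] [IsManifold (𝓡 n) ∞ N]

variable (m M) in
lemma finite_chartPartition : {c : M | (Function.support (chartPartition m M c)).Nonempty}.Finite :=
  (chartPartition m M).locallyFinite.finite_nonempty_of_compact

variable (m M) in
/-- The finitely many indices of the nonzero members of the chart partition of unity. -/
def chartIndices : Finset M := (finite_chartPartition m M).toFinset

lemma chartPartition_eq_zero_of_notMem {c : M} (hc : c ∉ chartIndices m M) (x : M) :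
    chartPartition m M c x = 0 := by
  by_contra h
  exact hc ((finite_chartPartition m M).mem_toFinset.2 ⟨x, h⟩)

lemma sum_chartPartition (x : M) : ∑ c ∈ chartIndices m M, chartPartition m M c x = 1 := by
  rw [← (chartPartition m M).sum_eq_one (Set.mem_univ x)]
  refine (finsum_eq_sum_of_support_subset _ fun c hc => ?_).symm
  by_contra h
  exact hc (chartPartition_eq_zero_of_notMem h x)

lemma tsupport_chartPartition_subset (c : M) :
    tsupport (chartPartition m M c) ⊆ (extChartAt (𝓡 m) c).source := by
  rw [extChartAt_source]
  exact Classical.choose_spec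
    (SmoothPartitionOfUnity.exists_isSubordinate_chartAt_source (I := 𝓡 m) (M := M)) c

lemma chartPartition_eq_zero_of_notMem_source {c x : M} (hx : x ∉ (extChartAt (𝓡 m) c).source) :
    chartPartition m M c x = 0 := by
  by_contra h
  exact hx (tsupport_chartPartition_subset c (subset_tsupport _ h))

lemma chartPartition_nonneg (c x : M) : 0 ≤ chartPartition m M c x :=
  (chartPartition m M).nonneg c x

variable (m) in
/-- The support of a member of the chart partition of unity, in its chart. -/
def chartCompact (c : M) : Set (𝓔 m) := extChartAt (𝓡 m) c '' tsupport (chartPartition m M c)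

lemma isCompact_chartCompact (c : M) : IsCompact (chartCompact m c) :=
  (isClosed_tsupport _).isCompact.image_of_continuousOn
    ((continuousOn_extChartAt c).mono (tsupport_chartPartition_subset c))

lemma chartCompact_subset (c : M) : chartCompact m c ⊆ (extChartAt (𝓡 m) c).target := by
  rintro _ ⟨x, hx, rfl⟩
  exact (extChartAt (𝓡 m) c).map_source (tsupport_chartPartition_subset c hx)

lemma notMem_tsupport_of_notMem_chartCompact {c : M} {u : 𝓔 m}
    (hu : u ∈ (extChartAt (𝓡 m) c).target) (hK : u ∉ chartCompact m c) :
    (extChartAt (𝓡 m) c).symm u ∉ tsupport (chartPartition m M c) := fun h =>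
  hK ⟨_, h, (extChartAt (𝓡 m) c).right_inv hu⟩

lemma chartPartition_eq_zero_of_notMem_chartCompact {c : M} {u : 𝓔 m}
    (hu : u ∈ (extChartAt (𝓡 m) c).target) (hK : u ∉ chartCompact m c) :
    chartPartition m M c ((extChartAt (𝓡 m) c).symm u) = 0 := by
  by_contra h
  exact notMem_tsupport_of_notMem_chartCompact hu hK (subset_tsupport _ h)

lemma contMDiff_chartPartition (c : M) :
    ContMDiff (𝓡 m) 𝓘(ℝ, ℝ) ∞ (chartPartition m M c) :=
  ContMDiffMap.contMDiff (chartPartition m M c)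

/-- A function continuous on the open chart image may blow up at its boundary; vanishing off a
compact subset rules this out. -/
lemma integrableOn_chart {c : M} {F : 𝓔 m → ℝ} (hF : ContinuousOn F (extChartAt (𝓡 m) c).target)
    (h0 : ∀ u ∈ (extChartAt (𝓡 m) c).target, u ∉ chartCompact m c → F u = 0) :
    IntegrableOn F (extChartAt (𝓡 m) c).target := by
  refine IntegrableOn.of_forall_sdiff_eq_zero
    ((hF.mono (chartCompact_subset c)).integrableOn_compact (isCompact_chartCompact c))
    (isOpen_extChartAt_target c).measurableSet fun u hu => h0 u hu.1 hu.2

lemma continuousOn_chart_symm (c : M) :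
    ContinuousOn (extChartAt (𝓡 m) c).symm (extChartAt (𝓡 m) c).target :=
  continuousOn_extChartAt_symm c

lemma continuousOn_sqrt_det_gram (g : RMetric n N) {K : 𝓔 m → N} {U : Set (𝓔 m)} (hU : IsOpen U)
    (hK : ContMDiffOn (𝓡 m) (𝓡 n) ∞ K U) :
    ContinuousOn (fun u => √(gram (k := m) g K u).det) U := by
  intro u hu
  have h := contDiffAt_det (contDiffAt_formMatrix (contDiffAt_pullForm g hU hK hu))
  exact (Real.continuous_sqrt.continuousAt.comp h.continuousAt).continuousWithinAt

lemma continuousOn_chart_density (g : RMetric n N) {f : M → N} (hf : ContMDiff (𝓡 m) (𝓡 n) ∞ f) (c : M) :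
    ContinuousOn (fun u => √(gram (k := m) g (f ∘ (extChartAt (𝓡 m) c).symm) u).det)
      (extChartAt (𝓡 m) c).target :=
  continuousOn_sqrt_det_gram g (isOpen_extChartAt_target c) (contMDiffOn_comp_chart_symm hf c)

variable [MeasurableSpace M] [BorelSpace M]

/-- The defining sum runs over all points of `M`, but compactness and local finiteness leave only
finitely many nonzero members of the partition. -/
lemma lintegral_volMeasure (g : RMetric n N) {f : M → N} (hf : ContMDiff (𝓡 m) (𝓡 n) ∞ f)
    {h : M → ℝ≥0∞} (hh : Measurable h) :
    ∫⁻ x, h x ∂(volMeasure (m := m) g f) = ∑ c ∈ chartIndices m M,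
      ∫⁻ u in (extChartAt (𝓡 m) c).target, ENNReal.ofReal
        (chartPartition m M c ((extChartAt (𝓡 m) c).symm u) *
          √(gram (k := m) g (f ∘ (extChartAt (𝓡 m) c).symm) u).det) *
        h ((extChartAt (𝓡 m) c).symm u) := by
  have hterm : ∀ c : M, ∫⁻ x, h x ∂(Measure.map (extChartAt (𝓡 m) c).symm
      ((volume.restrict (extChartAt (𝓡 m) c).target).withDensity fun u =>
        ENNReal.ofReal (chartPartition m M c ((extChartAt (𝓡 m) c).symm u) *
          √(gram (k := m) g (f ∘ (extChartAt (𝓡 m) c).symm) u).det))) =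
      ∫⁻ u in (extChartAt (𝓡 m) c).target, ENNReal.ofReal
        (chartPartition m M c ((extChartAt (𝓡 m) c).symm u) *
          √(gram (k := m) g (f ∘ (extChartAt (𝓡 m) c).symm) u).det) *
        h ((extChartAt (𝓡 m) c).symm u) := by
    intro c
    have hmt : MeasurableSet (extChartAt (𝓡 m) c).target := (isOpen_extChartAt_target c).measurableSet
    have hs : AEMeasurable (extChartAt (𝓡 m) c).symm
        (volume.restrict (extChartAt (𝓡 m) c).target) :=
      (continuousOn_chart_symm c).aemeasurable hmt
    have hd : AEMeasurable (fun u => ENNReal.ofReal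
        (chartPartition m M c ((extChartAt (𝓡 m) c).symm u) *
          √(gram (k := m) g (f ∘ (extChartAt (𝓡 m) c).symm) u).det))
        (volume.restrict (extChartAt (𝓡 m) c).target) :=
      ENNReal.measurable_ofReal.comp_aemeasurable (((
        (contMDiff_chartPartition c).continuous.comp_continuousOn (continuousOn_chart_symm c)).mul
          (continuousOn_chart_density g hf c)).aemeasurable hmt)
    rw [lintegral_map' hh.aemeasurable (hs.mono_ac (withDensity_absolutelyContinuous _ _))]
    exact lintegral_withDensity_eq_lintegral_mul₀ hd (hh.comp_aemeasurable hs)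
  rw [volMeasure, lintegral_sum_measure, tsum_eq_sum (s := chartIndices m M)]
  · exact Finset.sum_congr rfl fun c _ => hterm c
  · intro c hc
    rw [hterm]
    simp [chartPartition_eq_zero_of_notMem hc]

/-- The volume density is computed by any parametrization. -/
lemma setLIntegral_volMeasure (g : RMetric n N) {f : M → N} (hf : ContMDiff (𝓡 m) (𝓡 n) ∞ f)
    {Φ : 𝓔 m → M} {U : Set (𝓔 m)} (hU : IsOpen U) (hΦ : ContMDiffOn (𝓡 m) (𝓡 m) ∞ Φ U)
    (hinj : Set.InjOn Φ U) (himg : IsOpen (Φ '' U)) {h : M → ℝ≥0∞} (hh : Measurable h) :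
    ∫⁻ x in Φ '' U, h x ∂(volMeasure (m := m) g f) =
      ∫⁻ u in U, ENNReal.ofReal √(gram (k := m) g (f ∘ Φ) u).det * h (Φ u) := by
  rw [← lintegral_indicator himg.measurableSet,
    lintegral_volMeasure g hf (hh.indicator himg.measurableSet)]
  have hfΦ : ContMDiffOn (𝓡 m) (𝓡 n) ∞ (f ∘ Φ) U := hf.comp_contMDiffOn hΦ
  have hterm : ∀ c : M, ∫⁻ u in (extChartAt (𝓡 m) c).target, ENNReal.ofReal
        (chartPartition m M c ((extChartAt (𝓡 m) c).symm u) *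
          √(gram (k := m) g (f ∘ (extChartAt (𝓡 m) c).symm) u).det) *
        (Φ '' U).indicator h ((extChartAt (𝓡 m) c).symm u) =
      ∫⁻ u in U, ENNReal.ofReal (chartPartition m M c (Φ u) * √(gram (k := m) g (f ∘ Φ) u).det) *
        h (Φ u) := by
    intro c
    set φ := extChartAt (𝓡 m) c with hφ
    -- On `W` the map `φ ∘ Φ` is an injective smooth change of variables. The rest of `U`
    -- contributes nothing, because the partition member vanishes off the chart domain.
    set W := U ∩ Φ ⁻¹' φ.source with hW
    have hWo : IsOpen W :=
      hΦ.continuousOn.isOpen_inter_preimage hU (isOpen_extChartAt_source (I := 𝓡 m) c)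
    have hE : (φ ∘ Φ) '' W = φ.target ∩ φ.symm ⁻¹' (Φ '' U) := by
      ext v
      constructor
      · rintro ⟨u, hu, rfl⟩
        refine ⟨φ.map_source hu.2, ⟨u, hu.1, ?_⟩⟩
        exact (φ.left_inv hu.2).symm
      · rintro ⟨hv, u, hu, huv⟩
        refine ⟨u, ⟨hu, ?_⟩, ?_⟩
        · rw [Set.mem_preimage, huv]; exact φ.map_target hv
        · rw [Function.comp_apply, huv]; exact φ.right_inv hv
    have hEo : IsOpen ((φ ∘ Φ) '' W) := by
      rw [hE]
      exact (continuousOn_chart_symm c).isOpen_inter_preimage (isOpen_extChartAt_target c) himg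
    have hT : ∀ u ∈ W, ContDiffAt ℝ ∞ (φ ∘ Φ) u := fun u hu =>
      contMDiffAt_iff_contDiffAt.1 ((chart_contMDiffAt c hu.2).comp u
        (hΦ.contMDiffAt (hU.mem_nhds hu.1)))
    have hTinj : Set.InjOn (φ ∘ Φ) W := fun u hu v hv huv =>
      hinj hu.1 hv.1 (φ.injOn hu.2 hv.2 huv)
    have hdens : ∀ u ∈ W, √(gram (k := m) g (f ∘ Φ) u).det =
        |(fderiv ℝ (φ ∘ Φ) u).det| *
          √(gram (k := m) g (f ∘ φ.symm) ((φ ∘ Φ) u)).det := by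
      intro u hu
      have heq : f ∘ Φ =ᶠ[𝓝 u] (f ∘ φ.symm) ∘ (φ ∘ Φ) := by
        filter_upwards [hWo.mem_nhds hu] with q hq
        exact (congrArg f (φ.left_inv hq.2)).symm
      have hpb := pullForm_comp (V := 𝓔 m) (W := 𝓔 m) g heq
        (((contMDiffOn_comp_chart_symm hf c).contMDiffAt
          ((isOpen_extChartAt_target c).mem_nhds (φ.map_source hu.2))).mdifferentiableAt (by simp))
        ((hT u hu).differentiableAt (by simp)).mdifferentiableAt
      rw [mfderiv_eq_fderiv] at hpb
      rw [gram_eq, gram_eq, formMatrix_det_comp _ _ (fderiv ℝ (φ ∘ Φ) u) hpb,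
        Real.sqrt_mul (sq_nonneg _), Real.sqrt_sq_eq_abs]
    calc _ = ∫⁻ v in (φ ∘ Φ) '' W, ENNReal.ofReal (chartPartition m M c (φ.symm v) *
          √(gram (k := m) g (f ∘ φ.symm) v).det) * h (φ.symm v) := by
          have h1 : ∀ v, ENNReal.ofReal (chartPartition m M c (φ.symm v) *
              √(gram (k := m) g (f ∘ φ.symm) v).det) * (Φ '' U).indicator h (φ.symm v) =
              (φ.symm ⁻¹' (Φ '' U)).indicator (fun v => ENNReal.ofReal
                (chartPartition m M c (φ.symm v) * √(gram (k := m) g (f ∘ φ.symm) v).det) *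
                  h (φ.symm v)) v := by
            intro v
            by_cases hv : φ.symm v ∈ Φ '' U
            · rw [Set.indicator_of_mem hv, Set.indicator_of_mem (by exact hv)]
            · rw [Set.indicator_of_notMem hv, Set.indicator_of_notMem (by exact hv), mul_zero]
          rw [← lintegral_indicator (isOpen_extChartAt_target c).measurableSet,
            ← lintegral_indicator hEo.measurableSet, hE]
          refine lintegral_congr fun v => ?_
          simp only [h1]
          rw [Set.indicator_indicator]
      _ = ∫⁻ u in W, ENNReal.ofReal |(fderiv ℝ (φ ∘ Φ) u).det| *
          (ENNReal.ofReal (chartPartition m M c (φ.symm ((φ ∘ Φ) u)) *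
          √(gram (k := m) g (f ∘ φ.symm) ((φ ∘ Φ) u)).det) * h (φ.symm ((φ ∘ Φ) u))) :=
        lintegral_image_eq_lintegral_abs_det_fderiv_mul volume hWo.measurableSet
          (fun u hu => ((hT u hu).differentiableAt (by simp)).hasFDerivAt.hasFDerivWithinAt)
          hTinj _
      _ = ∫⁻ u in W, ENNReal.ofReal (chartPartition m M c (Φ u) *
          √(gram (k := m) g (f ∘ Φ) u).det) * h (Φ u) := by
        refine setLIntegral_congr_fun hWo.measurableSet fun u hu => ?_
        have h2 : φ.symm ((φ ∘ Φ) u) = Φ u := φ.left_inv hu.2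
        simp only [h2]
        rw [hdens u hu, ← mul_assoc, ← ENNReal.ofReal_mul (abs_nonneg _)]
        congr 2
        ring
      _ = _ := by
        rw [← lintegral_indicator hWo.measurableSet, ← lintegral_indicator hU.measurableSet]
        refine lintegral_congr fun u => ?_
        by_cases hu : u ∈ W
        · rw [Set.indicator_of_mem hu, Set.indicator_of_mem hu.1]
        · rw [Set.indicator_of_notMem hu]
          by_cases hu' : u ∈ U
          · have : Φ u ∉ φ.source := fun h => hu ⟨hu', h⟩
            rw [Set.indicator_of_mem hu', chartPartition_eq_zero_of_notMem_source this]
            simp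
          · rw [Set.indicator_of_notMem hu']
  simp only [hterm]
  have hΦm : AEMeasurable Φ (volume.restrict U) :=
    hΦ.continuousOn.aemeasurable hU.measurableSet
  -- All terms are now integrals over the same set `U`, so the partition of unity can be summed to
  -- `1`.
  rw [← lintegral_finsetSum']
  · refine lintegral_congr fun u => ?_
    rw [← Finset.sum_mul, ← ENNReal.ofReal_sum_of_nonneg fun c _ =>
      mul_nonneg (chartPartition_nonneg _ _) (Real.sqrt_nonneg _), ← Finset.sum_mul,
      sum_chartPartition, one_mul]
  · intro c _
    exact (ENNReal.measurable_ofReal.comp_aemeasurable ((((contMDiff_chartPartition c).continuous.comp_continuousOn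
      hΦ.continuousOn).mul (continuousOn_sqrt_det_gram g hU hfΦ)).aemeasurable
        hU.measurableSet)).mul (hh.comp_aemeasurable hΦm)

end Measure

/-! ### Finiteness and reparametrization invariance of the volume. -/

section Volume

open MeasureTheory

variable {m n : ℕ} {M : Type*} [TopologicalSpace M] [ChartedSpace (𝓔 m) M] [IsManifold (𝓡 m) ∞ M]
  [CompactSpace M] [T2Space M]
  {N : Type*} [TopologicalSpace N] [ChartedSpace (𝓔 n) N] [IsManifold (𝓡 n) ∞ N]
  [MeasurableSpace M] [BorelSpace M]

lemma volMeasure_univ (g : RMetric n N) {f : M → N} (hf : ContMDiff (𝓡 m) (𝓡 n) ∞ f) :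
    volMeasure (m := m) g f Set.univ = ENNReal.ofReal (∑ c ∈ chartIndices m M,
      ∫ u in (extChartAt (𝓡 m) c).target, chartPartition m M c ((extChartAt (𝓡 m) c).symm u) *
        √(gram (k := m) g (f ∘ (extChartAt (𝓡 m) c).symm) u).det) := by
  have h := lintegral_volMeasure g hf (measurable_const (a := (1 : ℝ≥0∞)))
  rw [lintegral_one] at h
  have hn : ∀ c : M, ∀ u, 0 ≤ chartPartition m M c ((extChartAt (𝓡 m) c).symm u) *
        √(gram (k := m) g (f ∘ (extChartAt (𝓡 m) c).symm) u).det := fun c u =>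
    mul_nonneg (chartPartition_nonneg _ _) (Real.sqrt_nonneg _)
  rw [h, ENNReal.ofReal_sum_of_nonneg fun c _ => integral_nonneg (hn c)]
  refine Finset.sum_congr rfl fun c _ => ?_
  rw [ofReal_integral_eq_lintegral_ofReal]
  · simp only [mul_one]
  · refine integrableOn_chart (((contMDiff_chartPartition c).continuous.comp_continuousOn
      (continuousOn_chart_symm c)).mul (continuousOn_chart_density g hf c)) fun u hu hK => ?_
    simp only [chartPartition_eq_zero_of_notMem_chartCompact hu hK, zero_mul]
  · exact Filter.Eventually.of_forall (hn c)

lemma isFiniteMeasure_volMeasure (g : RMetric n N) {f : M → N}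
    (hf : ContMDiff (𝓡 m) (𝓡 n) ∞ f) : IsFiniteMeasure (volMeasure (m := m) g f) :=
  ⟨by rw [volMeasure_univ g hf]; exact ENNReal.ofReal_lt_top⟩

lemma Vol_eq_sum (g : RMetric n N) {f : M → N} (hf : ContMDiff (𝓡 m) (𝓡 n) ∞ f) :
    Vol (m := m) g f = ∑ c ∈ chartIndices m M,
      ∫ u in (extChartAt (𝓡 m) c).target, chartPartition m M c ((extChartAt (𝓡 m) c).symm u) *
        √(gram (k := m) g (f ∘ (extChartAt (𝓡 m) c).symm) u).det := by
  rw [Vol, Measure.real, volMeasure_univ g hf, ENNReal.toReal_ofReal]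
  exact Finset.sum_nonneg fun c _ => integral_nonneg fun u =>
    mul_nonneg (chartPartition_nonneg _ _) (Real.sqrt_nonneg _)

/-- The term of `f ∘ χ` in the chart `φ` at `c` is the integral of `ρ_c ∘ χ⁻¹` against the measure
of `f`, computed in the parametrization `χ ∘ φ⁻¹`. These functions again sum to `1`. -/
lemma volMeasure_comp_univ (g : RMetric n N) {f : M → N} (hf : ContMDiff (𝓡 m) (𝓡 n) ∞ f)
    (χ : Diffeomorph (𝓡 m) (𝓡 m) M M ∞) :
    volMeasure (m := m) g (f ∘ χ) Set.univ = volMeasure (m := m) g f Set.univ := by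
  have hρ : ∀ c : M, Measurable fun x => ENNReal.ofReal (chartPartition m M c (χ.symm x)) :=
    fun c => ENNReal.measurable_ofReal.comp
      ((contMDiff_chartPartition c).continuous.comp χ.symm.continuous).measurable
  have h := lintegral_volMeasure g (hf.comp χ.contMDiff) (measurable_const (a := (1 : ℝ≥0∞)))
  rw [lintegral_one] at h
  have hterm : ∀ c : M, ∫⁻ u in (extChartAt (𝓡 m) c).target, ENNReal.ofReal
        (chartPartition m M c ((extChartAt (𝓡 m) c).symm u) *
          √(gram (k := m) g ((f ∘ χ) ∘ (extChartAt (𝓡 m) c).symm) u).det) * 1 =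
      ∫⁻ x, ENNReal.ofReal (chartPartition m M c (χ.symm x)) ∂(volMeasure (m := m) g f) := by
    intro c
    set φ := extChartAt (𝓡 m) c with hφ
    have himg : (χ ∘ φ.symm) '' φ.target = χ.symm ⁻¹' φ.source := by
      rw [Set.image_comp, φ.symm_image_target_eq_source]
      ext x
      constructor
      · rintro ⟨y, hy, rfl⟩
        rwa [Set.mem_preimage, χ.symm_apply_apply]
      · intro hx
        exact ⟨_, hx, χ.apply_symm_apply x⟩
    have himgo : IsOpen ((χ ∘ φ.symm) '' φ.target) := by
      rw [himg]
      exact (isOpen_extChartAt_source (I := 𝓡 m) c).preimage χ.symm.continuous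
    have h1 := setLIntegral_volMeasure g hf (isOpen_extChartAt_target (I := 𝓡 m) c)
      (Φ := χ ∘ φ.symm) (χ.contMDiff.comp_contMDiffOn (contMDiffOn_extChartAt_symm c))
      (χ.injective.comp_injOn φ.symm.injOn) himgo (hρ c)
    rw [← lintegral_indicator himgo.measurableSet] at h1
    have h2 : ((χ ∘ φ.symm) '' φ.target).indicator
        (fun x => ENNReal.ofReal (chartPartition m M c (χ.symm x))) =
        fun x => ENNReal.ofReal (chartPartition m M c (χ.symm x)) := by
      rw [Set.indicator_eq_self, himg]
      intro x hx
      by_contra h'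
      exact hx (by
        change ENNReal.ofReal _ = 0
        rw [chartPartition_eq_zero_of_notMem_source h', ENNReal.ofReal_zero])
    rw [h2] at h1
    rw [h1]
    refine lintegral_congr fun u => ?_
    rw [mul_one, ENNReal.ofReal_mul (chartPartition_nonneg _ _), mul_comm]
    congr 3
    simp
  rw [h, Finset.sum_congr rfl fun c _ => hterm c, ← lintegral_finsetSum _ fun c _ => hρ c,
    ← lintegral_one]
  refine lintegral_congr fun x => ?_
  rw [← ENNReal.ofReal_sum_of_nonneg fun c _ => chartPartition_nonneg _ _, sum_chartPartition,
    ENNReal.ofReal_one]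

lemma Vol_comp (g : RMetric n N) {f : M → N} (hf : ContMDiff (𝓡 m) (𝓡 n) ∞ f)
    (χ : Diffeomorph (𝓡 m) (𝓡 m) M M ∞) : Vol (m := m) g (f ∘ χ) = Vol (m := m) g f := by
  rw [Vol, Vol, Measure.real, Measure.real, volMeasure_comp_univ g hf]

/-- The representative picked by `Quotient.out` differs from `f` by a diffeomorphism, which leaves
the volume unchanged. -/
lemma volBi_proj (g : RMetric n N) (f : Imm m n M N) :
    volBi (m := m) g (proj f) = Vol (m := m) g f.1 := by
  obtain ⟨χ, hχ⟩ : (immSetoid m n M N).r f (Quotient.out (proj f)) :=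
    (immSetoid m n M N).symm (Quotient.mk_out (s := immSetoid m n M N) f)
  rw [volBi, hχ, Vol_comp g f.2.1]

lemma restrict_volMeasure (g : RMetric n N) {f : M → N} (hf : ContMDiff (𝓡 m) (𝓡 n) ∞ f) (c : M) :
    (volMeasure (m := m) g f).restrict (extChartAt (𝓡 m) c).source =
      Measure.map (extChartAt (𝓡 m) c).symm
        ((volume.restrict (extChartAt (𝓡 m) c).target).withDensity fun u =>
          ENNReal.ofReal √(gram (k := m) g (f ∘ (extChartAt (𝓡 m) c).symm) u).det) := by
  have hmt : MeasurableSet (extChartAt (𝓡 m) c).target := (isOpen_extChartAt_target c).measurableSet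
  have hs : AEMeasurable (extChartAt (𝓡 m) c).symm (volume.restrict (extChartAt (𝓡 m) c).target) :=
    (continuousOn_chart_symm c).aemeasurable hmt
  have hd : AEMeasurable (fun u => ENNReal.ofReal
      √(gram (k := m) g (f ∘ (extChartAt (𝓡 m) c).symm) u).det)
      (volume.restrict (extChartAt (𝓡 m) c).target) :=
    ENNReal.measurable_ofReal.comp_aemeasurable ((continuousOn_chart_density g hf c).aemeasurable hmt)
  have himg := (extChartAt (𝓡 m) c).symm_image_target_eq_source
  refine Measure.ext_of_lintegral _ fun h hh => ?_
  rw [lintegral_map' hh.aemeasurable (hs.mono_ac (withDensity_absolutelyContinuous _ _)), ← himg]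
  refine Eq.trans ?_ (lintegral_withDensity_eq_lintegral_mul₀ hd (hh.comp_aemeasurable hs)).symm
  exact setLIntegral_volMeasure g hf (isOpen_extChartAt_target (I := 𝓡 m) c)
    (contMDiffOn_extChartAt_symm c) (extChartAt (𝓡 m) c).symm.injOn
    (by rw [himg]; exact isOpen_extChartAt_source c) hh

/-- Integration of a function supported in a chart. -/
lemma integral_volMeasure_chart (g : RMetric n N) {f : M → N} (hf : ContMDiff (𝓡 m) (𝓡 n) ∞ f)
    (c : M) {h : M → ℝ} (hh : Continuous h) (h0 : ∀ x ∉ (extChartAt (𝓡 m) c).source, h x = 0) :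
    ∫ x, h x ∂(volMeasure (m := m) g f) = ∫ u in (extChartAt (𝓡 m) c).target,
      √(gram (k := m) g (f ∘ (extChartAt (𝓡 m) c).symm) u).det *
        h ((extChartAt (𝓡 m) c).symm u) := by
  have hmt : MeasurableSet (extChartAt (𝓡 m) c).target := (isOpen_extChartAt_target c).measurableSet
  have hs : AEMeasurable (extChartAt (𝓡 m) c).symm (volume.restrict (extChartAt (𝓡 m) c).target) :=
    (continuousOn_chart_symm c).aemeasurable hmt
  have hd : AEMeasurable (fun u => ENNReal.ofReal
      √(gram (k := m) g (f ∘ (extChartAt (𝓡 m) c).symm) u).det)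
      (volume.restrict (extChartAt (𝓡 m) c).target) :=
    ENNReal.measurable_ofReal.comp_aemeasurable ((continuousOn_chart_density g hf c).aemeasurable hmt)
  rw [← setIntegral_eq_integral_of_forall_compl_eq_zero h0, restrict_volMeasure g hf c,
    integral_map (hs.mono_ac (withDensity_absolutelyContinuous _ _)) hh.stronglyMeasurable.aestronglyMeasurable,
    integral_withDensity_eq_integral_toReal_smul₀ hd (by simp)]
  simp only [ENNReal.toReal_ofReal (Real.sqrt_nonneg _), smul_eq_mul]

lemma integrable_volMeasure (g : RMetric n N) {f : M → N} (hf : ContMDiff (𝓡 m) (𝓡 n) ∞ f)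
    {h : M → ℝ} (hh : Continuous h) : Integrable h (volMeasure (m := m) g f) := by
  have := isFiniteMeasure_volMeasure (m := m) g hf
  exact hh.integrable_of_hasCompactSupport (HasCompactSupport.of_compactSpace h)

lemma integral_volMeasure (g : RMetric n N) {f : M → N} (hf : ContMDiff (𝓡 m) (𝓡 n) ∞ f)
    {h : M → ℝ} (hh : Continuous h) :
    ∫ x, h x ∂(volMeasure (m := m) g f) = ∑ c ∈ chartIndices m M,
      ∫ u in (extChartAt (𝓡 m) c).target,
        √(gram (k := m) g (f ∘ (extChartAt (𝓡 m) c).symm) u).det *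
          (chartPartition m M c ((extChartAt (𝓡 m) c).symm u) *
            h ((extChartAt (𝓡 m) c).symm u)) := by
  have hc : ∀ c : M, Continuous fun x => chartPartition m M c x * h x := fun c =>
    (contMDiff_chartPartition c).continuous.mul hh
  rw [← Finset.sum_congr rfl fun c _ => integral_volMeasure_chart g hf c (hc c) fun x hx => by
    rw [chartPartition_eq_zero_of_notMem_source hx, zero_mul],
    ← integral_finsetSum _ fun c _ => integrable_volMeasure g hf (hc c)]
  simp only [← Finset.sum_mul, sum_chartPartition, one_mul]

end Volume

/-! ### Integration by parts on an open subset of Euclidean space. -/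

section Euclidean

open MeasureTheory

variable {m : ℕ} {U K : Set (𝓔 m)}

lemma fderiv_eq_zero_of_notMem (hU : IsOpen U) (hK : IsCompact K) {F : 𝓔 m → ℝ}
    (h0 : ∀ u ∈ U, u ∉ K → F u = 0) {u : 𝓔 m} (hu : u ∈ U) (huK : u ∉ K) : fderiv ℝ F u = 0 := by
  have h : F =ᶠ[𝓝 u] fun _ => 0 := by
    filter_upwards [hU.mem_nhds hu, hK.isClosed.isOpen_compl.mem_nhds huK] with v hv hvK
    exact h0 v hv hvK
  rw [h.fderiv_eq]
  simp

lemma integrableOn_of_compact (hU : IsOpen U) (hK : IsCompact K) (hKU : K ⊆ U) {F : 𝓔 m → ℝ}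
    (hF : ContinuousOn F U) (h0 : ∀ u ∈ U, u ∉ K → F u = 0) : IntegrableOn F U :=
  IntegrableOn.of_forall_sdiff_eq_zero ((hF.mono hKU).integrableOn_compact hK)
    hU.measurableSet fun u hu => h0 u hu.1 hu.2

lemma integral_fderiv_eq_zero (hU : IsOpen U) (hK : IsCompact K) (hKU : K ⊆ U) {F : 𝓔 m → ℝ}
    (hF : ∀ u ∈ U, ContDiffAt ℝ 1 F u) (h0 : ∀ u ∈ U, u ∉ K → F u = 0) (v : 𝓔 m) :
    ∫ u in U, fderiv ℝ F u v = 0 := by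
  -- Extension by zero is `C¹` on the whole space, because `F` vanishes off a compact subset of `U`.
  set G : 𝓔 m → ℝ := U.indicator F with hG
  have hGU : ∀ u ∈ U, G =ᶠ[𝓝 u] F := fun u hu => by
    filter_upwards [hU.mem_nhds hu] with w hw using Set.indicator_of_mem hw F
  have hGK : ∀ u ∉ K, G u = 0 := fun u hu => by
    by_cases h : u ∈ U
    · rw [hG, Set.indicator_of_mem h, h0 u h hu]
    · exact Set.indicator_of_notMem h F
  have hGC : ContDiff ℝ 1 G := contDiff_iff_contDiffAt.2 fun u => by
    by_cases h : u ∈ U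
    · exact (hF u h).congr_of_eventuallyEq (hGU u h)
    · refine (contDiffAt_const (c := (0 : ℝ))).congr_of_eventuallyEq ?_
      filter_upwards [hK.isClosed.isOpen_compl.mem_nhds fun h' => h (hKU h')] with w hw
      exact hGK w hw
  have hGs : HasCompactSupport G := HasCompactSupport.intro hK hGK
  have hG' : Continuous fun u => fderiv ℝ G u v :=
    (hGC.continuous_fderiv (by norm_num)).clm_apply continuous_const
  have hGs' : HasCompactSupport fun u => fderiv ℝ G u v := hGs.fderiv_apply ℝ v
  have h1 : ∫ u, fderiv ℝ G u v = 0 := by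
    -- Integration by parts against the constant `1`.
    have h := integral_mul_fderiv_eq_neg_fderiv_mul_of_integrable (μ := volume)
      (f := fun _ : 𝓔 m => (1 : ℝ)) (g := G) (v := v) (by simp)
      (by simpa using hG'.integrable_of_hasCompactSupport hGs')
      (by simpa using hGC.continuous.integrable_of_hasCompactSupport hGs)
      (fun _ _ => differentiableAt_const _)
      (fun u _ => hGC.differentiable (by norm_num) u)
    simpa using h
  have h2 : ∫ u in U, fderiv ℝ G u v = ∫ u, fderiv ℝ G u v := by
    refine setIntegral_eq_integral_of_forall_compl_eq_zero fun u hu => ?_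
    rw [fderiv_eq_zero_of_notMem isOpen_univ hK (fun u _ => hGK u) trivial fun h => hu (hKU h)]
    rfl
  rw [← h1, ← h2]
  exact setIntegral_congr_fun hU.measurableSet fun u hu =>
    congrArg (fun L : 𝓔 m →L[ℝ] ℝ => L v) (hGU u hu).fderiv_eq.symm

/-- Only `ρ` has compact support, and that is enough: each `ρ Y_i` vanishes off `K`, so its
derivative integrates to zero. -/
lemma integral_mul_divergence (hU : IsOpen U) (hK : IsCompact K) (hKU : K ⊆ U) {ρ : 𝓔 m → ℝ}
    {Y : Fin m → 𝓔 m → ℝ} (hρ : ∀ u ∈ U, ContDiffAt ℝ 1 ρ u)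
    (hY : ∀ i, ∀ u ∈ U, ContDiffAt ℝ 1 (Y i) u) (h0 : ∀ u ∈ U, u ∉ K → ρ u = 0) :
    ∫ u in U, ρ u * ∑ i, fderiv ℝ (Y i) u (e i) =
      -∫ u in U, ∑ i, Y i u * fderiv ℝ ρ u (e i) := by
  have hd : ∀ {F : 𝓔 m → ℝ}, (∀ u ∈ U, ContDiffAt ℝ 1 F u) → ∀ v,
      ContinuousOn (fun u => fderiv ℝ F u v) U := fun hF v u hu =>
    (((hF u hu).fderiv_right (m := 0) (by norm_num)).continuousAt.clm_apply
      continuousAt_const).continuousWithinAt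
  have hc : ∀ {F : 𝓔 m → ℝ}, (∀ u ∈ U, ContDiffAt ℝ 1 F u) → ContinuousOn F U := fun hF u hu =>
    (hF u hu).continuousAt.continuousWithinAt
  have h1 : ∀ i, IntegrableOn (fun u => ρ u * fderiv ℝ (Y i) u (e i)) U := fun i =>
    integrableOn_of_compact hU hK hKU ((hc hρ).mul (hd (hY i) _)) fun u hu huK => by
      simp only [h0 u hu huK, zero_mul]
  have h2 : ∀ i, IntegrableOn (fun u => Y i u * fderiv ℝ ρ u (e i)) U := fun i =>
    integrableOn_of_compact hU hK hKU ((hc (hY i)).mul (hd hρ _)) fun u hu huK => by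
      simp [fderiv_eq_zero_of_notMem hU hK h0 hu huK]
  simp only [Finset.mul_sum]
  rw [integral_finsetSum _ fun i _ => h1 i, integral_finsetSum _ fun i _ => h2 i,
    ← Finset.sum_neg_distrib]
  refine Finset.sum_congr rfl fun i _ => ?_
  rw [eq_neg_iff_add_eq_zero, ← integral_add (h1 i) (h2 i),
    ← integral_fderiv_eq_zero hU hK hKU (fun u hu => (hρ u hu).mul (hY i u hu))
      (fun u hu huK => by simp only [h0 u hu huK, zero_mul]) (e i)]
  refine setIntegral_congr_fun hU.measurableSet fun u hu => ?_
  have := fderiv_mul ((hρ u hu).differentiableAt (by norm_num))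
    ((hY i u hu).differentiableAt (by norm_num))
  refine Eq.trans ?_ (congrArg (fun L => L (e i)) this).symm
  simp

end Euclidean

/-! ### Joint smoothness in time and space of the density along a path. -/

section PathDensity

variable {m n : ℕ} {M : Type*} [TopologicalSpace M] [ChartedSpace (𝓔 m) M] [IsManifold (𝓡 m) ∞ M]
  {N : Type*} [TopologicalSpace N] [ChartedSpace (𝓔 n) N] [IsManifold (𝓡 n) ∞ N]

/-- The volume density of the immersions of a path in the chart at `x₀`. -/
def pathDensity (g : RMetric n N) (c : ℝ × M → N) (x₀ : M) (p : ℝ × 𝓔 m) : ℝ :=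
  √(formMatrix (spatialForm (pullForm g (localPath c x₀)) p.1 p.2)).det

variable {c : ℝ × M → N} (hc : ContMDiff (𝓘(ℝ, ℝ).prod (𝓡 m)) (𝓡 n) ∞ c)
include hc

lemma pathDensity_eq (g : RMetric n N) (t : ℝ) {x₀ : M} {u : 𝓔 m}
    (hu : u ∈ (extChartAt (𝓡 m) x₀).target) : pathDensity g c x₀ (t, u) =
      √(gram (k := m) g ((fun x => c (t, x)) ∘ (extChartAt (𝓡 m) x₀).symm) u).det := by
  rw [pathDensity, spatialForm_pathForm hc g t hu, gram_eq]

lemma spatialForm_det_pos (g : RMetric n N) {t : ℝ} (ht : IsSmoothImmersion m n fun x => c (t, x))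
    {x₀ : M} {u : 𝓔 m} (hu : u ∈ (extChartAt (𝓡 m) x₀).target) :
    0 < (formMatrix (spatialForm (pullForm g (localPath c x₀)) t u)).det := by
  rw [spatialForm_pathForm hc g t hu]
  exact (localForm_isInnerForm g ht x₀ hu).det_pos

lemma contDiffAt_pathForm_apply (g : RMetric n N) (t : ℝ) {x₀ : M} {u : 𝓔 m}
    (hu : u ∈ (extChartAt (𝓡 m) x₀).target) (v w : ℝ × 𝓔 m) :
    ContDiffAt ℝ ∞ (fun p => pullForm (V := ℝ × 𝓔 m) g (localPath c x₀) p v w) (t, u) :=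
  ((contDiffAt_pathForm hc g t hu).clm_apply contDiffAt_const).clm_apply contDiffAt_const

lemma contDiffAt_spatialForm (g : RMetric n N) (t : ℝ) {x₀ : M} {u : 𝓔 m}
    (hu : u ∈ (extChartAt (𝓡 m) x₀).target) (i j : Fin m) : ContDiffAt ℝ ∞ (fun p : ℝ × 𝓔 m =>
      formMatrix (spatialForm (pullForm g (localPath c x₀)) p.1 p.2) i j) (t, u) := by
  simpa [formMatrix] using contDiffAt_pathForm_apply hc g t hu (0, e i) (0, e j)

lemma contDiffAt_pathDensity (g : RMetric n N) {t : ℝ}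
    (ht : IsSmoothImmersion m n fun x => c (t, x)) {x₀ : M} {u : 𝓔 m}
    (hu : u ∈ (extChartAt (𝓡 m) x₀).target) : ContDiffAt ℝ ∞ (pathDensity g c x₀) (t, u) :=
  (contDiffAt_det (contDiffAt_spatialForm hc g t hu)).sqrt (spatialForm_det_pos hc g ht hu).ne'

lemma contDiffAt_spatialForm_inv (g : RMetric n N) {t : ℝ}
    (ht : IsSmoothImmersion m n fun x => c (t, x)) {x₀ : M} {u : 𝓔 m}
    (hu : u ∈ (extChartAt (𝓡 m) x₀).target) (i j : Fin m) : ContDiffAt ℝ ∞ (fun p : ℝ × 𝓔 m =>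
      (formMatrix (spatialForm (pullForm g (localPath c x₀)) p.1 p.2))⁻¹ i j) (t, u) :=
  contDiffAt_inv (γ := fun p : ℝ × 𝓔 m =>
    formMatrix (spatialForm (pullForm g (localPath c x₀)) p.1 p.2))
    (contDiffAt_spatialForm hc g t hu) (spatialForm_det_pos hc g ht hu).ne' i j

lemma contDiffAt_tangentialFlux (g : RMetric n N) {t : ℝ}
    (ht : IsSmoothImmersion m n fun x => c (t, x)) {x₀ : M} {u : 𝓔 m}
    (hu : u ∈ (extChartAt (𝓡 m) x₀).target) (i : Fin m) :
    ContDiffAt ℝ ∞ (tangentialFlux g c x₀ t i) u := by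
  have h : ContDiffAt ℝ ∞ (fun p : ℝ × 𝓔 m => pathDensity g c x₀ p *
      ∑ j, (formMatrix (spatialForm (pullForm g (localPath c x₀)) p.1 p.2))⁻¹ i j *
        pullForm (V := ℝ × 𝓔 m) g (localPath c x₀) p (0, e j) (1, 0)) (t, u) :=
    (contDiffAt_pathDensity hc g ht hu).mul (ContDiffAt.sum fun j _ =>
      (contDiffAt_spatialForm_inv hc g ht hu i j).mul (contDiffAt_pathForm_apply hc g t hu _ _))
  exact ContDiffAt.comp (f := fun u' : 𝓔 m => ((t, u') : ℝ × 𝓔 m)) u h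
    (contDiffAt_const.prodMk contDiffAt_id)

end PathDensity

/-! ### The divergence of the tangential velocity integrates to zero. -/

section Divergence

open MeasureTheory

variable {m n : ℕ} {M : Type*} [TopologicalSpace M] [ChartedSpace (𝓔 m) M] [IsManifold (𝓡 m) ∞ M]
  [CompactSpace M] [T2Space M]
  {N : Type*} [TopologicalSpace N] [ChartedSpace (𝓔 n) N] [IsManifold (𝓡 n) ∞ N]

lemma contDiffAt_chartPartition_chart (c : M) {x₀ : M} {u : 𝓔 m}
    (hu : u ∈ (extChartAt (𝓡 m) x₀).target) :
    ContDiffAt ℝ ∞ (chartPartition m M c ∘ (extChartAt (𝓡 m) x₀).symm) u :=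
  contMDiffAt_iff_contDiffAt.1
    ((contMDiff_chartPartition c).contMDiffAt.comp u (chart_symm_contMDiffAt x₀ hu))

/-- The differential of a member of the chart partition of unity. -/
def chartPartitionDeriv (c x : M) : 𝓔 m →L[ℝ] ℝ :=
  mfderiv (𝓡 m) 𝓘(ℝ, ℝ) (chartPartition m M c) x

lemma chartPartitionDeriv_eq (c : M) {x₀ x : M} (hx : x ∈ (extChartAt (𝓡 m) x₀).source) (v : 𝓔 m) :
    chartPartitionDeriv c x v =
      fderiv ℝ (chartPartition m M c ∘ (extChartAt (𝓡 m) x₀).symm) (extChartAt (𝓡 m) x₀ x)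
        (chartDeriv x₀ x v) := by
  have heq : chartPartition m M c =ᶠ[𝓝 x]
      (chartPartition m M c ∘ (extChartAt (𝓡 m) x₀).symm) ∘ extChartAt (𝓡 m) x₀ := by
    filter_upwards [(isOpen_extChartAt_source (I := 𝓡 m) x₀).mem_nhds hx] with y hy
    exact (congrArg _ ((extChartAt (𝓡 m) x₀).left_inv hy)).symm
  rw [chartPartitionDeriv, heq.mfderiv_eq, mfderiv_comp (I' := 𝓡 m) x
    (((contDiffAt_chartPartition_chart c
      ((extChartAt (𝓡 m) x₀).map_source hx)).differentiableAt (by simp)).mdifferentiableAt)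
    ((chart_contMDiffAt x₀ hx).mdifferentiableAt (by simp)), mfderiv_eq_fderiv]
  rfl

/-- The derivative of the `a`-th member of the chart partition of unity in the direction of the
tangential part of the velocity. -/
def partitionFlux (g : RMetric n N) (c : ℝ × M → N) (t : ℝ) (a x : M) : ℝ :=
  formTrace (formMatrix (pullForm (V := 𝓔 m) g (fun x => c (t, x)) x)) fun v w =>
    chartPartitionDeriv a x v *
      g.inner (c (t, x)) (velocity n c t x) (mfderiv (𝓡 m) (𝓡 n) (fun x => c (t, x)) x w)

lemma partitionFlux_eq_zero (g : RMetric n N) (c : ℝ × M → N) (t : ℝ) {a x : M}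
    (hx : x ∉ (extChartAt (𝓡 m) a).source) : partitionFlux (m := m) g c t a x = 0 := by
  have h : chartPartition m M a =ᶠ[𝓝 x] fun _ => 0 := by
    filter_upwards [(isClosed_tsupport (chartPartition m M a)).isOpen_compl.mem_nhds
      fun h => hx (tsupport_chartPartition_subset a h)] with y hy
    by_contra h'
    exact hy (subset_tsupport _ h')
  have h2 : chartPartitionDeriv (m := m) a x = 0 := by
    rw [chartPartitionDeriv, h.mfderiv_eq]; exact mfderiv_const
  simp only [partitionFlux, formTrace, h2]
  exact Finset.sum_eq_zero fun i _ => Finset.sum_eq_zero fun j _ => by simp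

/-- Since `∑ ρ_a = 1`, the differentials `dρ_a` add up to zero. -/
lemma sum_partitionFlux (g : RMetric n N) (c : ℝ × M → N) (t : ℝ) (x : M) :
    ∑ a ∈ chartIndices m M, partitionFlux (m := m) g c t a x = 0 := by
  have hx := mem_extChartAt_source (I := 𝓡 m) x
  have hu := (extChartAt (𝓡 m) x).map_source hx
  have h : ∀ v : 𝓔 m, ∑ a ∈ chartIndices m M,
      chartPartitionDeriv a x v = 0 := by
    intro v
    rw [Finset.sum_congr rfl fun a _ => chartPartitionDeriv_eq a hx v, ← sum_apply,
      ← fderiv_sum fun a _ => (contDiffAt_chartPartition_chart a hu).differentiableAt (by simp)]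
    have h1 : ∑ a ∈ chartIndices m M, (chartPartition m M a ∘ (extChartAt (𝓡 m) x).symm) =
        fun _ => 1 := by
      funext u
      simp only [Finset.sum_apply, Function.comp_apply, sum_chartPartition]
    rw [h1]
    simp
  simp only [partitionFlux, formTrace]
  rw [Finset.sum_comm]
  refine Finset.sum_eq_zero fun i _ => ?_
  rw [Finset.sum_comm]
  refine Finset.sum_eq_zero fun j _ => ?_
  rw [← Finset.smul_sum, ← Finset.sum_mul, h, zero_mul, smul_zero]

variable {c : ℝ × M → N} (hc : ContMDiff (𝓘(ℝ, ℝ).prod (𝓡 m)) (𝓡 n) ∞ c)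
include hc

/-- The trace is chart independent. This makes the boundary terms from different charts functions on
`M` that can be added pointwise. -/
lemma partitionFlux_eq_chart (g : RMetric n N) (t : ℝ) (a : M) {x₀ x : M}
    (hx : x ∈ (extChartAt (𝓡 m) x₀).source) : partitionFlux (m := m) g c t a x =
      formTrace (formMatrix (spatialForm (pullForm g (localPath c x₀)) t (extChartAt (𝓡 m) x₀ x)))
        fun v w => fderiv ℝ (chartPartition m M a ∘ (extChartAt (𝓡 m) x₀).symm)
          (extChartAt (𝓡 m) x₀ x) v *
          pullForm (V := ℝ × 𝓔 m) g (localPath c x₀) (t, extChartAt (𝓡 m) x₀ x) (1, 0) (0, w) := by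
  rw [partitionFlux]
  simp only [inner_velocity_mfderiv hc g t hx, chartPartitionDeriv_eq a hx]
  let L : 𝓔 m →ₗ[ℝ] ℝ :=
    (pullForm (V := ℝ × 𝓔 m) g (localPath c x₀) (t, extChartAt (𝓡 m) x₀ x) (1, 0)).toLinearMap ∘ₗ
      LinearMap.inr ℝ ℝ (𝓔 m)
  exact formTrace_comp _ _ _ (chartDeriv_det_ne_zero hx) (pullForm_slice hc g t hx)
    ((LinearMap.mul ℝ ℝ).compl₁₂ (fderiv ℝ (chartPartition m M a ∘ (extChartAt (𝓡 m) x₀).symm)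
          (extChartAt (𝓡 m) x₀ x)).toLinearMap L)

lemma continuous_partitionFlux (g : RMetric n N) {t : ℝ}
    (ht : IsSmoothImmersion m n fun x => c (t, x)) (a : M) :
    Continuous (partitionFlux (m := m) g c t a) := by
  refine continuous_iff_continuousAt.2 fun x₀ => ?_
  have hx := mem_extChartAt_source (I := 𝓡 m) x₀
  have hu := (extChartAt (𝓡 m) x₀).map_source hx
  have hι : ContinuousAt (fun u' : 𝓔 m => ((t, u') : ℝ × 𝓔 m)) (extChartAt (𝓡 m) x₀ x₀) :=
    continuousAt_const.prodMk continuousAt_id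
  have h : ContinuousAt (fun u => formTrace
      (formMatrix (spatialForm (pullForm g (localPath c x₀)) t u)) fun v w =>
        fderiv ℝ (chartPartition m M a ∘ (extChartAt (𝓡 m) x₀).symm) u v *
          pullForm (V := ℝ × 𝓔 m) g (localPath c x₀) (t, u) (1, 0) (0, w))
      (extChartAt (𝓡 m) x₀ x₀) := by
    unfold formTrace
    refine tendsto_finsetSum _ fun i _ => tendsto_finsetSum _ fun j _ => ?_
    refine ContinuousAt.mul ?_ (ContinuousAt.mul ?_ ?_)
    · exact ContinuousAt.comp (f := fun u' : 𝓔 m => ((t, u') : ℝ × 𝓔 m))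
        (contDiffAt_spatialForm_inv hc g ht hu i j).continuousAt hι
    · exact ((contDiffAt_chartPartition_chart a hu).fderiv_right (m := 0)
        (by norm_cast)).continuousAt.clm_apply continuousAt_const
    · exact ContinuousAt.comp (f := fun u' : 𝓔 m => ((t, u') : ℝ × 𝓔 m))
        (contDiffAt_pathForm_apply hc g t hu _ _).continuousAt hι
  refine (h.comp (continuousAt_extChartAt (I := 𝓡 m) x₀)).congr ?_
  filter_upwards [(isOpen_extChartAt_source (I := 𝓡 m) x₀).mem_nhds hx] with y hy
  exact (partitionFlux_eq_chart hc g t a hy).symm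

variable [MeasurableSpace M] [BorelSpace M]

/-- After integration by parts the derivative falls on `ρ_a`, and the remaining integrand is the
density times the trace of `dρ_a ⊗ g(f_t, Tf ·)`. -/
lemma integral_divergence_chart (g : RMetric n N) {t : ℝ}
    (ht : IsSmoothImmersion m n fun x => c (t, x)) (a : M) :
    ∫ u in (extChartAt (𝓡 m) a).target, chartPartition m M a ((extChartAt (𝓡 m) a).symm u) *
      ∑ i, fderiv ℝ (tangentialFlux g c a t i) u (e i) =
    -∫ x, partitionFlux (m := m) g c t a x ∂(volMeasure (m := m) g fun x => c (t, x)) := by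
  have h := integral_mul_divergence (isOpen_extChartAt_target (I := 𝓡 m) a)
    (isCompact_chartCompact a) (chartCompact_subset a)
    (ρ := chartPartition m M a ∘ (extChartAt (𝓡 m) a).symm) (Y := tangentialFlux g c a t)
    (fun u hu => (contDiffAt_chartPartition_chart a hu).of_le (by norm_cast))
    (fun i u hu => (contDiffAt_tangentialFlux hc g ht hu i).of_le (by norm_cast))
    (fun u hu huK => chartPartition_eq_zero_of_notMem_chartCompact hu huK)
  refine h.trans (congrArg _ ?_)
  rw [integral_volMeasure_chart g ht.1 a (continuous_partitionFlux hc g ht a)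
    fun x hx => partitionFlux_eq_zero g c t hx]
  refine setIntegral_congr_fun (isOpen_extChartAt_target (I := 𝓡 m) a).measurableSet
    fun u hu => ?_
  rw [partitionFlux_eq_chart hc g t a ((extChartAt (𝓡 m) a).map_target hu),
    (extChartAt (𝓡 m) a).right_inv hu, ← pathDensity_eq hc g t hu, formTrace, Finset.mul_sum]
  refine Finset.sum_congr rfl fun i _ => ?_
  rw [tangentialFlux, pathDensity, mul_assoc, Finset.sum_mul]
  congr 1
  refine Finset.sum_congr rfl fun j _ => ?_
  rw [pullForm_symm g _ _ (0, e j), smul_eq_mul]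
  ring

lemma sum_integral_divergence (g : RMetric n N) {t : ℝ}
    (ht : IsSmoothImmersion m n fun x => c (t, x)) :
    ∑ a ∈ chartIndices m M, ∫ u in (extChartAt (𝓡 m) a).target,
      chartPartition m M a ((extChartAt (𝓡 m) a).symm u) *
        ∑ i, fderiv ℝ (tangentialFlux g c a t i) u (e i) = 0 := by
  rw [Finset.sum_congr rfl fun a _ => integral_divergence_chart hc g ht a,
    Finset.sum_neg_distrib, ← integral_finsetSum _ fun a _ =>
      integrable_volMeasure g ht.1 (continuous_partitionFlux hc g ht a)]
  simp only [sum_partitionFlux, integral_zero, neg_zero]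

end Divergence

/-! ### Continuity of the normal quantities along a path. -/

section NormalVelocity

variable {m n : ℕ} {M : Type*} [TopologicalSpace M] [ChartedSpace (𝓔 m) M] [IsManifold (𝓡 m) ∞ M]
  {N : Type*} [TopologicalSpace N] [ChartedSpace (𝓔 n) N] [IsManifold (𝓡 n) ∞ N]

/-- The pairing of the mean curvature with the normal velocity of a path. -/
def meanNormal (g : RMetric n N) (c : ℝ × M → N) (t : ℝ) (x : M) : ℝ :=
  g.inner (c (t, x)) (meanCurvature (m := m) g (fun x => c (t, x)) x)
    (normalPart (m := m) g (fun x => c (t, x)) x (velocity n c t x))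

/-- The squared norm of the normal velocity of a path. -/
def normalSq (g : RMetric n N) (c : ℝ × M → N) (t : ℝ) (x : M) : ℝ :=
  g.inner (c (t, x)) (normalPart (m := m) g (fun x => c (t, x)) x (velocity n c t x))
    (normalPart (m := m) g (fun x => c (t, x)) x (velocity n c t x))

variable {c : ℝ × M → N} (hc : ContMDiff (𝓘(ℝ, ℝ).prod (𝓡 m)) (𝓡 n) ∞ c)
include hc

lemma hasDerivAt_pathDensity (g : RMetric n N) {t : ℝ}
    (ht : IsSmoothImmersion m n fun x => c (t, x)) {x₀ : M} {u : 𝓔 m}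
    (hu : u ∈ (extChartAt (𝓡 m) x₀).target) :
    HasDerivAt (fun s => pathDensity g c x₀ (s, u)) (fderiv ℝ (pathDensity g c x₀) (t, u) (1, 0)) t := by
  have h1 : HasFDerivAt (fun s : ℝ => ((s, u) : ℝ × 𝓔 m)) (ContinuousLinearMap.inl ℝ ℝ (𝓔 m)) t :=
    hasFDerivAt_prodMk_left t u
  have h2 := HasFDerivAt.comp (f := fun s : ℝ => ((s, u) : ℝ × 𝓔 m)) t
    ((contDiffAt_pathDensity hc g ht hu).differentiableAt (by simp)).hasFDerivAt h1
  refine (hasFDerivAt_iff_hasDerivAt.1 h2).congr_deriv ?_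
  simp

/-- Uniqueness of derivatives identifies the geometric formula with a partial derivative of a
jointly smooth function, which supplies the continuity and the bounds used below. -/
lemma fderiv_pathDensity (g : RMetric n N) {t : ℝ} (ht : IsSmoothImmersion m n fun x => c (t, x))
    {x₀ x : M} (hx : x ∈ (extChartAt (𝓡 m) x₀).source) :
    fderiv ℝ (pathDensity g c x₀) (t, extChartAt (𝓡 m) x₀ x) (1, 0) =
      ∑ i, fderiv ℝ (tangentialFlux g c x₀ t i) (extChartAt (𝓡 m) x₀ x) (e i) -
        pathDensity g c x₀ (t, extChartAt (𝓡 m) x₀ x) * meanNormal (m := m) g c t x :=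
  (hasDerivAt_pathDensity hc g ht ((extChartAt (𝓡 m) x₀).map_source hx)).unique
    (hasDerivAt_density hc g ht hx)

lemma continuousAt_fderiv_pathDensity (g : RMetric n N) {t : ℝ}
    (ht : IsSmoothImmersion m n fun x => c (t, x)) {x₀ : M} {u : 𝓔 m}
    (hu : u ∈ (extChartAt (𝓡 m) x₀).target) :
    ContinuousAt (fun p => fderiv ℝ (pathDensity g c x₀) p (1, 0)) (t, u) :=
  ((contDiffAt_pathDensity hc g ht hu).fderiv_right (m := 0)
    (by norm_cast)).continuousAt.clm_apply continuousAt_const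

lemma continuous_meanNormal (g : RMetric n N) {t : ℝ}
    (ht : IsSmoothImmersion m n fun x => c (t, x)) : Continuous (meanNormal (m := m) g c t) := by
  refine continuous_iff_continuousAt.2 fun x₀ => ?_
  have hx := mem_extChartAt_source (I := 𝓡 m) x₀
  have hu := (extChartAt (𝓡 m) x₀).map_source hx
  have hι : ContinuousAt (fun u' : 𝓔 m => ((t, u') : ℝ × 𝓔 m)) (extChartAt (𝓡 m) x₀ x₀) :=
    continuousAt_const.prodMk continuousAt_id
  have hpos : ∀ u ∈ (extChartAt (𝓡 m) x₀).target, pathDensity g c x₀ (t, u) ≠ 0 := fun u hu =>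
    (Real.sqrt_pos.2 (spatialForm_det_pos hc g ht hu)).ne'
  -- The first variation formula is solved for the pairing of mean curvature and normal velocity:
  -- every other term in it is continuous and the density is nonzero.
  have h : ContinuousAt (fun u => (∑ i, fderiv ℝ (tangentialFlux g c x₀ t i) u (e i) -
      fderiv ℝ (pathDensity g c x₀) (t, u) (1, 0)) / pathDensity g c x₀ (t, u))
      (extChartAt (𝓡 m) x₀ x₀) := by
    refine ContinuousAt.div (ContinuousAt.sub ?_ ?_) ?_ (hpos _ hu)
    · exact tendsto_finsetSum _ fun i _ => ((contDiffAt_tangentialFlux hc g ht hu i).fderiv_right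
        (m := 0) (by norm_cast)).continuousAt.clm_apply continuousAt_const
    · exact ContinuousAt.comp (f := fun u' : 𝓔 m => ((t, u') : ℝ × 𝓔 m))
        (continuousAt_fderiv_pathDensity hc g ht hu) hι
    · exact ContinuousAt.comp (f := fun u' : 𝓔 m => ((t, u') : ℝ × 𝓔 m))
        (contDiffAt_pathDensity hc g ht hu).continuousAt hι
  refine (h.comp (continuousAt_extChartAt (I := 𝓡 m) x₀)).congr ?_
  filter_upwards [(isOpen_extChartAt_source (I := 𝓡 m) x₀).mem_nhds hx] with y hy
  have hy' := hpos _ ((extChartAt (𝓡 m) x₀).map_source hy)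
  rw [Function.comp_apply, fderiv_pathDensity hc g ht hy]
  field_simp
  ring

lemma continuous_normalSq (g : RMetric n N) {t : ℝ}
    (ht : IsSmoothImmersion m n fun x => c (t, x)) : Continuous (normalSq (m := m) g c t) := by
  refine continuous_iff_continuousAt.2 fun x₀ => ?_
  have hx := mem_extChartAt_source (I := 𝓡 m) x₀
  have hu := (extChartAt (𝓡 m) x₀).map_source hx
  have hι : ContinuousAt (fun u' : 𝓔 m => ((t, u') : ℝ × 𝓔 m)) (extChartAt (𝓡 m) x₀ x₀) :=
    continuousAt_const.prodMk continuousAt_id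
  have hD : ∀ v w, ContinuousAt (fun u =>
      pullForm (V := ℝ × 𝓔 m) g (localPath c x₀) (t, u) v w) (extChartAt (𝓡 m) x₀ x₀) :=
    fun v w => ContinuousAt.comp (f := fun u' : 𝓔 m => ((t, u') : ℝ × 𝓔 m))
      (g := fun p => pullForm (V := ℝ × 𝓔 m) g (localPath c x₀) p v w)
      (contDiffAt_pathForm_apply hc g t hu v w).continuousAt hι
  have h : ContinuousAt (fun u => pullForm (V := ℝ × 𝓔 m) g (localPath c x₀) (t, u) (1, 0) (1, 0) -
      formTrace (formMatrix (spatialForm (pullForm g (localPath c x₀)) t u))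
        (fun v w => pullForm (V := ℝ × 𝓔 m) g (localPath c x₀) (t, u) (1, 0) (0, v)
          * pullForm (V := ℝ × 𝓔 m) g (localPath c x₀) (t, u) (1, 0) (0, w)))
      (extChartAt (𝓡 m) x₀ x₀) := by
    unfold formTrace
    refine (hD _ _).sub (tendsto_finsetSum _ fun i _ => tendsto_finsetSum _ fun j _ => ?_)
    refine ContinuousAt.mul ?_ ((hD _ _).mul (hD _ _))
    exact ContinuousAt.comp (f := fun u' : 𝓔 m => ((t, u') : ℝ × 𝓔 m))
      (contDiffAt_spatialForm_inv hc g ht hu i j).continuousAt hι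
  refine (h.comp (continuousAt_extChartAt (I := 𝓡 m) x₀)).congr ?_
  filter_upwards [(isOpen_extChartAt_source (I := 𝓡 m) x₀).mem_nhds hx] with y hy
  exact (inner_normal_velocity hc g ht hy).symm

end NormalVelocity

/-! ### First variation of the total volume. -/

section VolumeDerivative

open MeasureTheory

variable {m n : ℕ} {M : Type*} [TopologicalSpace M] [ChartedSpace (𝓔 m) M] [IsManifold (𝓡 m) ∞ M]
  [CompactSpace M] [T2Space M]
  {N : Type*} [TopologicalSpace N] [ChartedSpace (𝓔 n) N] [IsManifold (𝓡 n) ∞ N]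

/-- The part of the volume along a path that the chart at `a` contributes. -/
def chartVol (g : RMetric n N) (c : ℝ × M → N) (a : M) (t : ℝ) : ℝ :=
  ∫ u in (extChartAt (𝓡 m) a).target,
    chartPartition m M a ((extChartAt (𝓡 m) a).symm u) * pathDensity g c a (t, u)

lemma continuousOn_chartPartition_chart (a : M) :
    ContinuousOn (fun u => chartPartition m M a ((extChartAt (𝓡 m) a).symm u))
      (extChartAt (𝓡 m) a).target :=
  (contMDiff_chartPartition a).continuous.comp_continuousOn (continuousOn_chart_symm a)

/-- A continuous function on a compact interval times a chart is dominated by the partition of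
unity. -/
lemma exists_chartPartition_bound (a : M) {F : ℝ × 𝓔 m → ℝ}
    (hF : ∀ t ∈ Set.Icc (0 : ℝ) 1, ∀ u ∈ (extChartAt (𝓡 m) a).target, ContinuousAt F (t, u)) :
    ∃ C, ∀ t ∈ Set.Icc (0 : ℝ) 1, ∀ u ∈ (extChartAt (𝓡 m) a).target,
      ‖chartPartition m M a ((extChartAt (𝓡 m) a).symm u) * F (t, u)‖ ≤
        chartPartition m M a ((extChartAt (𝓡 m) a).symm u) * C := by
  obtain ⟨C, hC⟩ := ((isCompact_Icc (a := (0 : ℝ)) (b := 1)).prod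
    (isCompact_chartCompact (m := m) a)).exists_bound_of_continuousOn (f := F)
    fun p hp => (hF p.1 hp.1 p.2 (chartCompact_subset a hp.2)).continuousWithinAt
  refine ⟨C, fun t ht u hu => ?_⟩
  by_cases huK : u ∈ chartCompact m a
  · rw [norm_mul, Real.norm_of_nonneg (chartPartition_nonneg _ _)]
    exact mul_le_mul_of_nonneg_left (hC (t, u) ⟨ht, huK⟩) (chartPartition_nonneg _ _)
  · rw [chartPartition_eq_zero_of_notMem_chartCompact hu huK]
    simp

lemma integrableOn_chartPartition_mul (a : M) {F : 𝓔 m → ℝ}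
    (hF : ContinuousOn F (extChartAt (𝓡 m) a).target) :
    IntegrableOn (fun u => chartPartition m M a ((extChartAt (𝓡 m) a).symm u) * F u)
      (extChartAt (𝓡 m) a).target :=
  integrableOn_chart ((continuousOn_chartPartition_chart a).mul hF) fun u hu huK => by
    simp only [chartPartition_eq_zero_of_notMem_chartCompact hu huK, zero_mul]

variable {c : ℝ × M → N} (hc : ContMDiff (𝓘(ℝ, ℝ).prod (𝓡 m)) (𝓡 n) ∞ c)
include hc

/-- Derivatives are available only for `0 < t < 1`; continuity up to the endpoints is what lets the
inequality be integrated over `[0, 1]`. -/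
lemma continuousOn_chartVol (g : RMetric n N)
    (hT : ∀ t ∈ Set.Icc (0 : ℝ) 1, IsSmoothImmersion m n fun x => c (t, x)) (a : M) :
    ContinuousOn (chartVol (m := m) g c a) (Set.Icc 0 1) := by
  have hmt : MeasurableSet (extChartAt (𝓡 m) a).target := (isOpen_extChartAt_target (I := 𝓡 m) a).measurableSet
  have hW : ∀ t ∈ Set.Icc (0 : ℝ) 1, ∀ u ∈ (extChartAt (𝓡 m) a).target,
      ContinuousAt (pathDensity g c a) (t, u) := fun t ht u hu =>
    (contDiffAt_pathDensity hc g (hT t ht) hu).continuousAt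
  obtain ⟨C, hC⟩ := exists_chartPartition_bound a hW
  refine continuousOn_of_dominated (fun t ht => ?_)
    (fun t ht => (ae_restrict_iff' hmt).2 (.of_forall fun u hu => hC t ht u hu))
    (integrableOn_chartPartition_mul a continuousOn_const)
    ((ae_restrict_iff' hmt).2 (.of_forall fun u hu => ?_))
  · refine (integrableOn_chartPartition_mul a fun u hu => ?_).aestronglyMeasurable
    exact (ContinuousAt.comp (f := fun u' : 𝓔 m => ((t, u') : ℝ × 𝓔 m)) (hW t ht u hu)
      (continuousAt_const.prodMk continuousAt_id)).continuousWithinAt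
  · exact fun t ht => (continuousAt_const.mul
      (ContinuousAt.comp (f := fun s : ℝ => ((s, u) : ℝ × 𝓔 m)) (hW t ht u hu)
        (continuousAt_id.prodMk continuousAt_const))).continuousWithinAt

lemma hasDerivAt_chartVol (g : RMetric n N)
    (hT : ∀ t ∈ Set.Icc (0 : ℝ) 1, IsSmoothImmersion m n fun x => c (t, x)) (a : M) {t : ℝ}
    (ht : t ∈ Set.Ioo (0 : ℝ) 1) :
    HasDerivAt (chartVol (m := m) g c a) (∫ u in (extChartAt (𝓡 m) a).target,
      chartPartition m M a ((extChartAt (𝓡 m) a).symm u) *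
        fderiv ℝ (pathDensity g c a) (t, u) (1, 0)) t := by
  have hmt : MeasurableSet (extChartAt (𝓡 m) a).target := (isOpen_extChartAt_target (I := 𝓡 m) a).measurableSet
  have hW : ∀ t ∈ Set.Icc (0 : ℝ) 1, ∀ u ∈ (extChartAt (𝓡 m) a).target,
      ContinuousAt (pathDensity g c a) (t, u) := fun t ht u hu =>
    (contDiffAt_pathDensity hc g (hT t ht) hu).continuousAt
  have hW' : ∀ t ∈ Set.Icc (0 : ℝ) 1, ∀ u ∈ (extChartAt (𝓡 m) a).target,
      ContinuousAt (fun p => fderiv ℝ (pathDensity g c a) p (1, 0)) (t, u) := fun t ht u hu =>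
    continuousAt_fderiv_pathDensity hc g (hT t ht) hu
  have hint : ∀ {F : ℝ × 𝓔 m → ℝ}, (∀ t ∈ Set.Icc (0 : ℝ) 1,
      ∀ u ∈ (extChartAt (𝓡 m) a).target, ContinuousAt F (t, u)) → ∀ t ∈ Set.Icc (0 : ℝ) 1,
      IntegrableOn (fun u => chartPartition m M a ((extChartAt (𝓡 m) a).symm u) * F (t, u))
        (extChartAt (𝓡 m) a).target := fun hF t ht =>
    integrableOn_chartPartition_mul a fun u hu =>
      (ContinuousAt.comp (f := fun u' : 𝓔 m => ((t, u') : ℝ × 𝓔 m)) (hF t ht u hu)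
        (continuousAt_const.prodMk continuousAt_id)).continuousWithinAt
  obtain ⟨C, hC⟩ := exists_chartPartition_bound a hW'
  have hIcc := Set.Ioo_subset_Icc_self (a := (0 : ℝ)) (b := 1)
  -- The immersion property, hence positivity of the density, is known only on `[0, 1]`, so the
  -- neighbourhood for the dominated derivative is the open interval.
  refine (hasDerivAt_integral_of_dominated_loc_of_deriv_le (s := Set.Ioo 0 1)
    (F := fun t u => chartPartition m M a ((extChartAt (𝓡 m) a).symm u) * pathDensity g c a (t, u))
    (F' := fun t u => chartPartition m M a ((extChartAt (𝓡 m) a).symm u) *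
        fderiv ℝ (pathDensity g c a) (t, u) (1, 0))
    (bound := fun u => chartPartition m M a ((extChartAt (𝓡 m) a).symm u) * C)
    (isOpen_Ioo.mem_nhds ht) ?_ (hint hW t (hIcc ht))
    (hint hW' t (hIcc ht)).aestronglyMeasurable
    ((ae_restrict_iff' hmt).2 (.of_forall fun u hu s hs => hC s (hIcc hs) u hu))
    (integrableOn_chartPartition_mul a continuousOn_const)
    ((ae_restrict_iff' hmt).2 (.of_forall fun u hu s hs =>
      (hasDerivAt_pathDensity hc g (hT s (hIcc hs)) hu).const_mul _))).2
  filter_upwards [isOpen_Ioo.mem_nhds ht] with s hs using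
    (hint hW s (hIcc hs)).aestronglyMeasurable

variable [MeasurableSpace M] [BorelSpace M]

lemma Vol_slice (g : RMetric n N) (t : ℝ) :
    Vol (m := m) g (fun x => c (t, x)) = ∑ a ∈ chartIndices m M, chartVol (m := m) g c a t := by
  rw [Vol_eq_sum g (contMDiff_slice hc t)]
  refine Finset.sum_congr rfl fun a _ => ?_
  exact setIntegral_congr_fun (isOpen_extChartAt_target (I := 𝓡 m) a).measurableSet fun u hu =>
    congrArg _ (pathDensity_eq hc g t hu).symm

lemma continuousOn_Vol (g : RMetric n N)
    (hT : ∀ t ∈ Set.Icc (0 : ℝ) 1, IsSmoothImmersion m n fun x => c (t, x)) :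
    ContinuousOn (fun t => Vol (m := m) g fun x => c (t, x)) (Set.Icc 0 1) := by
  simp only [Vol_slice hc g]
  exact continuousOn_finsetSum _ fun a _ => continuousOn_chartVol hc g hT a

/-- The first variation of the volume. -/
lemma hasDerivAt_Vol (g : RMetric n N)
    (hT : ∀ t ∈ Set.Icc (0 : ℝ) 1, IsSmoothImmersion m n fun x => c (t, x)) {t : ℝ}
    (ht : t ∈ Set.Ioo (0 : ℝ) 1) :
    HasDerivAt (fun t => Vol (m := m) g fun x => c (t, x))
      (-∫ x, meanNormal (m := m) g c t x ∂(volMeasure (m := m) g fun x => c (t, x))) t := by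
  simp only [Vol_slice hc g]
  have htI := hT t (Set.Ioo_subset_Icc_self ht)
  refine (HasDerivAt.fun_sum fun a _ => hasDerivAt_chartVol hc g hT a ht).congr_deriv ?_
  -- The vanishing sum of divergence integrals is inserted for `0`, so that the identity can be
  -- checked chart by chart with `fderiv_pathDensity`.
  rw [integral_volMeasure g htI.1 (continuous_meanNormal hc g htI), ← zero_sub,
    ← sum_integral_divergence hc g htI, ← Finset.sum_sub_distrib]
  refine Finset.sum_congr rfl fun a _ => ?_
  rw [← integral_sub]
  · refine setIntegral_congr_fun (isOpen_extChartAt_target (I := 𝓡 m) a).measurableSet fun u hu => ?_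
    have h := fderiv_pathDensity hc g htI ((extChartAt (𝓡 m) a).map_target hu)
    rw [(extChartAt (𝓡 m) a).right_inv hu] at h
    simp only [h, ← pathDensity_eq hc g t hu]
    ring
  · exact integrableOn_chartPartition_mul a (continuousOn_finsetSum _ fun i _ u hu =>
      (((contDiffAt_tangentialFlux hc g htI hu i).fderiv_right (m := 0)
        (by norm_cast)).continuousAt.clm_apply continuousAt_const).continuousWithinAt)
  · have h := integrableOn_chartPartition_mul a ((continuousOn_chart_density g htI.1 a).mul
      ((continuous_meanNormal hc g htI).comp_continuousOn (continuousOn_chart_symm (m := m) a)))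
    refine h.congr (.of_forall fun u => ?_)
    simp only [Function.comp_apply, Pi.mul_apply]
    ring

end VolumeDerivative

/-! ### Cauchy-Schwarz and integration of the differential inequality. -/

section Estimate

open MeasureTheory

variable {m n : ℕ} {M : Type*} [TopologicalSpace M] [ChartedSpace (𝓔 m) M] [IsManifold (𝓡 m) ∞ M]
  [CompactSpace M] [T2Space M] [MeasurableSpace M] [BorelSpace M]
  {N : Type*} [TopologicalSpace N] [ChartedSpace (𝓔 n) N] [IsManifold (𝓡 n) ∞ N]

lemma inner_self_nonneg (g : RMetric n N) (q : N) (v : TangentSpace (𝓡 n) q) :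
    0 ≤ g.inner q v v := by
  rcases eq_or_ne v 0 with rfl | hv
  · simp
  · exact (g.pos q v hv).le

/-- Cauchy-Schwarz from the discriminant of the nonnegative quadratic `s ↦ g(v - s w, v - s w)`. -/
lemma inner_sq_le (g : RMetric n N) (q : N) (v w : TangentSpace (𝓡 n) q) :
    g.inner q v w ^ 2 ≤ g.inner q v v * g.inner q w w := by
  have h := discrim_le_zero (a := g.inner q w w) (b := -2 * g.inner q v w) (c := g.inner q v v)
    fun s => by
      have h1 := inner_self_nonneg g q (v - s • w)
      simp only [map_sub, map_smul, sub_apply, smul_apply, smul_eq_mul] at h1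
      rw [g.symm q w v] at h1
      linarith
  rw [discrim] at h
  linarith

variable {c : ℝ × M → N} (hc : ContMDiff (𝓘(ℝ, ℝ).prod (𝓡 m)) (𝓡 n) ∞ c)
include hc

/-- Two uses of Cauchy-Schwarz: the square of the integral of `r = g(Tr S, f_t^⊥)` is at most `Vol ·
∫ r²`, and `A r² ≤ A ‖Tr S‖² ‖f_t^⊥‖²` is at most the integrand of `G^A`, which has the extra
summand `‖f_t^⊥‖² ≥ 0`. -/
lemma sq_integral_meanNormal_le (g : RMetric n N) {A : ℝ} (hA : 0 < A) {t : ℝ}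
    (ht : IsSmoothImmersion m n fun x => c (t, x)) :
    (∫ x, meanNormal (m := m) g c t x ∂(volMeasure (m := m) g fun x => c (t, x))) ^ 2 ≤
      Vol (m := m) g (fun x => c (t, x)) *
        (GA (m := m) g A (fun x => c (t, x))
          (fun x => normalPart (m := m) g (fun x => c (t, x)) x (velocity n c t x))
          (fun x => normalPart (m := m) g (fun x => c (t, x)) x (velocity n c t x)) / A) := by
  set μ := volMeasure (m := m) g fun x => c (t, x) with hμ
  have := isFiniteMeasure_volMeasure (m := m) g ht.1
  have hr := continuous_meanNormal hc g ht
  have hi : ∀ {h : M → ℝ}, Continuous h → Integrable h μ := fun hh =>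
    integrable_volMeasure g ht.1 hh
  -- The quadratic in `s` is `∫ (s - r)² ≥ 0`, whose leading coefficient is the volume.
  have h1 := discrim_le_zero (a := Vol (m := m) g fun x => c (t, x))
    (b := -2 * ∫ x, meanNormal (m := m) g c t x ∂μ) (c := ∫ x, meanNormal (m := m) g c t x ^ 2 ∂μ)
    fun s => by
      have h0 : 0 ≤ ∫ x, (s - meanNormal (m := m) g c t x) ^ 2 ∂μ :=
        integral_nonneg fun x => sq_nonneg _
      have h2 : ∫ x, (s - meanNormal (m := m) g c t x) ^ 2 ∂μ =
          (s * s) * Vol (m := m) g (fun x => c (t, x)) -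
            2 * s * (∫ x, meanNormal (m := m) g c t x ∂μ) +
            ∫ x, meanNormal (m := m) g c t x ^ 2 ∂μ := by
        have h3 : ∀ x, (s - meanNormal (m := m) g c t x) ^ 2 =
            s * s - 2 * s * meanNormal (m := m) g c t x + meanNormal (m := m) g c t x ^ 2 :=
          fun x => by ring
        simp only [h3]
        have i1 : Integrable (fun _ : M => s * s) μ := hi continuous_const
        have i2 : Integrable (fun x => 2 * s * meanNormal (m := m) g c t x) μ :=
          hi (continuous_const.mul hr)
        have i3 : Integrable (fun x => meanNormal (m := m) g c t x ^ 2) μ := hi (hr.pow 2)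
        have i4 : Integrable (fun x => s * s - 2 * s * meanNormal (m := m) g c t x) μ := i1.sub i2
        rw [integral_add i4 i3, integral_sub i1 i2, integral_const,
          integral_const_mul, smul_eq_mul, mul_comm (μ.real _)]
        rfl
      linarith
  rw [discrim] at h1
  have h2 : (∫ x, meanNormal (m := m) g c t x ∂μ) ^ 2 ≤ Vol (m := m) g (fun x => c (t, x)) *
      ∫ x, meanNormal (m := m) g c t x ^ 2 ∂μ := by linarith
  refine h2.trans (mul_le_mul_of_nonneg_left ?_ measureReal_nonneg)
  rw [le_div_iff₀ hA, ← integral_mul_const]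
  have hp := continuous_inner_meanCurvature g ht
  refine integral_mono (hi ((hr.pow 2).mul continuous_const))
    (hi ((continuous_const.add (continuous_const.mul hp)).mul (continuous_normalSq hc g ht)))
    fun x => ?_
  have h3 := inner_sq_le g (c (t, x)) (meanCurvature (m := m) g (fun x => c (t, x)) x)
    (normalPart (m := m) g (fun x => c (t, x)) x (velocity n c t x))
  have h4 := inner_self_nonneg g (c (t, x))
    (normalPart (m := m) g (fun x => c (t, x)) x (velocity n c t x))
  have h5 := mul_le_mul_of_nonneg_right h3 hA.le
  simp only [meanNormal]
  rw [add_mul, one_mul]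
  linarith

lemma sqrt_Vol_sub_le_horLength (g : RMetric n N)
    (hT : ∀ t ∈ Set.Icc (0 : ℝ) 1, IsSmoothImmersion m n fun x => c (t, x)) {A : ℝ} (hA : 0 < A) :
    ENNReal.ofReal (2 * √A * (√(Vol (m := m) g fun x => c (1, x)) -
      √(Vol (m := m) g fun x => c (0, x)))) ≤ horLength (m := m) g A c := by
  set V : ℝ → ℝ := fun t => Vol (m := m) g fun x => c (t, x) with hV
  set G : ℝ → ℝ := fun t => GA (m := m) g A (fun x => c (t, x))
    (fun x => normalPart (m := m) g (fun x => c (t, x)) x (velocity n c t x))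
    (fun x => normalPart (m := m) g (fun x => c (t, x)) x (velocity n c t x)) with hG
  have hL : horLength (m := m) g A c = ∫⁻ t in Set.Icc (0 : ℝ) 1, ENNReal.ofReal √(G t) := rfl
  have hV0 : ∀ t, 0 ≤ V t := fun t => measureReal_nonneg
  have hVc : ContinuousOn V (Set.Icc 0 1) := continuousOn_Vol hc g hT
  have hA' := Real.sqrt_pos.2 hA
  rcases eq_or_ne (horLength (m := m) g A c) ⊤ with htop | htop
  · rw [htop]; exact le_top
  refine ENNReal.ofReal_le_of_le_toReal ?_
  have key : ∀ δ : ℝ, 0 < δ → √(V 1) - √(V 0) ≤ (horLength (m := m) g A c).toReal / (2 * √A) + δ := by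
    intro δ hδ
    -- The shift by `δ²` keeps the argument of the root positive, so positivity of the volume need
    -- not be known. It costs at most `δ` at `t = 0`, and `δ` is arbitrary.
    set φ : ℝ → ℝ := fun t => √(V t + δ ^ 2) with hφ
    have hpos : ∀ t, 0 < V t + δ ^ 2 := fun t => by have := hV0 t; positivity
    have hφd : ∀ t ∈ Set.Ioo (0 : ℝ) 1, HasDerivAt φ (deriv φ t) t ∧
        deriv φ t ≤ √(G t) / (2 * √A) := by
      intro t ht
      have htI := hT t (Set.Ioo_subset_Icc_self ht)
      have h1 : HasDerivAt φ _ t := ((hasDerivAt_Vol hc g hT ht).add_const (δ ^ 2)).sqrt (hpos t).ne'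
      refine ⟨h1.differentiableAt.hasDerivAt, ?_⟩
      rw [h1.deriv]
      set I := ∫ x, meanNormal (m := m) g c t x ∂(volMeasure (m := m) g fun x => c (t, x)) with hI
      have hS : 0 < √(V t + δ ^ 2) := Real.sqrt_pos.2 (hpos t)
      have h2 : I ^ 2 ≤ V t * (G t / A) := sq_integral_meanNormal_le hc g hA htI
      have hG0 : 0 ≤ G t / A := by
        have hp := continuous_inner_meanCurvature g htI
        refine div_nonneg (integral_nonneg fun x => mul_nonneg ?_ (inner_self_nonneg g _ _)) hA.le
        have := inner_self_nonneg g (c (t, x)) (meanCurvature (m := m) g (fun x => c (t, x)) x)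
        positivity
      have h3 : -I ≤ √(V t + δ ^ 2) * (√(G t) / √A) := by
        rw [← Real.sqrt_div' _ hA.le, ← Real.sqrt_mul (hpos t).le]
        refine (neg_le_abs I).trans (Real.abs_le_sqrt (h2.trans ?_))
        exact mul_le_mul_of_nonneg_right (by nlinarith [sq_nonneg δ]) hG0
      change -I / (2 * √(V t + δ ^ 2)) ≤ _
      rw [div_le_iff₀ (by positivity)]
      refine h3.trans (le_of_eq ?_)
      field_simp
    -- The positive part of `φ'` is measurable and, since the length is finite, integrable; it is
    -- used as the upper bound for `φ'` in the fundamental theorem of calculus, where integrability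
    -- of `φ'` itself is not needed.
    have hψm : Measurable fun t => max (deriv φ t) 0 := (measurable_deriv φ).max measurable_const
    have hle : ∫⁻ t in Set.Icc (0 : ℝ) 1, ENNReal.ofReal (max (deriv φ t) 0) ≤
        ENNReal.ofReal (1 / (2 * √A)) * horLength (m := m) g A c := by
      -- Endpoints are discarded because the bound on `φ'` holds only inside the interval.
      -- Measurability of `t ↦ √(G t)` is not required: a finite constant can be moved through the
      -- lower integral of any function, and monotonicity holds for any functions.
      rw [hL, ← lintegral_const_mul' _ _ ENNReal.ofReal_ne_top,
        setLIntegral_congr Ioo_ae_eq_Icc.symm, setLIntegral_congr Ioo_ae_eq_Icc.symm]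
      refine setLIntegral_mono' measurableSet_Ioo fun t ht => ?_
      rw [← ENNReal.ofReal_mul (by positivity)]
      refine ENNReal.ofReal_le_ofReal (max_le ((hφd t ht).2.trans (le_of_eq (by ring))) (by positivity))
    have hfin : ENNReal.ofReal (1 / (2 * √A)) * horLength (m := m) g A c ≠ ⊤ :=
      ENNReal.mul_ne_top ENNReal.ofReal_ne_top htop
    have hint : IntegrableOn (fun t => max (deriv φ t) 0) (Set.Icc 0 1) :=
      ⟨hψm.aestronglyMeasurable, (hasFiniteIntegral_iff_ofReal
        (.of_forall fun t => le_max_right _ _)).2 (lt_of_le_of_lt hle hfin.lt_top)⟩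
    have hmain := intervalIntegral.sub_le_integral_of_hasDeriv_right_of_le zero_le_one
      (g := φ) (g' := deriv φ) (φ := fun t => max (deriv φ t) 0)
      ((hVc.add continuousOn_const).sqrt) (fun t ht => (hφd t ht).1.hasDerivWithinAt) hint
      fun t _ => le_max_left _ _
    rw [intervalIntegral.integral_of_le zero_le_one, ← integral_Icc_eq_integral_Ioc,
      integral_eq_lintegral_of_nonneg_ae (f := fun t => max (deriv φ t) 0)
        (.of_forall fun t => le_max_right _ _) hψm.aestronglyMeasurable] at hmain
    have h4 := ENNReal.toReal_mono hfin hle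
    rw [ENNReal.toReal_mul, ENNReal.toReal_ofReal (by positivity)] at h4
    have h5 : √(V 1) ≤ φ 1 := Real.sqrt_le_sqrt (by nlinarith [sq_nonneg δ])
    have h6 : φ 0 ≤ √(V 0) + δ := by
      refine Real.sqrt_le_iff.2 ⟨by positivity, ?_⟩
      have := Real.sq_sqrt (hV0 0)
      nlinarith [Real.sqrt_nonneg (V 0), mul_nonneg (Real.sqrt_nonneg (V 0)) hδ.le]
    have h7 : 1 / (2 * √A) * (horLength (m := m) g A c).toReal =
      (horLength (m := m) g A c).toReal / (2 * √A) := by ring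
    linarith
  have h := le_of_forall_pos_le_add key
  rw [le_div_iff₀ (by positivity)] at h
  linarith

omit hc in
lemma sqrt_volBi_sub_le_distBi (g : RMetric n N) {A : ℝ} (hA : 0 < A) (F₀ F₁ : Bi m n M N) :
    ENNReal.ofReal (2 * √A * (√(volBi (m := m) g F₁) - √(volBi (m := m) g F₀))) ≤
      distBi (m := m) g A F₀ F₁ := by
  refine le_iInf fun f₀ => le_iInf fun h₀ => le_iInf fun f₁ => le_iInf fun h₁ => le_iInf fun c =>
    le_iInf fun hc => ?_
  rw [← h₀, ← h₁, volBi_proj, volBi_proj]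
  have h := sqrt_Vol_sub_le_horLength hc.smooth g hc.immersion hA
  rwa [show (fun x => c (0, x)) = f₀.1 from funext hc.source,
    show (fun x => c (1, x)) = f₁.1 from funext hc.target] at h

end Estimate

end ImmersionSpace

end

theorem mainTheorem4 {m n : ℕ} (hm : 1 ≤ m) (hmn : m < n)
    {M : Type*} [TopologicalSpace M] [ChartedSpace (EuclideanSpace ℝ (Fin m)) M]
    [IsManifold (𝓡 m) ∞ M] [CompactSpace M] [T2Space M] [ConnectedSpace M]
    [MeasurableSpace M] [BorelSpace M]
    {N : Type*} [TopologicalSpace N] [ChartedSpace (EuclideanSpace ℝ (Fin n)) N]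
    [IsManifold (𝓡 n) ∞ N] [T2Space N] [SecondCountableTopology N] [ConnectedSpace N]
    (g : ImmersionSpace.RMetric n N) :
    (∀ f : ImmersionSpace.Imm m n M N,
      ImmersionSpace.volBi g (ImmersionSpace.proj f) = ImmersionSpace.Vol (m := m) g f.1) ∧
    ∀ A : ℝ, 0 < A → ∀ F₀ F₁ : ImmersionSpace.Bi m n M N,
      ((√(ImmersionSpace.volBi g F₁) - √(ImmersionSpace.volBi g F₀) : ℝ) : EReal) ≤
        ((1 / (2 * √A) : ℝ) : EReal) * (ImmersionSpace.distBi g A F₀ F₁ : EReal) := by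
  refine ⟨fun f => ImmersionSpace.volBi_proj g f, fun A hA F₀ F₁ => ?_⟩
  have hA' := Real.sqrt_pos.2 hA
  have h : ((2 * √A * (√(ImmersionSpace.volBi g F₁) - √(ImmersionSpace.volBi g F₀)) : ℝ) : EReal) ≤
      (ImmersionSpace.distBi g A F₀ F₁ : EReal) := by
    -- The estimate in `ℝ≥0∞` truncates a negative left side to `0`, and a real number is at most
    -- its truncation, so the signed inequality follows.
    refine le_trans ?_ (EReal.coe_ennreal_le_coe_ennreal_iff.2
      (ImmersionSpace.sqrt_volBi_sub_le_distBi g hA F₀ F₁))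
    rw [EReal.coe_ennreal_ofReal]
    exact EReal.coe_le_coe_iff.2 (le_max_left _ _)
  refine le_trans (le_of_eq ?_) (mul_le_mul_of_nonneg_left h
    (EReal.coe_nonneg.2 (by positivity)))
  rw [← EReal.coe_mul]
  congr 1
  field_simp
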